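/- There are a universal constant $b>1$ and, for every $\sigma_x>0$, a constant $c>1$ depending only on $\sigma_x$ (and $b$), such that the following holds. Let $n<p$ and let $k$ be an integer with $0<k<n/c$ (and $k<p$). *Setting.* Let $\mathcal D_s,\mathcal D_t$ be probability distributions on $\mathbb R^p$ with finite second moments, $\mathcal D_s$ centered, and let $\Sigma_s=\mathbb E_{\mathcal D_s}[xx^\top]$, $\Sigma_t=\mathbb E_{\mathcal D_t}[xx^\top]$. Suppose that for some orthogonal matrix $U$ we have $U^\top\Sigma_sU=\mathrm{diag}(\lambda_1,\dots,\lambda_p)$ with $\lambda_1\ge\dots\ge\lambda_p>0$ and $U^\top\Sigma_tU=\mathrm{diag}(\tilde\lambda_1,\dots,\tilde\lambda_p)$ (with the $\tilde\lambda_i\ge0$ in any order). Suppose that for $x\sim\mathcal D_s$ the whitened vector $z=\mathrm{diag}(\lambda_1,\dots,\lambda_p)^{-1/2}U^\top x$ has independent coordinates and satisfies $\mathbb E\exp(\gamma^\top z)\le\exp(\sigma_x^2\|\gamma\|^2/2)$ for all $\gamma\in\mathbb R^p$. Let $X\in\mathbb R^{n\times p}$ have i.i.d. rows drawn from $\mathcal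 D_s$. For $\xi\in\mathbb R^n$ let $\mathrm{MNI}(\xi)=X^\top(XX^\top)^{-1}\xi$ be the min-norm interpolator, that is, the minimizer of $\|\theta\|^2$ subject to $X\theta=\xi$; if $XX^\top$ is singular, $(XX^\top)^{-1}$ is read as the Moore–Penrose pseudo-inverse. Let $\varepsilon\in\mathbb R^n$ be a noise vector, independent of $X$, with i.i.d. centered components of variance $v^2>0$, and define $$V=\mathbb E_{\varepsilon}\left[\frac{\mathrm{MNI}(\varepsilon)^\top\,\Sigma_t\,\mathrm{MNI}(\varepsilon)}{v^2}\right],\qquad \rho_k=\frac{\sum_{i>k}\lambda_i}{n\,\lambda_{k+1}},$$ where the expectation is over $\varepsilon$ only, with $X$ fixed. *Lower bound.* With probability at least $1-10e^{-n/c}$ over $X$, $$V\ \ge\ \frac1{cn}\sum_{i=1}^p\frac{\tilde\lambda_i}{\lambda_i}\min\left(1,\ \frac{\lambda_i^2}{\lambda_{k+1}^2(\rho_k+1)^2}\right).$$ *Upper bound.* If in addition $\rho_k\ge b$, then with probability at least $1-7e^{-n/c}$ over $X$, $$V\ \le\ c\left[\frac1n\sum_{i=1}^k\frac{\tilde\lambda_i}{\lambda_i}+n\,\frac{\sum_{i>k}\tilde\lambda_i\lambda_i}{\left(\sum_{i>k}\lambda_i\right)^2}\right].$$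 -/

import Mathlib

open MeasureTheory ProbabilityTheory Matrix

/-- The Moore-Penrose pseudo-inverse `A⁺` of a symmetric matrix `A`: the nonzero eigenvalues are
inverted and the eigenvalue `0` is kept (`0⁻¹ = 0` in `ℝ`).
It is `A⁻¹` when `A` is invertible. -/
noncomputable def symPinv {n : ℕ} (A : Matrix (Fin n) (Fin n) ℝ) : Matrix (Fin n) (Fin n) ℝ :=
  cfc (fun t : ℝ => t⁻¹) A

/-- The minimum-norm interpolator `Xᵀ (X Xᵀ)⁻¹ ξ` of the labels `ξ`. For a data matrix `X` with
`X Xᵀ` singular, where some labels cannot be interpolated, `(X Xᵀ)⁻¹` is read as the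
pseudo-inverse (this is the minimum-norm least-squares solution). -/
noncomputable def mni {n p : ℕ} (X : Matrix (Fin n) (Fin p) ℝ) (ξ : Fin n → ℝ) : Fin p → ℝ :=
  Xᵀ *ᵥ (symPinv (X * Xᵀ) *ᵥ ξ)

theorem symPinv_eq_inv {n : ℕ} {A : Matrix (Fin n) (Fin n) ℝ} (hA : A.IsHermitian)
    (h : IsUnit A.det) : symPinv A = A⁻¹ := by
  have hU : IsUnit A := (Matrix.isUnit_iff_isUnit_det A).2 h
  obtain ⟨u, rfl⟩ := hU
  have hs : IsSelfAdjoint (u : Matrix (Fin n) (Fin n) ℝ) := hA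
  rw [symPinv, cfc_inv_id (R := ℝ) u hs, Matrix.coe_units_inv]

theorem mni_eq {n p : ℕ} {X : Matrix (Fin n) (Fin p) ℝ} (h : IsUnit (X * Xᵀ).det)
    (ξ : Fin n → ℝ) : mni X ξ = Xᵀ *ᵥ ((X * Xᵀ)⁻¹ *ᵥ ξ) := by
  have hA : (X * Xᵀ).IsHermitian := by
    simp [Matrix.IsHermitian, Matrix.conjTranspose_eq_transpose_of_trivial]
  rw [mni, symPinv_eq_inv hA h]

/-- When `X Xᵀ` is invertible, `mni X ξ` is the minimizer of `‖θ‖²` among the `θ` with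
`X θ = ξ`. -/
theorem mni_isArgmin {n p : ℕ} {X : Matrix (Fin n) (Fin p) ℝ} (h : IsUnit (X * Xᵀ).det)
    (ξ : Fin n → ℝ) : X *ᵥ mni X ξ = ξ ∧
      ∀ θ : Fin p → ℝ, X *ᵥ θ = ξ → θ ≠ mni X ξ → mni X ξ ⬝ᵥ mni X ξ < θ ⬝ᵥ θ := by
  have h1 : X *ᵥ mni X ξ = ξ := by
    rw [mni_eq h, Matrix.mulVec_mulVec, Matrix.mulVec_mulVec, Matrix.mul_nonsing_inv _ h,
      Matrix.one_mulVec]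
  refine ⟨h1, fun θ hθ hne => ?_⟩
  set m := mni X ξ with hm
  have h2 : m ⬝ᵥ (θ - m) = 0 := by
    have h3 : X *ᵥ (θ - m) = 0 := by rw [Matrix.mulVec_sub, hθ, h1, sub_self]
    have h4 : m = Xᵀ *ᵥ ((X * Xᵀ)⁻¹ *ᵥ ξ) := mni_eq h ξ
    have h4' : ∀ w : Fin p → ℝ, m ⬝ᵥ w = ((X * Xᵀ)⁻¹ *ᵥ ξ) ⬝ᵥ (X *ᵥ w) := fun w => by
      rw [h4, Matrix.mulVec_transpose, ← Matrix.dotProduct_mulVec]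
    rw [h4', h3, dotProduct_zero]
  have h5 : θ ⬝ᵥ θ = m ⬝ᵥ m + (θ - m) ⬝ᵥ (θ - m) := by
    have h6 : θ = m + (θ - m) := by abel
    conv_lhs => rw [h6]
    rw [add_dotProduct, dotProduct_add, dotProduct_add, dotProduct_comm (θ - m) m, h2]
    ring
  have h7 : 0 < (θ - m) ⬝ᵥ (θ - m) := by
    have h8 : 0 ≤ (θ - m) ⬝ᵥ (θ - m) := Finset.sum_nonneg fun i _ => mul_self_nonneg _
    refine lt_of_le_of_ne h8 fun h9 => hne ?_
    exact sub_eq_zero.1 (dotProduct_self_eq_zero.1 h9.symm)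
  linarith

/-- The (uncentered) second moment matrix `E[x xᵀ]` of a distribution on `ℝᵖ`. -/
noncomputable def secondMoment {p : ℕ} (D : Measure (Fin p → ℝ)) : Matrix (Fin p) (Fin p) ℝ :=
  Matrix.of fun i j => ∫ x, x i * x j ∂D

/-- `Λ^{-1/2} Uᵀ x`: the whitened observation `x`, in coordinates along the orthonormal
eigenvectors (the columns of `U`) of the source covariance `U diag(lam) Uᵀ`. -/
noncomputable def whiten {p : ℕ} (U : Matrix (Fin p) (Fin p) ℝ) (lam : Fin p → ℝ)
    (x : Fin p → ℝ) : Fin p → ℝ :=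
  fun j => (Uᵀ *ᵥ x) j / Real.sqrt (lam j)

/-- The assumptions on the covariate distributions `Dsrc` and `Dtgt`: the covariance matrices are
diagonalized by one orthogonal matrix `U`, with source eigenvalues `lam` (positive and
nonincreasing) and target eigenvalues `lamT` (in any order; they are automatically nonnegative),
and the whitened source observations are centered, with independent coordinates and subgaussian
norm `σ`. -/
structure CovariateAssumptions {p : ℕ} (Dsrc Dtgt : Measure (Fin p → ℝ))
    (U : Matrix (Fin p) (Fin p) ℝ) (lam lamT : Fin p → ℝ) (σ : ℝ) : Prop where
  prob_src : IsProbabilityMeasure Dsrc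
  prob_tgt : IsProbabilityMeasure Dtgt
  memLp_src : ∀ j, MemLp (fun x : Fin p → ℝ => x j) 2 Dsrc
  memLp_tgt : ∀ j, MemLp (fun x : Fin p → ℝ => x j) 2 Dtgt
  orthogonal : U ∈ Matrix.orthogonalGroup (Fin p) ℝ
  diag_src : Uᵀ * secondMoment Dsrc * U = Matrix.diagonal lam
  diag_tgt : Uᵀ * secondMoment Dtgt * U = Matrix.diagonal lamT
  lam_pos : ∀ j, 0 < lam j
  lam_antitone : Antitone lam
  centered : ∀ j, ∫ x, x j ∂Dsrc = 0
  indep : iIndepFun (fun (j : Fin p) (x : Fin p → ℝ) => whiten U lam x j) Dsrc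
  subgaussian : ∀ γ : Fin p → ℝ,
    Integrable (fun x => Real.exp (γ ⬝ᵥ whiten U lam x)) Dsrc ∧
      ∫ x, Real.exp (γ ⬝ᵥ whiten U lam x) ∂Dsrc ≤ Real.exp (σ ^ 2 * (γ ⬝ᵥ γ) / 2)

/-- The law `ν` of one response noise variable is centered with variance `v ^ 2 > 0`. -/
structure NoiseAssumptions (ν : Measure ℝ) (v : ℝ) : Prop where
  prob : IsProbabilityMeasure ν
  memLp : MemLp (fun e : ℝ => e) 2 ν
  v_pos : 0 < v
  centered : ∫ e, e ∂ν = 0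
  variance : ∫ e, e ^ 2 ∂ν = v ^ 2

/-- The variance term `V_ε = ‖mni X ε‖²_M = (mni X ε)ᵀ M (mni X ε)`. -/
noncomputable def rawVariance {n p : ℕ} (M : Matrix (Fin p) (Fin p) ℝ)
    (X : Matrix (Fin n) (Fin p) ℝ) (ε : Fin n → ℝ) : ℝ :=
  mni X ε ⬝ᵥ (M *ᵥ mni X ε)

/-- The normalized variance `V = E_ε [V_ε / v²]`: the data matrix `X` is fixed and the mean is
over a noise vector `ε` with `n` i.i.d. components of law `ν` and variance `v²`. -/
noncomputable def normalizedVariance {n p : ℕ} (M : Matrix (Fin p) (Fin p) ℝ) (ν : Measure ℝ)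
    (v : ℝ) (X : Matrix (Fin n) (Fin p) ℝ) : ℝ :=
  ∫ ε : Fin n → ℝ, rawVariance M X ε / v ^ 2 ∂(Measure.pi fun _ : Fin n => ν)

/-- `ρ_k = (∑_{i > k} λ_i) / (n λ_{k+1})`. Indices start at `0` here, so that `k : Fin p` stands
for the number of leading eigenvalues, `lam k` is `λ_{k+1}`, `Finset.Iio k` is the set of the first
`k` indices, and `Finset.Ici k` that of the remaining ones. -/
noncomputable def effRank {p : ℕ} (lam : Fin p → ℝ) (n : ℕ) (k : Fin p) : ℝ :=
  (∑ i ∈ Finset.Ici k, lam i) / (n * lam k)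

/-! Let `z_j ∈ ℝⁿ` be the columns of the whitened data, so that `X Xᵀ = A = ∑ λ_j z_j z_jᵀ`.
Averaging over the noise turns `V` into `∑ λ̃_i |u_i|²` with `A u_i = √λ_i z_i`
(`normalizedVariance_eq`, `solvesNormalEq`). Both bounds thus reduce to estimates of the single
norms `|u_i|²`, obtained by splitting `A` into the head (the first `k` indices) and the tail.

Upper bound: if the tail form lies between `α` and `β`, and the Gram matrix of the head columns is
at least `γ`, then `|u_i|² ≤ λ_i |z_i|² / α²` for every `i`, and `|u_i|² ≤ β / (α γ λ_i)` for a head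
index (`norm_le`, `norm_le_of_head`). With high probability `α` and `β` are of order `∑_{i>k} λ_i`
and `γ` is of order `n`. Lower bound: pairing `u_i` with the component of `z_i` orthogonal to the
other head columns bounds `|u_i|²` below, and only an upper bound of the tail form is needed
(`le_norm`). This holds for each `i` with probability `1 - 3 exp(-n/c)`. A union bound over the `p`
indices is not affordable, since `p` is not controlled by `n`; instead, Markov's inequality shows
that the failing indices rarely carry more than half of the sum (`prob_half_lt_sum_le`).

Random matrices: divided by `λ_{k+1}`, the tail form is a sum of squares with weights `μ_j ∈ [0,
1]`, and the total weight `∑ μ_j = n ρ_k` acts as the number of rows. The upper estimate and the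
head estimate follow from a net and exponential moments. The lower estimate of the tail form is
harder: `b` may not depend on `σ_x`, so only `∑ μ_j ≥ 2n` is available and a plain net is too large.
Unit vectors are divided in two kinds (`exists_prob_rowForm_lt_of_two_mul_le`). Those concentrated
on few large coordinates have a net of subexponential size. The others have substantial mass on
small coordinates, and a Fourier small-ball estimate (`integral_exp_neg_sq_sum_le`) gives a
probability small enough for a full net. -/

open scoped NNReal ENNReal

/-! ### One-dimensional estimates for standardized sub-Gaussian variables -/

/-- A measurable real random variable with mean `0`, second moment `1` and a sub-Gaussian moment
generating function with variance proxy `c`. -/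
structure StdSubgaussian {Ω : Type*} [MeasurableSpace Ω] (X : Ω → ℝ) (c : ℝ≥0)
    (P : Measure Ω) : Prop where
  measurable : Measurable X
  mean : ∫ ω, X ω ∂P = 0
  second : ∫ ω, X ω ^ 2 ∂P = 1
  mgf : HasSubgaussianMGF X c P

/-- A bound on the third and fourth absolute moments in terms of the variance proxy. -/
noncomputable def momentBound (c : ℝ≥0) : ℝ := 48 * Real.exp (c / 2)

theorem momentBound_pos (c : ℝ≥0) : 48 ≤ momentBound c := by
  have : 1 ≤ Real.exp ((c : ℝ) / 2) := Real.one_le_exp (by positivity)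
  unfold momentBound; linarith

namespace StdSubgaussian

variable {Ω : Type*} [MeasurableSpace Ω] {X : Ω → ℝ} {c : ℝ≥0} {P : Measure Ω}

theorem integrable_pow (h : StdSubgaussian X c P) (m : ℕ) :
    Integrable (fun ω => X ω ^ m) P := by
  rcases Nat.eq_zero_or_pos m with rfl | hm
  · have : MemLp X 0 P := by
      simpa using h.mgf.memLp 0
    have h1 := h.mgf.integrable_exp_mul 0
    simpa using h1
  · have h1 : MemLp X m P := by simpa using h.mgf.memLp m
    have h2 := h1.integrable_norm_pow hm.ne'
    rw [← integrable_norm_iff (h.measurable.pow_const m).aestronglyMeasurable]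
    simpa using h2

theorem integral_abs_pow_le (h : StdSubgaussian X c P) {m : ℕ} (hm : m ≤ 4) :
    ∫ ω, |X ω| ^ m ∂P ≤ momentBound c := by
  have h1 := h.mgf.integrable_exp_mul 1
  have h2 := h.mgf.integrable_exp_mul (-1)
  have hb : ∀ ω, |X ω| ^ m ≤ 24 * (Real.exp (1 * X ω) + Real.exp (-1 * X ω)) := by
    intro ω
    have h3 := Real.pow_div_factorial_le_exp (|X ω|) (abs_nonneg _) m
    have h4 : Real.exp |X ω| ≤ Real.exp (1 * X ω) + Real.exp (-1 * X ω) := by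
      rcases abs_cases (X ω) with ⟨h, _⟩ | ⟨h, _⟩ <;> rw [h]
      · have := Real.exp_pos (-1 * X ω); rw [one_mul]; linarith
      · have := Real.exp_pos (1 * X ω); rw [neg_one_mul]; linarith
    have h5 : (m.factorial : ℝ) ≤ 24 := by
      exact_mod_cast Nat.factorial_le hm
    have h6 : (0 : ℝ) < m.factorial := by positivity
    rw [div_le_iff₀ h6] at h3
    calc |X ω| ^ m ≤ Real.exp |X ω| * m.factorial := h3
      _ ≤ Real.exp |X ω| * 24 := by gcongr
      _ ≤ _ := by linarith
  have h7 := h.mgf.mgf_le 1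
  have h8 := h.mgf.mgf_le (-1)
  have h9 : Integrable (fun ω => |X ω| ^ m) P := by
    simpa [abs_pow] using (h.integrable_pow m).abs
  calc ∫ ω, |X ω| ^ m ∂P
      ≤ ∫ ω, 24 * (Real.exp (1 * X ω) + Real.exp (-1 * X ω)) ∂P :=
        integral_mono h9 ((h1.add h2).const_mul 24) hb
    _ = 24 * (ProbabilityTheory.mgf X P 1 + ProbabilityTheory.mgf X P (-1)) := by
        rw [integral_const_mul, integral_add h1 h2]; rfl
    _ ≤ 24 * (Real.exp (c * 1 ^ 2 / 2) + Real.exp (c * (-1) ^ 2 / 2)) := by gcongr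
    _ = momentBound c := by unfold momentBound; norm_num; ring

/-- The Laplace transform of the square at the scale of the fourth moment. -/
theorem integral_exp_neg_sq_le [IsProbabilityMeasure P] (h : StdSubgaussian X c P) :
    ∫ ω, Real.exp (-(1 / momentBound c) * X ω ^ 2) ∂P
      ≤ Real.exp (-(1 / momentBound c) / 2) := by
  set M := momentBound c with hM
  have hMp : 0 < M := by have := momentBound_pos c; linarith
  set s := 1 / M with hs
  have hsp : 0 < s := by positivity
  have h4 : ∫ ω, X ω ^ 4 ∂P ≤ M := by
    have := h.integral_abs_pow_le (m := 4) le_rfl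
    simpa [Even.pow_abs (show Even 4 by decide)] using this
  have hb : ∀ ω, Real.exp (-s * X ω ^ 2) ≤ 1 - s * X ω ^ 2 + s ^ 2 / 2 * X ω ^ 4 := by
    intro ω
    have hy : 0 ≤ s * X ω ^ 2 := by positivity
    have := Real.quadratic_le_exp_of_nonneg hy
    have h2 : Real.exp (-s * X ω ^ 2) = (Real.exp (s * X ω ^ 2))⁻¹ := by
      rw [← Real.exp_neg]; congr 1; ring
    rw [h2]
    set y := s * X ω ^ 2
    have h3 : s ^ 2 / 2 * X ω ^ 4 = y ^ 2 / 2 := by simp only [y]; ring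
    rw [h3]
    -- `exp(-y) ≤ 1 - y + y²/2` follows from `exp y ≥ 1 + y + y²/2`, because `(1 + y + y²/2)(1 - y +
    -- y²/2) = 1 + y⁴/4 ≥ 1`.
    apply inv_le_of_inv_le₀ (by nlinarith [sq_nonneg (y - 1)])
    refine le_trans ?_ this
    rw [inv_le_iff_one_le_mul₀ (by nlinarith [sq_nonneg (y - 1)])]
    nlinarith [sq_nonneg (y ^ 2)]
  have i2 := h.integrable_pow 2
  have i4 := h.integrable_pow 4
  have i0 : Integrable (fun _ : Ω => (1 : ℝ)) P := integrable_const 1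
  have ie : Integrable (fun ω => Real.exp (-s * X ω ^ 2)) P := by
    refine i0.mono' (by have := h.measurable; fun_prop) (ae_of_all _ fun ω => ?_)
    rw [Real.norm_eq_abs, abs_of_pos (Real.exp_pos _), Real.exp_le_one_iff]
    have : 0 ≤ s * X ω ^ 2 := by positivity
    linarith
  calc ∫ ω, Real.exp (-s * X ω ^ 2) ∂P
      ≤ ∫ ω, (1 - s * X ω ^ 2 + s ^ 2 / 2 * X ω ^ 4) ∂P :=
        integral_mono ie ((i0.sub (i2.const_mul s)).add (i4.const_mul _)) hb
    _ = 1 - s + s ^ 2 / 2 * ∫ ω, X ω ^ 4 ∂P := by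
        have i02 : Integrable (fun ω => 1 - s * X ω ^ 2) P := i0.sub (i2.const_mul s)
        rw [integral_add i02 (i4.const_mul _), integral_sub i0 (i2.const_mul s),
          integral_const_mul, integral_const_mul, h.second]
        simp
    _ ≤ 1 - s + s ^ 2 / 2 * M := by gcongr
    _ = -s / 2 + 1 := by rw [hs]; field_simp; ring
    _ ≤ Real.exp (-s / 2) := Real.add_one_le_exp _

/-- The square of a sub-Gaussian variable is subexponential. -/
theorem exp_sq (h : StdSubgaussian X c P) [IsProbabilityMeasure P] (hc : 0 < c) :
    Integrable (fun ω => Real.exp (1 / (4 * c) * X ω ^ 2)) P ∧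
      ∫ ω, Real.exp (1 / (4 * c) * X ω ^ 2) ∂P ≤ 2 := by
  have hc' : (0 : ℝ) < c := by exact_mod_cast hc
  set a : ℝ := 1 / (4 * c) with ha
  have hap : 0 < a := by positivity
  have hX := h.measurable
  set r := Real.sqrt (2 * a)
  have hr : r ^ 2 = 2 * a := Real.sq_sqrt (by positivity)
  -- The square is linearized by an auxiliary Gaussian: `exp(a y²) = E_g exp(r y g)` with `r² = 2a`.
  -- After exchanging the integrals, the moment generating function of `X` leaves `E_g exp(g²/4) =
  -- √2`. Working with lower integrals makes integrability a conclusion.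
  have key : ∀ y : ℝ, ENNReal.ofReal (Real.exp (a * y ^ 2))
      = ∫⁻ g, ENNReal.ofReal (Real.exp (r * y * g)) ∂(gaussianReal 0 1) := by
    intro y
    have h1 : ProbabilityTheory.mgf id (gaussianReal 0 1) (r * y) = Real.exp (a * y ^ 2) := by
      rw [mgf_id_gaussianReal]
      simp only [NNReal.coe_one]
      congr 1
      rw [mul_pow, hr]; ring
    rw [← h1, ProbabilityTheory.mgf, ofReal_integral_eq_lintegral_ofReal]
    · rfl
    · exact integrable_exp_mul_gaussianReal (r * y)
    · exact ae_of_all _ fun g => (Real.exp_pos _).le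
  have hb : ∫⁻ ω, ENNReal.ofReal (Real.exp (a * X ω ^ 2)) ∂P ≤ ENNReal.ofReal 2 := by
    simp_rw [key]
    rw [lintegral_lintegral_swap (by fun_prop)]
    calc ∫⁻ g, ∫⁻ ω, ENNReal.ofReal (Real.exp (r * X ω * g)) ∂P ∂(gaussianReal 0 1)
        ≤ ∫⁻ g, ENNReal.ofReal (Real.exp (g ^ 2 / 4)) ∂(gaussianReal 0 1) := by
          refine lintegral_mono fun g => ?_
          have e : ∀ ω, r * X ω * g = (r * g) * X ω := fun ω => by ring
          simp_rw [e]
          rw [← ofReal_integral_eq_lintegral_ofReal (h.mgf.integrable_exp_mul _)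
            (ae_of_all _ fun ω => (Real.exp_pos _).le)]
          refine ENNReal.ofReal_le_ofReal ((h.mgf.mgf_le (r * g)).trans (le_of_eq ?_))
          congr 1
          rw [mul_pow, hr, ha]; field_simp
      _ = ∫⁻ g, ENNReal.ofReal ((√(2 * Real.pi))⁻¹ * Real.exp (-(1 / 4) * g ^ 2)) := by
          rw [gaussianReal_of_var_ne_zero _ one_ne_zero, lintegral_withDensity_eq_lintegral_mul _
            (measurable_gaussianPDF 0 1) (by fun_prop)]
          refine lintegral_congr fun g => ?_
          simp only [Pi.mul_apply, gaussianPDF, gaussianPDFReal]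
          rw [← ENNReal.ofReal_mul (by positivity), mul_assoc, ← Real.exp_add]
          simp only [NNReal.coe_one, mul_one, sub_zero]
          congr 3
          ring
      _ = ENNReal.ofReal ((√(2 * Real.pi))⁻¹ * √(Real.pi / (1 / 4))) := by
          rw [← ofReal_integral_eq_lintegral_ofReal, integral_const_mul, integral_gaussian]
          · exact (integrable_exp_neg_mul_sq (by norm_num)).const_mul _
          · exact ae_of_all _ fun g => by positivity
      _ ≤ ENNReal.ofReal 2 := by
          refine ENNReal.ofReal_le_ofReal ?_
          rw [← Real.sqrt_inv, ← Real.sqrt_mul (by positivity)]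
          apply Real.sqrt_le_iff.2
          refine ⟨by norm_num, ?_⟩
          have := Real.pi_pos
          field_simp; norm_num
  have hi : Integrable (fun ω => Real.exp (a * X ω ^ 2)) P := by
    refine ⟨by fun_prop, ?_⟩
    rw [hasFiniteIntegral_iff_ofReal (ae_of_all _ fun ω => (Real.exp_pos _).le)]
    exact hb.trans_lt ENNReal.ofReal_lt_top
  refine ⟨hi, ?_⟩
  rw [← ofReal_integral_eq_lintegral_ofReal hi (ae_of_all _ fun ω => (Real.exp_pos _).le)] at hb
  exact (ENNReal.ofReal_le_ofReal_iff (by norm_num)).1 hb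

end StdSubgaussian

theorem Complex.norm_exp_mul_I_sub_quadratic_le (x : ℝ) :
    ‖Complex.exp (x * Complex.I) - (1 + x * Complex.I - x ^ 2 / 2)‖ ≤ 4 * |x| ^ 3 := by
  rcases le_total |x| 1 with hx | hx
  · have hn : ‖(x : ℂ) * Complex.I‖ = |x| := by simp
    have := Complex.exp_bound (x := (x : ℂ) * Complex.I) (by rw [hn]; exact hx) (n := 3)
      (by norm_num)
    rw [hn] at this
    have e : ∑ m ∈ Finset.range 3, ((x : ℂ) * Complex.I) ^ m / (m.factorial : ℂ)
        = 1 + x * Complex.I - x ^ 2 / 2 := by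
      simp [Finset.sum_range_succ, Nat.factorial, mul_pow]
      ring
    rw [e] at this
    refine this.trans ?_
    have h3 : 0 ≤ |x| ^ 3 := by positivity
    norm_num [Nat.factorial]
    linarith
  · have h1 : ‖Complex.exp (x * Complex.I)‖ = 1 := Complex.norm_exp_ofReal_mul_I x
    have h2 : ‖(1 + x * Complex.I - x ^ 2 / 2 : ℂ)‖ ≤ 1 + |x| + |x| ^ 2 / 2 := by
      refine (norm_sub_le _ _).trans (add_le_add ((norm_add_le _ _).trans ?_) ?_)
      · simp
      · simp
    refine (norm_sub_le _ _).trans ?_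
    have h3 : |x| ≤ |x| ^ 2 := by nlinarith
    have h4 : |x| ^ 2 ≤ |x| ^ 3 := by nlinarith [sq_nonneg |x|]
    rw [h1]; nlinarith

namespace StdSubgaussian

variable {Ω : Type*} [MeasurableSpace Ω] {X : Ω → ℝ} {c : ℝ≥0} {P : Measure Ω}

/-- Second-order expansion: the characteristic function is `1 - t²/2` up to `4 |t|³ M`, where `M`
bounds the third moment. The range of `t` is the one in which this error is at most `t²/4`. -/
theorem norm_charFun_le [IsProbabilityMeasure P] (h : StdSubgaussian X c P) {t : ℝ}
    (ht : |t| ≤ 1 / (16 * momentBound c)) :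
    ‖charFun (P.map X) t‖ ≤ Real.exp (-t ^ 2 / 4) := by
  have hM := momentBound_pos c
  set M := momentBound c
  have hX := h.measurable
  have i0 : Integrable (fun _ : Ω => (1 : ℂ)) P := integrable_const 1
  have i1 : Integrable (fun ω => ((t * X ω : ℝ) : ℂ) * Complex.I) P := by
    have : Integrable (fun ω => t * X ω) P := by
      simpa using (h.integrable_pow 1).const_mul t
    exact this.ofReal.mul_const _
  have i01 : Integrable (fun ω => 1 + ((t * X ω : ℝ) : ℂ) * Complex.I) P := i0.add i1
  have i2 : Integrable (fun ω => ((t * X ω : ℝ) : ℂ) ^ 2 / 2) P := by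
    have : Integrable (fun ω => (t * X ω) ^ 2 / 2) P := by
      simp_rw [mul_pow]
      exact ((h.integrable_pow 2).const_mul _).div_const _
    simpa using this.ofReal (𝕜 := ℂ)
  have i12 : Integrable
      (fun ω => 1 + ((t * X ω : ℝ) : ℂ) * Complex.I - ((t * X ω : ℝ) : ℂ) ^ 2 / 2) P := i01.sub i2
  have i3 : Integrable (fun ω => Complex.exp (((t * X ω : ℝ) : ℂ) * Complex.I)) P := by
    refine Integrable.of_bound (by fun_prop) 1 (ae_of_all _ fun ω => ?_)
    rw [Complex.norm_exp_ofReal_mul_I]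
  have hq : ∫ ω, (1 + ((t * X ω : ℝ) : ℂ) * Complex.I - ((t * X ω : ℝ) : ℂ) ^ 2 / 2) ∂P
      = ((1 - t ^ 2 / 2 : ℝ) : ℂ) := by
    rw [integral_sub i01 i2, integral_add i0 i1, integral_mul_const,
      integral_complex_ofReal, integral_const_mul, h.mean]
    have : ∫ ω, ((t * X ω : ℝ) : ℂ) ^ 2 / 2 ∂P = ((t ^ 2 / 2 : ℝ) : ℂ) := by
      have e : ∀ ω, ((t * X ω : ℝ) : ℂ) ^ 2 / 2 = ((t ^ 2 / 2 * X ω ^ 2 : ℝ) : ℂ) := by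
        intro ω; push_cast; ring
      simp_rw [e]
      rw [integral_complex_ofReal, integral_const_mul, h.second, mul_one]
    rw [this]
    simp
  have hd : ‖charFun (P.map X) t - ((1 - t ^ 2 / 2 : ℝ) : ℂ)‖ ≤ 4 * |t| ^ 3 * M := by
    rw [charFun_apply_real, integral_map hX.aemeasurable (by fun_prop), ← hq]
    have e : ∀ ω, Complex.exp ((t : ℂ) * (X ω) * Complex.I)
        = Complex.exp (((t * X ω : ℝ) : ℂ) * Complex.I) := by intro ω; push_cast; rfl
    simp_rw [e]
    rw [← integral_sub i3 i12]
    refine (norm_integral_le_integral_norm _).trans ?_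
    have i4 : Integrable (fun ω => |X ω| ^ 3) P := by
      simpa [abs_pow] using (h.integrable_pow 3).abs
    calc ∫ ω, ‖Complex.exp (((t * X ω : ℝ) : ℂ) * Complex.I)
          - (1 + ((t * X ω : ℝ) : ℂ) * Complex.I - ((t * X ω : ℝ) : ℂ) ^ 2 / 2)‖ ∂P
        ≤ ∫ ω, 4 * |t| ^ 3 * |X ω| ^ 3 ∂P := by
          refine integral_mono (i3.sub i12).norm (i4.const_mul _) fun ω => ?_
          refine (Complex.norm_exp_mul_I_sub_quadratic_le (t * X ω)).trans (le_of_eq ?_)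
          rw [abs_mul, mul_pow, mul_assoc]
      _ ≤ 4 * |t| ^ 3 * M := by
          rw [integral_const_mul]
          have := h.integral_abs_pow_le (m := 3) (by norm_num)
          gcongr
  have ht1 : |t| * (16 * M) ≤ 1 := by rwa [← le_div_iff₀ (by positivity)]
  have ht2 : |t| ≤ 1 := by nlinarith [abs_nonneg t]
  have ht3 : t ^ 2 ≤ 1 := by rw [← sq_abs]; nlinarith [abs_nonneg t]
  have h5 : ‖((1 - t ^ 2 / 2 : ℝ) : ℂ)‖ = 1 - t ^ 2 / 2 := by
    rw [Complex.norm_real, Real.norm_eq_abs, abs_of_nonneg (by linarith)]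
  have h6 : ‖charFun (P.map X) t‖ ≤ 4 * |t| ^ 3 * M + (1 - t ^ 2 / 2) := by
    rw [← h5]
    calc ‖charFun (P.map X) t‖ = ‖(charFun (P.map X) t - ((1 - t ^ 2 / 2 : ℝ) : ℂ))
          + ((1 - t ^ 2 / 2 : ℝ) : ℂ)‖ := by rw [sub_add_cancel]
      _ ≤ _ := (norm_add_le _ _).trans (by gcongr)
  have h7 : 4 * |t| ^ 3 * M ≤ t ^ 2 / 4 := by
    rw [← sq_abs t]; nlinarith [sq_nonneg |t|, abs_nonneg t]
  have h8 := Real.add_one_le_exp (-t ^ 2 / 4)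
  linarith

/-- A unit combination of independent standardized sub-Gaussian variables is again one. -/
theorem sum_mul {D : Type*} [Fintype D] {z : D → Ω → ℝ} (hi : iIndepFun z P)
    (hz : ∀ d, StdSubgaussian (z d) c P) {v : D → ℝ} (hv : ∑ d, v d ^ 2 = 1) :
    StdSubgaussian (fun ω => ∑ d, v d * z d ω) c P := by
  have hP := hi.isProbabilityMeasure
  have hm : ∀ d, MemLp (fun ω => v d * z d ω) 2 P := fun d => by
    have : MemLp (z d) 2 P := by simpa using (hz d).mgf.memLp 2
    exact this.const_mul _
  have hmean : ∫ ω, ∑ d, v d * z d ω ∂P = 0 := by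
    rw [integral_finsetSum _ fun d _ => (hm d).integrable (by norm_num)]
    simp [integral_const_mul, (hz _).mean]
  have hi' : iIndepFun (fun d ω => v d * z d ω) P :=
    hi.comp (fun d x => v d * x) fun d => measurable_const_mul _
  refine ⟨?_, hmean, ?_, ?_⟩
  · have := fun d => (hz d).measurable
    fun_prop
  · have h1 := IndepFun.variance_sum (μ := P) (X := fun d ω => v d * z d ω) (s := Finset.univ)
      (fun d _ => hm d) (fun i _ j _ hij => hi'.indepFun hij)
    have h2 : ∀ d, Var[fun ω => v d * z d ω; P] = v d ^ 2 := by
      intro d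
      rw [variance_eq_sub (hm d)]
      simp only [Pi.pow_apply, mul_pow, integral_const_mul, (hz d).mean, (hz d).second]
      ring
    rw [Finset.sum_congr rfl fun d _ => h2 d, hv, variance_eq_sub (memLp_finsetSum' _
      fun d _ => hm d)] at h1
    simp only [Pi.pow_apply, Finset.sum_apply, hmean] at h1
    simpa using h1
  · let w : D → ℝ≥0 := fun d => ⟨v d ^ 2, sq_nonneg _⟩
    have h1 : HasSubgaussianMGF (fun ω => ∑ d, v d * z d ω) (∑ d, w d * c) P :=
      HasSubgaussianMGF.sum_of_iIndepFun hi' fun d _ => (hz d).mgf.const_mul (v d)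
    have h2 : ∑ d, w d = 1 := by
      apply NNReal.coe_injective
      rw [NNReal.coe_sum]
      exact hv
    rwa [← Finset.sum_mul, h2, one_mul] at h1

end StdSubgaussian

/-! ### Small-ball estimates and exponential moments of weighted sums -/

section

variable {Ω : Type*} [MeasurableSpace Ω] {c : ℝ≥0} {P : Measure Ω}

theorem integral_exp_neg_mul_sq_gaussianReal_le {b : ℝ} (hb : 0 < b) :
    ∫ g, Real.exp (-b * g ^ 2) ∂(gaussianReal 0 1) ≤ 1 / √(2 * b) := by
  rw [integral_gaussianReal_eq_integral_smul one_ne_zero]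
  have hpi := Real.pi_pos
  have i1 := (integrable_exp_neg_mul_sq hb).const_mul (√(2 * Real.pi))⁻¹
  calc ∫ x, gaussianPDFReal 0 1 x • Real.exp (-b * x ^ 2)
      ≤ ∫ x, (√(2 * Real.pi))⁻¹ * Real.exp (-b * x ^ 2) := by
        have hle : ∀ x : ℝ, gaussianPDFReal 0 1 x • Real.exp (-b * x ^ 2)
            ≤ (√(2 * Real.pi))⁻¹ * Real.exp (-b * x ^ 2) := by
          intro x
          rw [smul_eq_mul]
          refine mul_le_mul_of_nonneg_right ?_ (Real.exp_pos _).le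
          simp only [gaussianPDFReal, NNReal.coe_one, mul_one, sub_zero]
          refine mul_le_of_le_one_right (by positivity) (Real.exp_le_one_iff.2 ?_)
          have := sq_nonneg x
          linarith
        refine integral_mono (i1.mono' ?_ (ae_of_all _ fun x => ?_)) i1 hle
        · exact ((measurable_gaussianPDFReal 0 1).smul (by fun_prop)).aestronglyMeasurable
        · rw [Real.norm_eq_abs, abs_of_nonneg]
          · exact hle x
          · exact mul_nonneg (gaussianPDFReal_nonneg _ _ _) (Real.exp_pos _).le
    _ = 1 / √(2 * b) := by
        rw [integral_const_mul, integral_gaussian, ← Real.sqrt_inv, ← Real.sqrt_mul (by positivity),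
          one_div, ← Real.sqrt_inv]
        congr 1
        field_simp

/-- The characteristic function factors. Factors in `J` have argument `v d * s` small enough for
`norm_charFun_le`; the others are bounded by `1`. -/
theorem norm_charFun_sum_le [IsProbabilityMeasure P] {D : Type*} [Fintype D] {z : D → Ω → ℝ}
    (hi : iIndepFun z P) (hz : ∀ d, StdSubgaussian (z d) c P) {v : D → ℝ} {J : Finset D} {δ s : ℝ}
    (hJ : ∀ d ∈ J, |v d| ≤ δ) (hs : δ * |s| ≤ 1 / (16 * momentBound c)) :
    ‖charFun (P.map fun ω => ∑ d, v d * z d ω) s‖ ≤ Real.exp (-(∑ d ∈ J, v d ^ 2) * s ^ 2 / 4) := by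
  classical
  have hm := fun d => (hz d).measurable
  have hi' : iIndepFun (fun d ω => v d * z d ω) P :=
    hi.comp (fun d x => v d * x) fun d => measurable_const_mul _
  rw [hi'.charFun_map_fun_sum_eq_prod (fun d => ((hm d).const_mul _).aemeasurable),
    Finset.prod_apply, norm_prod, ← Finset.prod_mul_prod_compl J]
  have h1 : ∀ d, charFun (P.map fun ω => v d * z d ω) s = charFun (P.map (z d)) (v d * s) :=
    fun d => charFun_map_mul_comp (hm d).aemeasurable _ _
  have hpm : ∀ d, IsProbabilityMeasure (P.map (z d)) := fun d =>
    Measure.isProbabilityMeasure_map (hm d).aemeasurable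
  calc _ ≤ (∏ d ∈ J, Real.exp (-(v d ^ 2) * s ^ 2 / 4)) * ∏ d ∈ Jᶜ, 1 := by
        refine mul_le_mul (Finset.prod_le_prod (fun _ _ => norm_nonneg _) fun d hd => ?_)
          (Finset.prod_le_prod (fun _ _ => norm_nonneg _) fun d hd => ?_)
          (Finset.prod_nonneg fun _ _ => norm_nonneg _)
          (Finset.prod_nonneg fun _ _ => (Real.exp_pos _).le)
        · rw [h1]
          refine ((hz d).norm_charFun_le ?_).trans (le_of_eq ?_)
          · rw [abs_mul]
            exact (mul_le_mul_of_nonneg_right (hJ d hd) (abs_nonneg _)).trans hs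
          · congr 1; ring
        · rw [h1]
          exact norm_charFun_le_one _
    _ = _ := by
        rw [Finset.prod_const_one, mul_one, ← Real.exp_sum]
        congr 1
        rw [← Finset.sum_div, ← Finset.sum_mul, Finset.sum_neg_distrib]

/-- A small-ball estimate, in Laplace form, for a combination of independent variables with many
small coefficients. -/
theorem integral_exp_neg_sq_sum_le [IsProbabilityMeasure P] {D : Type*} [Fintype D]
    {z : D → Ω → ℝ} (hi : iIndepFun z P) (hz : ∀ d, StdSubgaussian (z d) c P) {v : D → ℝ}
    {J : Finset D} {δ τ θ : ℝ} (hτ : 0 < τ) (hθ : 0 < θ) (hδ : 0 < δ)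
    (hJ : ∀ d ∈ J, |v d| ≤ δ) (hv : θ ^ 2 ≤ ∑ d ∈ J, v d ^ 2) :
    ∫ ω, Real.exp (-(1 / (2 * τ ^ 2)) * (∑ d, v d * z d ω) ^ 2) ∂P
      ≤ 2 * τ / θ + (16 * momentBound c * δ / τ) ^ 2 := by
  have hM := momentBound_pos c
  set M := momentBound c
  set S : Ω → ℝ := fun ω => ∑ d, v d * z d ω with hS
  have hSm : Measurable S := by
    have := fun d => (hz d).measurable
    fun_prop
  set γ := gaussianReal 0 1
  -- A Gaussian of width `τ` is the Fourier transform of a Gaussian, so the Laplace integral equals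
  -- the mean of `charFun (P.map S) (g / τ)` over a standard Gaussian `g`.
  have h1 : ∀ ω, ((Real.exp (-(1 / (2 * τ ^ 2)) * (S ω) ^ 2) : ℝ) : ℂ)
      = ∫ g : ℝ, Complex.exp ((((S ω) / τ * g : ℝ) : ℂ) * Complex.I) ∂γ := by
    intro ω
    have := charFun_gaussianReal (μ := 0) (v := 1) (S ω / τ)
    rw [charFun_apply_real] at this
    push_cast at this ⊢
    rw [this]
    congr 1
    field_simp
    simp
    ring
  have h2 : ((∫ ω, Real.exp (-(1 / (2 * τ ^ 2)) * (S ω) ^ 2) ∂P : ℝ) : ℂ)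
      = ∫ g : ℝ, charFun (P.map S) (g / τ) ∂γ := by
    rw [← integral_complex_ofReal]
    simp_rw [h1]
    rw [integral_integral_swap]
    · refine integral_congr_ae (ae_of_all _ fun g => ?_)
      simp only
      rw [charFun_apply_real, integral_map hSm.aemeasurable (by fun_prop)]
      refine integral_congr_ae (ae_of_all _ fun ω => ?_)
      simp only
      congr 2
      push_cast
      ring
    · refine Integrable.of_bound (by fun_prop) 1 (ae_of_all _ fun q => ?_)
      simp only [Function.uncurry]
      rw [Complex.norm_exp_ofReal_mul_I]
  have i1 : Integrable (fun g : ℝ => Real.exp (-(θ ^ 2 / (4 * τ ^ 2)) * g ^ 2)) γ := by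
    refine Integrable.of_bound (by fun_prop) 1 (ae_of_all _ fun g => ?_)
    rw [Real.norm_eq_abs, abs_of_pos (Real.exp_pos _), Real.exp_le_one_iff]
    have : 0 ≤ (θ ^ 2 / (4 * τ ^ 2)) * g ^ 2 := by positivity
    linarith
  have i2 : Integrable (fun g : ℝ => g ^ 2) γ := by
    simpa using (memLp_id_gaussianReal (μ := 0) (v := 1) 2).integrable_sq
  have hg2 : ∫ g, g ^ 2 ∂γ = 1 := by
    have h := variance_fun_id_gaussianReal (μ := 0) (v := 1)
    have hm : MemLp (fun g : ℝ => g) 2 γ := memLp_id_gaussianReal' 2 (by simp)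
    rw [variance_eq_sub hm] at h
    have h0 : ∫ g, g ∂γ = 0 := integral_id_gaussianReal
    simpa [h0] using h
  -- For small `g` the characteristic function decays like a Gaussian. For the other `g` it is at
  -- most `1`, which is at most `(16 M δ g / τ)²`; its mean is the second error term.
  have h3 : ∀ g : ℝ, ‖charFun (P.map S) (g / τ)‖
      ≤ Real.exp (-(θ ^ 2 / (4 * τ ^ 2)) * g ^ 2) + (16 * M * δ / τ) ^ 2 * g ^ 2 := by
    intro g
    by_cases hg : δ * |g / τ| ≤ 1 / (16 * M)
    · have h4 := norm_charFun_sum_le hi hz hJ hg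
      refine h4.trans (le_trans (Real.exp_le_exp.2 ?_) (le_add_of_nonneg_right (by positivity)))
      have h5 : 0 ≤ (g / τ) ^ 2 := by positivity
      have h6 := mul_le_mul_of_nonneg_right hv h5
      have h7 : (θ ^ 2 / (4 * τ ^ 2)) * g ^ 2 = θ ^ 2 * (g / τ) ^ 2 / 4 := by
        field_simp
      linarith
    · have hpm : IsProbabilityMeasure (P.map S) :=
        Measure.isProbabilityMeasure_map hSm.aemeasurable
      refine (norm_charFun_le_one _).trans (le_trans ?_ (le_add_of_nonneg_left (Real.exp_pos _).le))
      push Not at hg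
      rw [div_lt_iff₀ (by positivity)] at hg
      have e : (16 * M * δ / τ) ^ 2 * g ^ 2 = (δ * |g / τ| * (16 * M)) ^ 2 := by
        rw [mul_pow, mul_pow, sq_abs]; field_simp
      rw [e]
      exact one_le_pow₀ hg.le
  have h0 : 0 ≤ ∫ ω, Real.exp (-(1 / (2 * τ ^ 2)) * (S ω) ^ 2) ∂P :=
    integral_nonneg fun ω => (Real.exp_pos _).le
  calc ∫ ω, Real.exp (-(1 / (2 * τ ^ 2)) * (S ω) ^ 2) ∂P
      = ‖((∫ ω, Real.exp (-(1 / (2 * τ ^ 2)) * (S ω) ^ 2) ∂P : ℝ) : ℂ)‖ := by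
        rw [Complex.norm_real, Real.norm_eq_abs, abs_of_nonneg h0]
    _ ≤ ∫ g, ‖charFun (P.map S) (g / τ)‖ ∂γ := by
        rw [h2]; exact norm_integral_le_integral_norm _
    _ ≤ ∫ g, (Real.exp (-(θ ^ 2 / (4 * τ ^ 2)) * g ^ 2) + (16 * M * δ / τ) ^ 2 * g ^ 2) ∂γ := by
        refine integral_mono_of_nonneg (ae_of_all _ fun g => norm_nonneg _)
          (i1.add (i2.const_mul _)) (ae_of_all _ h3)
    _ ≤ 1 / √(2 * (θ ^ 2 / (4 * τ ^ 2))) + (16 * M * δ / τ) ^ 2 := by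
        rw [integral_add i1 (i2.const_mul _), integral_const_mul, hg2, mul_one]
        gcongr
        exact integral_exp_neg_mul_sq_gaussianReal_le (by positivity)
    _ ≤ 2 * τ / θ + (16 * M * δ / τ) ^ 2 := by
        refine add_le_add ?_ le_rfl
        rw [div_le_div_iff₀ (by positivity) hθ, one_mul]
        have : θ / (2 * τ) ≤ √(2 * (θ ^ 2 / (4 * τ ^ 2))) := by
          apply Real.le_sqrt_of_sq_le
          rw [div_pow]
          have : 0 ≤ θ ^ 2 / (4 * τ ^ 2) := by positivity
          have e : θ ^ 2 / (2 * τ) ^ 2 = θ ^ 2 / (4 * τ ^ 2) := by ring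
          rw [e]; linarith
        rw [div_le_iff₀ (by positivity)] at this
        linarith

/-- Jensen's inequality for `x ↦ x ^ μ`, through weighted AM-GM between `exp W` and `L`. It lets a
row of weight `μ` count as a fraction `μ` of a row. -/
theorem integral_exp_mul_le_rpow [IsProbabilityMeasure P] {W : Ω → ℝ} (hW : Measurable W)
    {L μ : ℝ} (hL : 0 < L) (h0 : 0 ≤ μ) (h1 : μ ≤ 1)
    (hint : Integrable (fun ω => Real.exp (W ω)) P) (hle : ∫ ω, Real.exp (W ω) ∂P ≤ L) :
    Integrable (fun ω => Real.exp (μ * W ω)) P ∧ ∫ ω, Real.exp (μ * W ω) ∂P ≤ L ^ μ := by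
  have hb : ∀ ω, Real.exp (μ * W ω) ≤ L ^ (μ - 1) * (μ * Real.exp (W ω) + (1 - μ) * L) := by
    intro ω
    have h := Real.geom_mean_le_arith_mean2_weighted h0 (sub_nonneg.2 h1)
      (Real.exp_pos (W ω)).le hL.le (by ring)
    calc Real.exp (μ * W ω) = L ^ (μ - 1) * (Real.exp (W ω) ^ μ * L ^ (1 - μ)) := by
          rw [mul_left_comm, ← Real.rpow_add hL, ← Real.exp_mul]
          simp [mul_comm]
      _ ≤ _ := by gcongr
  have i1 : Integrable (fun ω => L ^ (μ - 1) * (μ * Real.exp (W ω) + (1 - μ) * L)) P :=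
    ((hint.const_mul μ).add (integrable_const _)).const_mul _
  have i2 : Integrable (fun ω => Real.exp (μ * W ω)) P := by
    refine i1.mono' (by fun_prop) (ae_of_all _ fun ω => ?_)
    rw [Real.norm_eq_abs, abs_of_pos (Real.exp_pos _)]
    exact hb ω
  refine ⟨i2, (integral_mono i2 i1 hb).trans ?_⟩
  rw [integral_const_mul, integral_add (hint.const_mul μ) (integrable_const _),
    integral_const_mul]
  simp only [integral_const, probReal_univ, one_smul]
  calc L ^ (μ - 1) * (μ * ∫ ω, Real.exp (W ω) ∂P + (1 - μ) * L)
      ≤ L ^ (μ - 1) * (μ * L + (1 - μ) * L) := by gcongr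
    _ = L ^ (μ - 1) * L ^ (1 : ℝ) := by rw [Real.rpow_one]; ring
    _ = L ^ μ := by rw [← Real.rpow_add hL]; ring_nf

/-- The exponential moment of a sum of independent variables with weights in `[0, 1]`. -/
theorem mgf_weighted_sum_le [IsProbabilityMeasure P] {N : Type*} [Fintype N] {Y : N → Ω → ℝ}
    (hi : iIndepFun Y P) (hY : ∀ j, Measurable (Y j)) {μ : N → ℝ} (h0 : ∀ j, 0 ≤ μ j)
    (h1 : ∀ j, μ j ≤ 1) {t L : ℝ} (hL : 0 < L)
    (hint : ∀ j, Integrable (fun ω => Real.exp (t * Y j ω)) P)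
    (hle : ∀ j, ∫ ω, Real.exp (t * Y j ω) ∂P ≤ L) :
    Integrable (fun ω => Real.exp (t * ∑ j, μ j * Y j ω)) P ∧
      mgf (fun ω => ∑ j, μ j * Y j ω) P t ≤ L ^ (∑ j, μ j) := by
  have hi' : iIndepFun (fun j ω => μ j * Y j ω) P :=
    hi.comp (fun j x => μ j * x) fun j => measurable_const_mul _
  have hm : ∀ j, Measurable (fun ω => μ j * Y j ω) := fun j => (hY j).const_mul _
  have key : ∀ j, Integrable (fun ω => Real.exp (t * (μ j * Y j ω))) P ∧
      ∫ ω, Real.exp (t * (μ j * Y j ω)) ∂P ≤ L ^ μ j := by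
    intro j
    have := integral_exp_mul_le_rpow ((hY j).const_mul t) hL (h0 j) (h1 j) (hint j) (hle j)
    simpa only [mul_left_comm] using this
  have e : (fun ω => ∑ j, μ j * Y j ω) = ∑ j, fun ω => μ j * Y j ω := by
    ext ω; simp
  constructor
  · have := hi'.integrable_exp_mul_sum hm (s := Finset.univ) (t := t) fun j _ => (key j).1
    simpa using this
  · rw [e, hi'.mgf_sum hm, Real.rpow_sum_of_pos hL]
    exact Finset.prod_le_prod (fun j _ => mgf_nonneg) fun j _ => (key j).2

/-- If all entries of a random matrix are independent, so are its rows. -/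
theorem ProbabilityTheory.iIndepFun.curry {N D : Type*} {z : N → D → Ω → ℝ}
    (hm : ∀ j d, Measurable (z j d)) (h : iIndepFun (fun (q : N × D) ω => z q.1 q.2 ω) P) :
    iIndepFun (fun j ω d => z j d ω) P := by
  have hP := h.isProbabilityMeasure
  have hs : iIndepFun (fun (q : (_ : N) × D) ω => z q.1 q.2 ω) P :=
    h.precomp (g := Equiv.sigmaEquivProd N D) (Equiv.injective _)
  have hrow : ∀ j, iIndepFun (fun d => z j d) P := fun j =>
    h.precomp (g := fun d => (j, d)) fun d d' hd => by simpa using hd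
  have hpm : ∀ j d, IsProbabilityMeasure (P.map (z j d)) :=
    fun j d => Measure.isProbabilityMeasure_map (hm j d).aemeasurable
  have hpm' : ∀ j, IsProbabilityMeasure (P.map (fun ω d => z j d ω)) :=
    fun j => Measure.isProbabilityMeasure_map (Measurable.aemeasurable (by fun_prop))
  rw [iIndepFun_iff_map_fun_eq_infinitePi_map (by fun_prop)] at hs ⊢
  have e : (MeasurableEquiv.piCurry fun (_ : N) (_ : D) => ℝ) ∘
      (fun ω (q : (_ : N) × D) => z q.1 q.2 ω) = fun ω j d => z j d ω := by
    ext; simp [Sigma.curry]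
  rw [← e, ← Measure.map_map (by fun_prop) (by fun_prop), hs]
  refine (Measure.infinitePi_map_piCurry (fun j d => P.map (z j d))).trans ?_
  congr 1
  ext1 j
  exact ((iIndepFun_iff_map_fun_eq_infinitePi_map (by fun_prop)).1 (hrow j)).symm

end

/-! ### Lattice points used as nets, and their number -/

/-- Rounding of `x / h` to an integer, towards `0`. -/
noncomputable def truncDiv (h x : ℝ) : ℤ := if 0 ≤ x then ⌊x / h⌋ else ⌈x / h⌉

/-- Rounding towards `0`, rather than to the nearest point, never enlarges a coordinate: small
coordinates stay small and the norm does not grow. -/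
theorem truncDiv_spec {h : ℝ} (hh : 0 < h) (x : ℝ) :
    |h * truncDiv h x| ≤ |x| ∧ |x - h * truncDiv h x| ≤ h := by
  unfold truncDiv
  split_ifs with hx
  · have h1 := Int.floor_le (x / h)
    have h2 := Int.lt_floor_add_one (x / h)
    have h3 : (0 : ℝ) ≤ ⌊x / h⌋ := by exact_mod_cast Int.floor_nonneg.2 (by positivity)
    rw [le_div_iff₀ hh] at h1
    rw [div_lt_iff₀ hh] at h2
    have h4 : 0 ≤ h * ⌊x / h⌋ := by positivity
    rw [abs_of_nonneg h4, abs_of_nonneg hx, abs_le]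
    exact ⟨by linarith, by linarith, by linarith⟩
  · push Not at hx
    have h1 := Int.le_ceil (x / h)
    have h2 := Int.ceil_lt_add_one (x / h)
    have h3 : (⌈x / h⌉ : ℝ) ≤ 0 := by
      exact_mod_cast Int.ceil_le.2 (by simpa using (div_neg_of_neg_of_pos hx hh).le)
    rw [div_le_iff₀ hh] at h1
    rw [← sub_lt_iff_lt_add, lt_div_iff₀ hh] at h2
    have h4 : h * ⌈x / h⌉ ≤ 0 := mul_nonpos_of_nonneg_of_nonpos hh.le h3
    rw [abs_of_nonpos h4, abs_of_neg hx, abs_le]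
    exact ⟨by linarith, by linarith, by linarith⟩

theorem abs_truncDiv_le {h : ℝ} (hh : 0 < h) (x : ℝ) : |(truncDiv h x : ℝ)| ≤ |x| / h := by
  have := (truncDiv_spec hh x).1
  rw [abs_mul, abs_of_pos hh] at this
  rw [le_div_iff₀ hh]; linarith

section lattice

variable (D : Type*) [Fintype D]

open Classical in
/-- The integer vectors of `ℓ¹` norm at most `R`. -/
noncomputable def latticeBall (R : ℝ) : Finset (D → ℤ) :=
  (Fintype.piFinset fun _ => Finset.Icc (-(⌊R⌋₊ : ℤ)) ⌊R⌋₊).filter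
    fun m => ∑ d, |(m d : ℝ)| ≤ R

variable {D}

theorem mem_latticeBall {R : ℝ} {m : D → ℤ} :
    m ∈ latticeBall D R ↔ ∑ d, |(m d : ℝ)| ≤ R := by
  classical
  rw [latticeBall, Finset.mem_filter, and_iff_right_iff_imp]
  intro h
  rw [Fintype.mem_piFinset]
  intro d
  have h1 : |(m d : ℝ)| ≤ R :=
    (Finset.single_le_sum (f := fun d => |(m d : ℝ)|) (fun _ _ => abs_nonneg _)
      (Finset.mem_univ d)).trans h
  have h2 : (m d).natAbs ≤ ⌊R⌋₊ := by
    apply Nat.le_floor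
    rwa [Nat.cast_natAbs, Int.cast_abs]
  rw [Finset.mem_Icc]
  omega

theorem sum_exp_neg_abs_le {a : ℝ} (ha : 0 < a) (K : ℕ) :
    ∑ m ∈ Finset.Icc (-(K : ℤ)) K, Real.exp (-a * |(m : ℝ)|)
      ≤ 2 / (1 - Real.exp (-a)) - 1 := by
  have hq : Real.exp (-a) < 1 := Real.exp_lt_one_iff.2 (by linarith)
  have hq0 := Real.exp_pos (-a)
  rw [Finset.sum_Icc_of_even_eq_range (f := fun m : ℤ => Real.exp (-a * |(m : ℝ)|))
    (fun m => by simp)]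
  have h1 : ∑ m ∈ Finset.range (K + 1), Real.exp (-a * |((m : ℤ) : ℝ)|)
      ≤ 1 / (1 - Real.exp (-a)) := by
    have e : ∀ m ∈ Finset.range (K + 1), Real.exp (-a * |((m : ℤ) : ℝ)|) = Real.exp (-a) ^ m := by
      intro m _
      rw [← Real.exp_nat_mul]
      congr 1
      simp [mul_comm]
    rw [Finset.sum_congr rfl e, one_div, ← tsum_geometric_of_lt_one hq0.le hq]
    exact (summable_geometric_of_lt_one hq0.le hq).sum_le_tsum _ fun _ _ => by positivity
  simp only [nsmul_eq_mul, Int.cast_zero, abs_zero, mul_zero, Real.exp_zero, Nat.cast_ofNat]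
  have e : 2 / (1 - Real.exp (-a)) = 2 * (1 / (1 - Real.exp (-a))) := by ring
  rw [e]; linarith

/-- Exponential counting: each point of the ball contributes at least `1` to the sum of `exp (a (R -
‖m‖₁))`, which factors over the coordinates into geometric series. The parameter `a` is free: small
for a large radius, large for a small one. -/
theorem card_latticeBall_le {a : ℝ} (ha : 0 < a) (R : ℝ) :
    ((latticeBall D R).card : ℝ)
      ≤ Real.exp (a * R) * (2 / (1 - Real.exp (-a)) - 1) ^ Fintype.card D := by
  classical
  calc ((latticeBall D R).card : ℝ) = ∑ m ∈ latticeBall D R, (1 : ℝ) := by simp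
    _ ≤ ∑ m ∈ latticeBall D R, Real.exp (a * R) * ∏ d, Real.exp (-a * |(m d : ℝ)|) := by
        refine Finset.sum_le_sum fun m hm => ?_
        rw [mem_latticeBall] at hm
        rw [← Real.exp_sum, ← Real.exp_add, ← Finset.mul_sum]
        apply Real.one_le_exp
        nlinarith
    _ ≤ ∑ m ∈ Fintype.piFinset fun _ : D => Finset.Icc (-(⌊R⌋₊ : ℤ)) ⌊R⌋₊,
          Real.exp (a * R) * ∏ d, Real.exp (-a * |(m d : ℝ)|) := by
        refine Finset.sum_le_sum_of_subset_of_nonneg (Finset.filter_subset _ _) fun m _ _ => ?_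
        exact mul_nonneg (Real.exp_pos _).le (Finset.prod_nonneg fun _ _ => (Real.exp_pos _).le)
    _ = Real.exp (a * R) * ∏ _d : D, ∑ m ∈ Finset.Icc (-(⌊R⌋₊ : ℤ)) ⌊R⌋₊,
          Real.exp (-a * |(m : ℝ)|) := by
        rw [← Finset.mul_sum, Finset.prod_univ_sum]
    _ ≤ _ := by
        rw [Finset.prod_const, Finset.card_univ]
        have := sum_exp_neg_abs_le ha ⌊R⌋₊
        gcongr

theorem card_latticeBall_div_le {ε : ℝ} (hε : 0 < ε) (hε1 : ε ≤ 1) :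
    ((latticeBall D (Fintype.card D / ε)).card : ℝ) ≤ (12 / ε) ^ Fintype.card D := by
  refine (card_latticeBall_le hε _).trans ?_
  rw [mul_div_cancel₀ _ hε.ne', ← mul_one (Fintype.card D : ℝ), Real.exp_nat_mul, ← mul_pow]
  have h1 : ε / 2 ≤ 1 - Real.exp (-ε) := by
    have h2 : Real.exp (-ε) ≤ 1 / (1 + ε) := by
      rw [Real.exp_neg, ← one_div]
      exact one_div_le_one_div_of_le (by linarith) (by linarith [Real.add_one_le_exp ε])
    have h3 : 1 / (1 + ε) ≤ 1 - ε / 2 := by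
      rw [div_le_iff₀ (by linarith)]; nlinarith
    linarith
  have h4 : 2 / (1 - Real.exp (-ε)) ≤ 4 / ε := by
    rw [div_le_div_iff₀ (by linarith) hε]; linarith
  have h5 := Real.exp_one_lt_d9
  have h6 : 0 ≤ 2 / (1 - Real.exp (-ε)) - 1 := by
    have := Real.exp_pos (-ε)
    rw [sub_nonneg, le_div_iff₀ (by linarith)]; linarith
  refine pow_le_pow_left₀ (mul_nonneg (Real.exp_pos _).le h6) ?_ _
  calc Real.exp 1 * (2 / (1 - Real.exp (-ε)) - 1) ≤ 3 * (4 / ε) := by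
        refine mul_le_mul (by linarith) (by linarith) h6 (by norm_num)
    _ = 12 / ε := by ring

/-- A small multiple of the dimension, as radius, gives a subexponential number of lattice points. -/
theorem exists_card_latticeBall_le {s : ℝ} (hs : 0 < s) :
    ∃ κ : ℝ, 0 < κ ∧ ∀ (D : Type) [Fintype D],
      ((latticeBall D (κ * Fintype.card D)).card : ℝ) ≤ Real.exp (s * Fintype.card D) := by
  have hlim : Filter.Tendsto (fun a : ℝ => 2 / (1 - Real.exp (-a)) - 1) Filter.atTop
      (nhds (2 / (1 - 0) - 1)) := by
    have h1 : Filter.Tendsto (fun a : ℝ => Real.exp (-a)) Filter.atTop (nhds 0) :=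
      Real.tendsto_exp_neg_atTop_nhds_zero
    exact ((tendsto_const_nhds.div (tendsto_const_nhds.sub h1) (by norm_num))).sub_const 1
  have hlt : (2 / (1 - 0) - 1 : ℝ) < Real.exp (s / 2) := by
    norm_num; positivity
  -- The cost per coordinate tends to `1` as `a → ∞`. Half of the allowance `s` pays for it, and the
  -- other half for the factor `exp (a R)`, whence `κ = s / (2a)`.
  obtain ⟨a, ha, ha0⟩ := ((hlim.eventually (gt_mem_nhds hlt)).and
    (Filter.eventually_gt_atTop 0)).exists
  refine ⟨s / (2 * a), by positivity, fun D _ => (card_latticeBall_le ha0 _).trans ?_⟩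
  have h6 : 0 ≤ 2 / (1 - Real.exp (-a)) - 1 := by
    have := Real.exp_pos (-a)
    have : Real.exp (-a) < 1 := Real.exp_lt_one_iff.2 (by linarith)
    rw [sub_nonneg, le_div_iff₀ (by linarith)]; linarith
  calc _ ≤ Real.exp (a * (s / (2 * a) * Fintype.card D)) * Real.exp (s / 2) ^ Fintype.card D := by
        gcongr
    _ = _ := by
        rw [← Real.exp_nat_mul, ← Real.exp_add]
        congr 1
        field_simp; ring

end lattice

/-! ### Weighted quadratic forms and approximation by nets -/

section form

variable {N D : Type*} [Fintype N] [Fintype D]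

/-- The quadratic form `v ↦ ∑ⱼ μⱼ ⟨aⱼ, v⟩²` of a family of weighted rows `aⱼ`. -/
def rowForm (μ : N → ℝ) (a : N → D → ℝ) (v : D → ℝ) : ℝ := ∑ j, μ j * (∑ d, v d * a j d) ^ 2

theorem rowForm_nonneg {μ : N → ℝ} (hμ : ∀ j, 0 ≤ μ j) (a : N → D → ℝ) (v : D → ℝ) :
    0 ≤ rowForm μ a v :=
  Finset.sum_nonneg fun j _ => mul_nonneg (hμ j) (sq_nonneg _)

theorem rowForm_smul (μ : N → ℝ) (a : N → D → ℝ) (t : ℝ) (v : D → ℝ) :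
    rowForm μ a (fun d => t * v d) = t ^ 2 * rowForm μ a v := by
  simp only [rowForm, mul_assoc, ← Finset.mul_sum, mul_pow]
  rw [Finset.mul_sum]
  exact Finset.sum_congr rfl fun j _ => by ring

theorem rowForm_le_two {μ : N → ℝ} (hμ : ∀ j, 0 ≤ μ j) (a : N → D → ℝ) (v w : D → ℝ) :
    rowForm μ a v ≤ 2 * rowForm μ a w + 2 * rowForm μ a (fun d => v d - w d) := by
  simp only [rowForm, Finset.mul_sum, ← Finset.sum_add_distrib]
  refine Finset.sum_le_sum fun j _ => ?_
  have : ∑ d, v d * a j d = ∑ d, w d * a j d + ∑ d, (v d - w d) * a j d := by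
    rw [← Finset.sum_add_distrib]
    exact Finset.sum_congr rfl fun d _ => by ring
  rw [this]
  nlinarith [hμ j, sq_nonneg (∑ d, w d * a j d - ∑ d, (v d - w d) * a j d),
    mul_nonneg (hμ j) (sq_nonneg (∑ d, w d * a j d - ∑ d, (v d - w d) * a j d))]

theorem sum_sq_le_two {ι : Type*} (v w : ι → ℝ) (J : Finset ι) :
    ∑ d ∈ J, v d ^ 2 ≤ 2 * ∑ d ∈ J, w d ^ 2 + 2 * ∑ d ∈ J, (v d - w d) ^ 2 := by
  simp only [Finset.mul_sum, ← Finset.sum_add_distrib]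
  exact Finset.sum_le_sum fun d _ => by nlinarith [sq_nonneg (w d - (v d - w d))]

/-- A property of the values of a quadratic form, homogeneous in the vector, may be checked on unit
vectors. -/
theorem exists_unit_of_rowForm {μ : N → ℝ} {a : N → D → ℝ} {v : D → ℝ} (hv : 0 < ∑ d, v d ^ 2) :
    ∃ u : D → ℝ, ∑ d, u d ^ 2 = 1 ∧ rowForm μ a v = (∑ d, v d ^ 2) * rowForm μ a u := by
  have hr : √(∑ d, v d ^ 2) ^ 2 = ∑ d, v d ^ 2 := Real.sq_sqrt hv.le
  have hr0 : 0 < √(∑ d, v d ^ 2) := Real.sqrt_pos.2 hv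
  refine ⟨fun d => (√(∑ d, v d ^ 2))⁻¹ * v d, ?_, ?_⟩
  · simp only [mul_pow, ← Finset.mul_sum]
    rw [inv_pow, hr, inv_mul_cancel₀ hv.ne']
  · rw [rowForm_smul, inv_pow, hr, mul_inv_cancel_left₀ hv.ne']

theorem rowForm_eq_zero_of_sum_sq {μ : N → ℝ} {a : N → D → ℝ} {v : D → ℝ}
    (hv : ∑ d, v d ^ 2 = 0) : rowForm μ a v = 0 := by
  have : ∀ d, v d = 0 := fun d => by
    have := (Finset.sum_eq_zero_iff_of_nonneg fun d _ => sq_nonneg (v d)).1 hv d (Finset.mem_univ d)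
    simpa using this
  simp [rowForm, this]

/-- The mesh at which rounding moves a vector by at most `ε`. -/
theorem round_sum_sq_le [Nonempty D] {ε : ℝ} (hε : 0 < ε) {v : D → ℝ} (hv : ∑ d, v d ^ 2 = 1) :
    let h := ε / √(Fintype.card D)
    (fun d => truncDiv h (v d)) ∈ latticeBall D (Fintype.card D / ε) ∧
      (∀ d, |h * truncDiv h (v d)| ≤ |v d|) ∧
      ∑ d, (v d - h * truncDiv h (v d)) ^ 2 ≤ ε ^ 2 := by
  intro h
  have hn : (0 : ℝ) < Fintype.card D := by exact_mod_cast Fintype.card_pos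
  have hs : 0 < √(Fintype.card D : ℝ) := Real.sqrt_pos.2 hn
  have hs2 : √(Fintype.card D : ℝ) ^ 2 = Fintype.card D := Real.sq_sqrt hn.le
  have hh : 0 < h := by positivity
  refine ⟨?_, fun d => (truncDiv_spec hh (v d)).1, ?_⟩
  · rw [mem_latticeBall]
    -- A unit vector has `ℓ¹` norm at most the square root of the dimension, so its rounding
    -- satisfies the `ℓ¹` constraint of the lattice ball.
    have h1 : (∑ d, |v d|) ^ 2 ≤ Fintype.card D := by
      have := sq_sum_le_card_mul_sum_sq (s := Finset.univ) (f := fun d => |v d|)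
      simpa [sq_abs, hv] using this
    have h2 : ∑ d, |v d| ≤ √(Fintype.card D : ℝ) := Real.le_sqrt_of_sq_le h1
    calc ∑ d, |(truncDiv h (v d) : ℝ)| ≤ ∑ d, |v d| / h :=
          Finset.sum_le_sum fun d _ => abs_truncDiv_le hh _
      _ = (∑ d, |v d|) / h := by rw [Finset.sum_div]
      _ ≤ √(Fintype.card D : ℝ) / h := by gcongr
      _ = Fintype.card D / ε := by
          simp only [h]; field_simp; exact hs2
  · calc ∑ d, (v d - h * truncDiv h (v d)) ^ 2 ≤ ∑ _d : D, h ^ 2 := by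
          refine Finset.sum_le_sum fun d _ => ?_
          rw [← sq_abs]
          exact pow_le_pow_left₀ (abs_nonneg _) (truncDiv_spec hh (v d)).2 2
      _ = ε ^ 2 := by
          rw [Finset.sum_const, Finset.card_univ, nsmul_eq_mul]
          simp only [h, div_pow, hs2]; field_simp

theorem isCompact_unitBall : IsCompact {v : D → ℝ | ∑ d, v d ^ 2 ≤ 1} := by
  refine Metric.isCompact_of_isClosed_isBounded (isClosed_le (by fun_prop) continuous_const) ?_
  refine (Metric.isBounded_closedBall (x := (0 : D → ℝ)) (r := 1)).subset fun v hv => ?_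
  rw [mem_closedBall_zero_iff, pi_norm_le_iff_of_nonneg zero_le_one]
  intro d
  rw [Real.norm_eq_abs, ← sq_le_one_iff_abs_le_one]
  exact (Finset.single_le_sum (f := fun d => v d ^ 2) (fun _ _ => sq_nonneg _)
    (Finset.mem_univ d)).trans hv

/-- Passing from a `1/2`-net to the unit ball, for an upper bound. -/
theorem rowForm_le_of_net [Nonempty D] {μ : N → ℝ} (hμ : ∀ j, 0 ≤ μ j) {a : N → D → ℝ} {T : ℝ}
    (hT : 0 ≤ T)
    (hnet : ∀ m ∈ latticeBall D (Fintype.card D / (1 / 2 : ℝ)),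
      rowForm μ a (fun d => (1 / 2) / √(Fintype.card D) * (m d : ℝ))
        ≤ T * ∑ d, ((1 / 2) / √(Fintype.card D) * (m d : ℝ)) ^ 2) (v : D → ℝ) :
    rowForm μ a v ≤ 4 * T * ∑ d, v d ^ 2 := by
  have hcont : Continuous (rowForm μ a) := by unfold rowForm; fun_prop
  obtain ⟨w, hw, hmax⟩ := (isCompact_unitBall (D := D)).exists_isMaxOn ⟨0, by simp⟩
    hcont.continuousOn
  have hle : ∀ u : D → ℝ, rowForm μ a u ≤ (∑ d, u d ^ 2) * rowForm μ a w := by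
    intro u
    rcases (Finset.sum_nonneg fun d _ => sq_nonneg (u d) : 0 ≤ ∑ d, u d ^ 2).eq_or_lt with h0 | h0
    · rw [rowForm_eq_zero_of_sum_sq h0.symm, ← h0, zero_mul]
    · obtain ⟨u', h1, h2⟩ := exists_unit_of_rowForm (μ := μ) (a := a) h0
      rw [h2]
      exact mul_le_mul_of_nonneg_left (hmax (show ∑ d, u' d ^ 2 ≤ 1 from h1.le)) h0.le
  have hw4 : rowForm μ a w ≤ 4 * T := by
    rcases (Finset.sum_nonneg fun d _ => sq_nonneg (w d) : 0 ≤ ∑ d, w d ^ 2).eq_or_lt with h0 | h0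
    · rw [rowForm_eq_zero_of_sum_sq h0.symm]; positivity
    · obtain ⟨u, h1, h2⟩ := exists_unit_of_rowForm (μ := μ) (a := a) h0
      obtain ⟨hm, habs, hdist⟩ := round_sum_sq_le (ε := 1 / 2) (by norm_num) h1
      have h3 := rowForm_le_two hμ a u
        (fun d => (1 / 2) / √(Fintype.card D) * (truncDiv ((1 / 2) / √(Fintype.card D)) (u d) : ℝ))
      have h4 := hle (fun d => u d - (1 / 2) / √(Fintype.card D) *
        (truncDiv ((1 / 2) / √(Fintype.card D)) (u d) : ℝ))
      have h5 := hnet _ hm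
      have h6 : ∑ d, ((1 / 2) / √(Fintype.card D) *
          (truncDiv ((1 / 2) / √(Fintype.card D)) (u d) : ℝ)) ^ 2 ≤ 1 := by
        refine le_of_le_of_eq ?_ h1
        exact Finset.sum_le_sum fun d _ => sq_le_sq.2 (habs d)
      have h7 := rowForm_nonneg hμ a w
      have h8 := rowForm_nonneg hμ a u
      -- With `Q` the form and `w` its maximizer on the ball, `Q(w) ≤ Q(u) ≤ 2T + 2 · (1/4) Q(w)`,
      -- and the last term is absorbed on the left.
      have h9 : rowForm μ a w ≤ rowForm μ a u := by
        rw [h2]; exact mul_le_of_le_one_left h8 hw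
      have h10 := mul_le_mul_of_nonneg_right hdist h7
      have h11 := mul_le_mul_of_nonneg_left h6 hT
      linarith
  calc rowForm μ a v ≤ (∑ d, v d ^ 2) * rowForm μ a w := hle v
    _ ≤ (∑ d, v d ^ 2) * (4 * T) :=
        mul_le_mul_of_nonneg_left hw4 (Finset.sum_nonneg fun d _ => sq_nonneg _)
    _ = _ := by ring

end form

/-! ### Tails of random quadratic forms -/

/-- A random matrix whose entries are independent standardized sub-Gaussian variables. -/
structure IndepEntries {Ω N D : Type*} [MeasurableSpace Ω] (z : N → D → Ω → ℝ) (c : ℝ≥0)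
    (P : Measure Ω) : Prop where
  indep : iIndepFun (fun (q : N × D) ω => z q.1 q.2 ω) P
  std : ∀ j d, StdSubgaussian (z j d) c P

namespace IndepEntries

variable {Ω N D : Type*} [MeasurableSpace Ω] {z : N → D → Ω → ℝ} {c : ℝ≥0} {P : Measure Ω}

theorem submatrix (h : IndepEntries z c P) {N' D' : Type*} {f : N' → N} {g : D' → D}
    (hf : f.Injective) (hg : g.Injective) : IndepEntries (fun j d => z (f j) (g d)) c P :=
  ⟨h.indep.precomp (g := fun q : N' × D' => (f q.1, g q.2)) (hf.prodMap hg),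
    fun j d => h.std (f j) (g d)⟩

theorem transpose (h : IndepEntries z c P) : IndepEntries (fun d j => z j d) c P :=
  ⟨h.indep.precomp (g := Prod.swap) Prod.swap_injective, fun d j => h.std j d⟩

theorem row (h : IndepEntries z c P) (j : N) : iIndepFun (z j) P :=
  h.indep.precomp (g := fun d => (j, d)) fun d d' hd => by simpa using hd

variable [Fintype D]

theorem iIndepFun_rowSum (h : IndepEntries z c P) (v : D → ℝ) :
    iIndepFun (fun j ω => (∑ d, v d * z j d ω) ^ 2) P := by
  have h1 := ProbabilityTheory.iIndepFun.curry (fun j d => (h.std j d).measurable) h.indep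
  exact h1.comp (fun _ (x : D → ℝ) => (∑ d, v d * x d) ^ 2) fun _ => by fun_prop

theorem measurable_rowSum (h : IndepEntries z c P) (v : D → ℝ) (j : N) :
    Measurable (fun ω => (∑ d, v d * z j d ω) ^ 2) := by
  have := fun d => (h.std j d).measurable
  fun_prop

variable [Fintype N] [IsProbabilityMeasure P] {μ : N → ℝ}

/-- Upper tail of the quadratic form at a single vector. -/
theorem prob_le_rowForm (h : IndepEntries z c P) (hc : 0 < c) (h0 : ∀ j, 0 ≤ μ j)
    (h1 : ∀ j, μ j ≤ 1) (T : ℝ) (v : D → ℝ) :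
    P.real {ω | T * ∑ d, v d ^ 2 < rowForm μ (fun j d => z j d ω) v}
      ≤ Real.exp (-(1 / (4 * c)) * T) * 2 ^ (∑ j, μ j) := by
  rcases (Finset.sum_nonneg fun d _ => sq_nonneg (v d) : 0 ≤ ∑ d, v d ^ 2).eq_or_lt with hv | hv
  · have : {ω | T * ∑ d, v d ^ 2 < rowForm μ (fun j d => z j d ω) v} = ∅ := by
      ext ω
      simp [rowForm_eq_zero_of_sum_sq hv.symm, ← hv]
    rw [this, measureReal_empty]
    positivity
  have hc' : (0 : ℝ) < c := by exact_mod_cast hc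
  set r := √(∑ d, v d ^ 2)
  have hr : r ^ 2 = ∑ d, v d ^ 2 := Real.sq_sqrt hv.le
  have hr0 : 0 < r := Real.sqrt_pos.2 hv
  set w : D → ℝ := fun d => r⁻¹ * v d with hw
  have hw1 : ∑ d, w d ^ 2 = 1 := by
    simp only [hw, mul_pow, ← Finset.mul_sum]
    rw [inv_pow, hr, inv_mul_cancel₀ hv.ne']
  have hval : ∀ ω, rowForm μ (fun j d => z j d ω) v
      = (∑ d, v d ^ 2) * rowForm μ (fun j d => z j d ω) w := by
    intro ω
    rw [hw, rowForm_smul, inv_pow, hr, mul_inv_cancel_left₀ hv.ne']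
  have hstd := fun j => StdSubgaussian.sum_mul (h.row j) (h.std j) hw1
  obtain ⟨hint, hmgf⟩ := mgf_weighted_sum_le (h.iIndepFun_rowSum w) (h.measurable_rowSum w) h0 h1
    (t := 1 / (4 * c)) (L := 2) two_pos (fun j => ((hstd j).exp_sq hc).1)
    (fun j => ((hstd j).exp_sq hc).2)
  have h2 := measure_ge_le_exp_mul_mgf T (t := 1 / (4 * (c : ℝ))) (by positivity) hint
  refine le_trans (measureReal_mono fun ω hω => ?_)
    (h2.trans (mul_le_mul_of_nonneg_left hmgf (Real.exp_pos _).le))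
  simp only [Set.mem_ofPred_eq, hval ω] at hω ⊢
  rw [mul_comm] at hω
  exact (lt_of_mul_lt_mul_left hω hv.le).le

/-- Lower tail of the quadratic form at a single vector. -/
theorem prob_rowForm_le (h : IndepEntries z c P) (h0 : ∀ j, 0 ≤ μ j) (h1 : ∀ j, μ j ≤ 1)
    {v : D → ℝ} (hv : 0 < ∑ d, v d ^ 2) :
    P.real {ω | rowForm μ (fun j d => z j d ω) v ≤ (∑ j, μ j) / 4 * ∑ d, v d ^ 2}
      ≤ Real.exp (-(1 / momentBound c) / 4 * ∑ j, μ j) := by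
  have hM := momentBound_pos c
  set s := 1 / momentBound c with hs
  have hsp : 0 < s := by positivity
  set r := √(∑ d, v d ^ 2)
  have hr : r ^ 2 = ∑ d, v d ^ 2 := Real.sq_sqrt hv.le
  have hr0 : 0 < r := Real.sqrt_pos.2 hv
  set w : D → ℝ := fun d => r⁻¹ * v d with hw
  have hw1 : ∑ d, w d ^ 2 = 1 := by
    simp only [hw, mul_pow, ← Finset.mul_sum]
    rw [inv_pow, hr, inv_mul_cancel₀ hv.ne']
  have hval : ∀ ω, rowForm μ (fun j d => z j d ω) v
      = (∑ d, v d ^ 2) * rowForm μ (fun j d => z j d ω) w := by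
    intro ω
    rw [hw, rowForm_smul, inv_pow, hr, mul_inv_cancel_left₀ hv.ne']
  have hstd := fun j => StdSubgaussian.sum_mul (h.row j) (h.std j) hw1
  have hi : ∀ j, Integrable (fun ω => Real.exp (-s * (∑ d, w d * z j d ω) ^ 2)) P := by
    intro j
    have := h.measurable_rowSum w j
    refine Integrable.of_bound (this.const_mul _).exp.aestronglyMeasurable 1 (ae_of_all _ fun ω => ?_)
    rw [Real.norm_eq_abs, abs_of_pos (Real.exp_pos _), Real.exp_le_one_iff]
    have : 0 ≤ s * (∑ d, w d * z j d ω) ^ 2 := by positivity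
    linarith
  obtain ⟨hint, hmgf⟩ := mgf_weighted_sum_le (h.iIndepFun_rowSum w) (h.measurable_rowSum w) h0 h1
    (Real.exp_pos _) hi fun j => (hstd j).integral_exp_neg_sq_le
  -- The threshold, a quarter of the mean, costs `exp (s S / 4)`, while the Laplace transform gives
  -- `exp (-s S / 2)`, where `S = ∑ μ`.
  have h2 := measure_le_le_exp_mul_mgf ((∑ j, μ j) / 4) (t := -s) (by linarith) hint
  refine le_trans (measureReal_mono fun ω hω => ?_)
    (h2.trans ((mul_le_mul_of_nonneg_left hmgf (Real.exp_pos _).le).trans (le_of_eq ?_)))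
  · simp only [Set.mem_ofPred_eq, hval ω] at hω ⊢
    rw [mul_comm] at hω
    exact le_of_mul_le_mul_right hω hv
  · rw [← Real.exp_mul, ← Real.exp_add]
    congr 1; ring

/-- Lower tail of the quadratic form at a vector with many small coordinates. -/
theorem prob_rowForm_le_of_spread (h : IndepEntries z c P) (h0 : ∀ j, 0 ≤ μ j)
    (h1 : ∀ j, μ j ≤ 1) {v : D → ℝ} {J : Finset D} {δ τ θ : ℝ} (hτ : 0 < τ) (hθ : 0 < θ)
    (hδ : 0 < δ) (hJ : ∀ d ∈ J, |v d| ≤ δ) (hv : θ ^ 2 ≤ ∑ d ∈ J, v d ^ 2) :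
    P.real {ω | rowForm μ (fun j d => z j d ω) v ≤ 2 * τ ^ 2 * ∑ j, μ j}
      ≤ (Real.exp 1 * (2 * τ / θ + (16 * momentBound c * δ / τ) ^ 2)) ^ (∑ j, μ j) := by
  have hM := momentBound_pos c
  have hi : ∀ j, Integrable
      (fun ω => Real.exp (-(1 / (2 * τ ^ 2)) * (∑ d, v d * z j d ω) ^ 2)) P := by
    intro j
    have := h.measurable_rowSum v j
    refine Integrable.of_bound (this.const_mul _).exp.aestronglyMeasurable 1 (ae_of_all _ fun ω => ?_)
    rw [Real.norm_eq_abs, abs_of_pos (Real.exp_pos _), Real.exp_le_one_iff]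
    have : 0 ≤ 1 / (2 * τ ^ 2) * (∑ d, v d * z j d ω) ^ 2 := by positivity
    linarith
  obtain ⟨hint, hmgf⟩ := mgf_weighted_sum_le (h.iIndepFun_rowSum v) (h.measurable_rowSum v) h0 h1
    (L := 2 * τ / θ + (16 * momentBound c * δ / τ) ^ 2) (by positivity) hi
    fun j => integral_exp_neg_sq_sum_le (h.row j) (h.std j) hτ hθ hδ hJ hv
  -- Here threshold times parameter is exactly `∑ μ`, so the Chernoff factor is `exp 1` per unit of
  -- weight and merges with the base of the power.
  have h2 := measure_le_le_exp_mul_mgf (2 * τ ^ 2 * ∑ j, μ j) (t := -(1 / (2 * τ ^ 2)))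
    (neg_nonpos.2 (by positivity)) hint
  refine h2.trans ((mul_le_mul_of_nonneg_left hmgf (Real.exp_pos _).le).trans (le_of_eq ?_))
  rw [Real.mul_rpow (Real.exp_pos _).le (by positivity), ← Real.exp_mul]
  congr 2
  field_simp

/-- The quadratic form is at most of order `∑ μ + dim` times the norm, uniformly. -/
theorem prob_exists_lt_rowForm (h : IndepEntries z c P) (hc : 0 < c) (h0 : ∀ j, 0 ≤ μ j)
    (h1 : ∀ j, μ j ≤ 1) :
    P.real {ω | ∃ v : D → ℝ, 80 * c * (∑ j, μ j + Fintype.card D) * ∑ d, v d ^ 2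
        < rowForm μ (fun j d => z j d ω) v} ≤ Real.exp (-(∑ j, μ j + Fintype.card D)) := by
  classical
  have hc' : (0 : ℝ) < c := by exact_mod_cast hc
  have hS : 0 ≤ ∑ j, μ j := Finset.sum_nonneg fun j _ => h0 j
  rcases isEmpty_or_nonempty D with hD | hD
  · have : {ω | ∃ v : D → ℝ, 80 * c * (∑ j, μ j + Fintype.card D) * ∑ d, v d ^ 2
        < rowForm μ (fun j d => z j d ω) v} = ∅ := by
      ext ω; simp [rowForm]
    rw [this, measureReal_empty]; positivity
  set S := ∑ j, μ j
  set n : ℝ := (Fintype.card D : ℝ)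
  have hn : 0 ≤ n := by positivity
  -- With this `T` a single vector fails with probability at most `exp (-5 (S + n)) 2 ^ S`, which
  -- beats the `24 ^ n ≤ exp (4 n)` net points; passing from the net to all vectors costs a factor
  -- `4`.
  set T := 20 * c * (S + n) with hT
  have hTn : 0 ≤ T := by positivity
  set F := latticeBall D (Fintype.card D / (1 / 2 : ℝ))
  set vec : (D → ℤ) → D → ℝ := fun m d => (1 / 2) / √(Fintype.card D) * (m d : ℝ)
  have hsub : {ω | ∃ v : D → ℝ, 80 * c * (S + n) * ∑ d, v d ^ 2
        < rowForm μ (fun j d => z j d ω) v}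
      ⊆ ⋃ m ∈ F, {ω | T * ∑ d, vec m d ^ 2 < rowForm μ (fun j d => z j d ω) (vec m)} := by
    rintro ω ⟨v, hv⟩
    by_contra hcon
    simp only [Set.mem_iUnion, Set.mem_ofPred_eq, not_exists, not_lt] at hcon
    have := rowForm_le_of_net h0 hTn hcon v
    have e : 4 * T = 80 * c * (S + n) := by rw [hT]; ring
    rw [e] at this
    linarith
  have hcard := card_latticeBall_div_le (D := D) (ε := 1 / 2) (by norm_num) (by norm_num)
  have h24 : (12 / (1 / 2) : ℝ) ≤ Real.exp 4 := by
    have h2 := Real.exp_one_gt_d9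
    have : Real.exp 4 = Real.exp 1 ^ 4 := by rw [← Real.exp_nat_mul]; norm_num
    rw [this]
    calc (12 / (1 / 2) : ℝ) ≤ 2.7 ^ 4 := by norm_num
      _ ≤ _ := by gcongr; linarith
  have h2S : (2 : ℝ) ^ S ≤ Real.exp S := by
    rw [← Real.exp_one_rpow S]
    exact Real.rpow_le_rpow (by norm_num) (by linarith [Real.exp_one_gt_d9]) hS
  calc _ ≤ P.real (⋃ m ∈ F, {ω | T * ∑ d, vec m d ^ 2
          < rowForm μ (fun j d => z j d ω) (vec m)}) :=
        measureReal_mono hsub (measure_ne_top _ _)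
    _ ≤ ∑ m ∈ F, P.real {ω | T * ∑ d, vec m d ^ 2 < rowForm μ (fun j d => z j d ω) (vec m)} :=
        measureReal_biUnion_finset_le _ _
    _ ≤ ∑ _m ∈ F, Real.exp (-(1 / (4 * c)) * T) * 2 ^ S :=
        Finset.sum_le_sum fun m _ => h.prob_le_rowForm hc h0 h1 T (vec m)
    _ = F.card * (Real.exp (-(1 / (4 * c)) * T) * 2 ^ S) := by
        rw [Finset.sum_const, nsmul_eq_mul]
    _ ≤ Real.exp 4 ^ Fintype.card D * (Real.exp (-(5 * (S + n))) * Real.exp S) := by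
        have e : -(1 / (4 * c)) * T = -(5 * (S + n)) := by rw [hT]; field_simp; ring
        rw [e]
        have := hcard.trans (pow_le_pow_left₀ (by norm_num) h24 _)
        gcongr
    _ = Real.exp (-4 * S - n) := by
        rw [← Real.exp_nat_mul, ← Real.exp_add, ← Real.exp_add]
        congr 1
        simp only [n]; ring
    _ ≤ Real.exp (-(S + n)) := Real.exp_le_exp.2 (by linarith)

end IndepEntries

/-! ### Smallest singular values of weighted random matrices -/

/-- A vector close to a long vector on which the form is large. -/
theorem le_rowForm_of_close {N D : Type*} [Fintype N] [Fintype D] {μ : N → ℝ}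
    (hμ : ∀ j, 0 ≤ μ j) {a : N → D → ℝ} {u w : D → ℝ} {A q e : ℝ} (hA : 0 ≤ A)
    (hup : ∀ v : D → ℝ, rowForm μ a v ≤ A * ∑ d, v d ^ 2)
    (hd : ∑ d, (u d - w d) ^ 2 ≤ e) (hw : q ≤ rowForm μ a w) :
    q / 2 - A * e ≤ rowForm μ a u := by
  have h1 := rowForm_le_two hμ a w u
  have h2 := hup (fun d => w d - u d)
  have h3 : ∑ d, (w d - u d) ^ 2 = ∑ d, (u d - w d) ^ 2 :=
    Finset.sum_congr rfl fun d _ => by ring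
  have h4 := mul_le_mul_of_nonneg_left hd hA
  rw [h3] at h2
  linarith

/-- The smallest singular value of a tall random matrix with weighted rows. -/
theorem exists_prob_rowForm_lt_of_tall {c : ℝ≥0} (hc : 0 < c) :
    ∃ c₀ c₁ : ℝ, 0 < c₀ ∧ 0 < c₁ ∧ c₀ ≤ 1 ∧ c₁ ≤ 1 ∧
      ∀ (Ω N D : Type) [MeasurableSpace Ω] [Fintype N] [Fintype D] (P : Measure Ω)
        [IsProbabilityMeasure P] (z : N → D → Ω → ℝ) (μ : N → ℝ), IndepEntries z c P →
        (∀ j, 0 ≤ μ j) → (∀ j, μ j ≤ 1) → (Fintype.card D : ℝ) ≤ c₁ * ∑ j, μ j →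
        P.real {ω | ∃ v : D → ℝ, rowForm μ (fun j d => z j d ω) v
          < c₀ * (∑ j, μ j) * ∑ d, v d ^ 2} ≤ 2 * Real.exp (-c₀ * ∑ j, μ j) := by
  classical
  have hc' : (0 : ℝ) < c := by exact_mod_cast hc
  have hM := momentBound_pos c
  set s := 1 / momentBound c with hs
  have hsp : 0 < s := by positivity
  have hs1 : s ≤ 1 := by rw [hs, div_le_one (by linarith)]; linarith
  -- `B S` bounds the form from above, since the dimension is at most `S`. A net point `w` has `|w|²
  -- ≥ 1/4`, hence a value above `S/16`. At distance `ε` the form is still at least `S/32 - B S ε² ≥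
  -- S/64`.
  set B := 160 * (c : ℝ) with hB
  have hBp : 0 < B := by positivity
  set ε := 1 / (2 + 64 * B) with hε
  have hεp : 0 < ε := by positivity
  have hε2 : ε ≤ 1 / 2 := one_div_le_one_div_of_le (by norm_num) (by linarith)
  have hεB : B * ε ^ 2 ≤ 1 / 64 := by
    rw [hε, div_pow, one_pow, mul_one_div, div_le_div_iff₀ (by positivity) (by norm_num)]
    nlinarith
  set ℓ := Real.log (12 / ε) with hℓ
  have h12 : 1 < 12 / ε := by rw [lt_div_iff₀ hεp]; linarith
  have hℓp : 0 < ℓ := Real.log_pos h12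
  -- The second constant keeps the net below `exp (s S / 8)`, half the exponent of the failure
  -- probability `exp (-s S / 4)` of a single point.
  refine ⟨min (1 / 64) (s / 8), min 1 (s / (8 * ℓ)), by positivity, by positivity,
    (min_le_left _ _).trans (by norm_num), min_le_left _ _, ?_⟩
  intro Ω N D _ _ _ P _ z μ h h0 h1 hcard
  set S := ∑ j, μ j
  have hS : 0 ≤ S := Finset.sum_nonneg fun j _ => h0 j
  set c₀ := min (1 / 64) (s / 8)
  have hc₀ : c₀ ≤ 1 / 64 := min_le_left _ _
  have hc₀s : c₀ ≤ s / 8 := min_le_right _ _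
  have hd1 : (Fintype.card D : ℝ) ≤ S :=
    hcard.trans (mul_le_of_le_one_left hS (min_le_left _ _))
  have hd2 : (Fintype.card D : ℝ) * ℓ ≤ s * S / 8 := by
    have : (Fintype.card D : ℝ) ≤ s / (8 * ℓ) * S :=
      hcard.trans (mul_le_mul_of_nonneg_right (min_le_right _ _) hS)
    rw [div_mul_eq_mul_div, le_div_iff₀ (by positivity)] at this
    linarith
  rcases isEmpty_or_nonempty D with hD | hD
  · have : {ω | ∃ v : D → ℝ, rowForm μ (fun j d => z j d ω) v
        < c₀ * S * ∑ d, v d ^ 2} = ∅ := by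
      ext ω; simp [rowForm]
    rw [this, measureReal_empty]; positivity
  set hmesh := ε / √(Fintype.card D)
  set vec : (D → ℤ) → D → ℝ := fun m d => hmesh * (m d : ℝ)
  set F := (latticeBall D (Fintype.card D / ε)).filter fun m => 0 < ∑ d, vec m d ^ 2
  set E₁ := {ω | ∃ v : D → ℝ, 80 * c * (S + Fintype.card D) * ∑ d, v d ^ 2
        < rowForm μ (fun j d => z j d ω) v}
  set E₂ := ⋃ m ∈ F, {ω | rowForm μ (fun j d => z j d ω) (vec m) ≤ S / 4 * ∑ d, vec m d ^ 2}
  have hsub : {ω | ∃ v : D → ℝ, rowForm μ (fun j d => z j d ω) v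
      < c₀ * S * ∑ d, v d ^ 2} ⊆ E₁ ∪ E₂ := by
    rintro ω ⟨v, hv⟩
    by_contra hcon
    rw [Set.mem_union, not_or] at hcon
    obtain ⟨hn1, hn2⟩ := hcon
    simp only [E₁, E₂, Set.mem_iUnion, Set.mem_ofPred_eq, not_exists, not_lt, not_le] at hn1 hn2
    have hup : ∀ v : D → ℝ, rowForm μ (fun j d => z j d ω) v ≤ B * S * ∑ d, v d ^ 2 := by
      intro v
      refine (hn1 v).trans (mul_le_mul_of_nonneg_right ?_
        (Finset.sum_nonneg fun d _ => sq_nonneg _))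
      rw [hB]; nlinarith
    have hv0 : 0 < ∑ d, v d ^ 2 := by
      rcases (Finset.sum_nonneg fun d _ => sq_nonneg (v d) : 0 ≤ ∑ d, v d ^ 2).eq_or_lt with h0 | h0
      · rw [rowForm_eq_zero_of_sum_sq h0.symm, ← h0] at hv; simp at hv
      · exact h0
    obtain ⟨u, hu1, hu2⟩ := exists_unit_of_rowForm (μ := μ) (a := fun j d => z j d ω) hv0
    rw [hu2, mul_comm] at hv
    have hu3 := lt_of_mul_lt_mul_right hv hv0.le
    obtain ⟨hm, -, hdist⟩ := round_sum_sq_le hεp hu1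
    have hlen : 1 / 4 ≤ ∑ d, vec (fun d => truncDiv hmesh (u d)) d ^ 2 := by
      have := sum_sq_le_two u (vec fun d => truncDiv hmesh (u d)) Finset.univ
      rw [hu1] at this
      have h2 : ε ^ 2 ≤ 1 / 4 := by nlinarith
      have h3 := hdist.trans h2
      simp only [vec, hmesh] at this h3 ⊢
      linarith
    have hq := hn2 _ (Finset.mem_filter.2 ⟨hm, by linarith⟩)
    have hclose := le_rowForm_of_close h0 (by positivity) hup hdist hq.le
    have h5 := mul_le_mul_of_nonneg_left hlen hS
    have h6 := mul_le_mul_of_nonneg_right hεB hS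
    have h7 := mul_le_mul_of_nonneg_right hc₀ hS
    simp only [vec, hmesh] at hclose h5
    linarith
  have hE₁ : P.real E₁ ≤ Real.exp (-c₀ * S) := by
    refine (h.prob_exists_lt_rowForm hc h0 h1).trans (Real.exp_le_exp.2 ?_)
    have h7 := mul_le_mul_of_nonneg_right hc₀ hS
    have : (0 : ℝ) ≤ Fintype.card D := by positivity
    linarith
  have hE₂ : P.real E₂ ≤ Real.exp (-c₀ * S) := by
    calc P.real E₂ ≤ ∑ m ∈ F, P.real {ω | rowForm μ (fun j d => z j d ω) (vec m)
          ≤ S / 4 * ∑ d, vec m d ^ 2} := measureReal_biUnion_finset_le _ _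
      _ ≤ ∑ _m ∈ F, Real.exp (-s / 4 * S) :=
          Finset.sum_le_sum fun m hm => h.prob_rowForm_le h0 h1 (Finset.mem_filter.1 hm).2
      _ = F.card * Real.exp (-s / 4 * S) := by rw [Finset.sum_const, nsmul_eq_mul]
      _ ≤ Real.exp (Fintype.card D * ℓ) * Real.exp (-s / 4 * S) := by
          have hF : (F.card : ℝ) ≤ Real.exp (Fintype.card D * ℓ) := by
            rw [Real.exp_nat_mul, hℓ, Real.exp_log (by positivity)]
            refine le_trans ?_ (card_latticeBall_div_le (D := D) hεp (by linarith))
            exact_mod_cast Finset.card_filter_le _ _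
          gcongr
      _ ≤ Real.exp (-c₀ * S) := by
          rw [← Real.exp_add]
          refine Real.exp_le_exp.2 ?_
          have h7 := mul_le_mul_of_nonneg_right hc₀s hS
          linarith
  calc _ ≤ P.real (E₁ ∪ E₂) := measureReal_mono hsub (measure_ne_top _ _)
    _ ≤ P.real E₁ + P.real E₂ := measureReal_union_le _ _
    _ ≤ _ := by linarith

/-- Rounding a vector supported on large coordinates. -/
theorem round_large_coords {D : Type*} [Fintype D] [Nonempty D] {ε K : ℝ} (hε : 0 < ε) (hK : 0 < K) {u : D → ℝ}
    (hu : ∑ d, u d ^ 2 = 1)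
    (hsmall : ∑ d with |u d| ≤ K / √(Fintype.card D), u d ^ 2 ≤ ε ^ 2) :
    ∃ m ∈ latticeBall D (1 / (ε * K ^ 2) * Fintype.card D),
      ∑ d, (u d - ε * K / √(Fintype.card D) * (m d : ℝ)) ^ 2 ≤ 2 * ε ^ 2 := by
  classical
  have hn : (0 : ℝ) < Fintype.card D := by exact_mod_cast Fintype.card_pos
  set r := √(Fintype.card D : ℝ)
  have hr : 0 < r := Real.sqrt_pos.2 hn
  have hr2 : r ^ 2 = Fintype.card D := Real.sq_sqrt hn.le
  set h := ε * K / r with hh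
  have hhp : 0 < h := by positivity
  set J : Finset D := Finset.univ.filter fun d => ¬ |u d| ≤ K / r
  have hJ : ∀ d ∈ J, K / r < |u d| := fun d hd => not_le.1 (Finset.mem_filter.1 hd).2
  have hJsum : ∑ d ∈ J, u d ^ 2 ≤ 1 := by
    rw [← hu]
    exact Finset.sum_le_sum_of_subset_of_nonneg (Finset.subset_univ _) fun d _ _ => sq_nonneg _
  -- Small coordinates are dropped. A large one satisfies `|u d| ≤ u d ^ 2 * r / K`, which turns the
  -- `ℓ¹` norm into the `ℓ²` norm. At most `r² / K²` coordinates are large, so a mesh as coarse as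
  -- `ε K / r` has total squared error at most `ε²`.
  refine ⟨fun d => if |u d| ≤ K / r then 0 else truncDiv h (u d), ?_, ?_⟩
  · rw [mem_latticeBall]
    calc ∑ d, |((if |u d| ≤ K / r then 0 else truncDiv h (u d) : ℤ) : ℝ)|
        = ∑ d, if |u d| ≤ K / r then 0 else |(truncDiv h (u d) : ℝ)| := by
          refine Finset.sum_congr rfl fun d _ => ?_
          split_ifs <;> simp
      _ = ∑ d ∈ J, |(truncDiv h (u d) : ℝ)| := by
          rw [Finset.sum_ite]; simp [J]
      _ ≤ ∑ d ∈ J, u d ^ 2 * (r / (K * h)) := by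
          refine Finset.sum_le_sum fun d hd => (abs_truncDiv_le hhp _).trans ?_
          have h1 := (hJ d hd).le
          rw [div_le_iff₀ hr] at h1
          rw [← sq_abs, mul_div_assoc', div_le_div_iff₀ hhp (by positivity)]
          nlinarith [mul_le_mul_of_nonneg_left h1 (mul_nonneg (abs_nonneg (u d)) hhp.le)]
      _ = (∑ d ∈ J, u d ^ 2) * (r / (K * h)) := by rw [Finset.sum_mul]
      _ ≤ 1 * (r / (K * h)) := by gcongr
      _ = 1 / (ε * K ^ 2) * Fintype.card D := by
          rw [← hr2, hh]; field_simp
  · have hcardJ : (J.card : ℝ) * h ^ 2 ≤ ε ^ 2 := by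
      have h1 : (J.card : ℝ) * (K / r) ^ 2 ≤ 1 := by
        rw [← nsmul_eq_mul, ← Finset.sum_const]
        refine (Finset.sum_le_sum fun d hd => ?_).trans hJsum
        rw [← sq_abs (u d)]
        exact pow_le_pow_left₀ (by positivity) (hJ d hd).le 2
      have h2 := mul_le_mul_of_nonneg_right h1 (sq_nonneg ε)
      have e : h ^ 2 = (K / r) ^ 2 * ε ^ 2 := by rw [hh]; ring
      rw [e]; linarith
    rw [← Finset.sum_filter_add_sum_filter_not _ fun d => |u d| ≤ K / r]
    have h1 : ∑ d with |u d| ≤ K / r,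
        (u d - h * ((if |u d| ≤ K / r then 0 else truncDiv h (u d) : ℤ) : ℝ)) ^ 2 ≤ ε ^ 2 := by
      refine le_trans (le_of_eq (Finset.sum_congr rfl fun d hd => ?_)) hsmall
      rw [if_pos (Finset.mem_filter.1 hd).2]; simp
    have h2 : ∑ d ∈ J,
        (u d - h * ((if |u d| ≤ K / r then 0 else truncDiv h (u d) : ℤ) : ℝ)) ^ 2 ≤ ε ^ 2 := by
      refine le_trans (Finset.sum_le_sum fun d hd => ?_)
        ((le_of_eq (by rw [Finset.sum_const, nsmul_eq_mul])).trans hcardJ)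
      rw [if_neg (Finset.mem_filter.1 hd).2, ← sq_abs]
      exact pow_le_pow_left₀ (abs_nonneg _) (truncDiv_spec hhp _).2 2
    linarith

/-- Rounding a vector with substantial mass on small coordinates. -/
theorem round_small_coords {D : Type*} [Fintype D] [Nonempty D] {ε ε' K : ℝ} (hε : 0 < ε)
    (hε' : 0 < ε') (hle : ε' ≤ ε / 2) {u : D → ℝ} (hu : ∑ d, u d ^ 2 = 1)
    (hbig : ε ^ 2 < ∑ d with |u d| ≤ K / √(Fintype.card D), u d ^ 2) :
    ∃ m ∈ latticeBall D (Fintype.card D / ε'),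
      ∑ d, (u d - ε' / √(Fintype.card D) * (m d : ℝ)) ^ 2 ≤ ε' ^ 2 ∧
      (ε / 2) ^ 2 ≤ ∑ d with |ε' / √(Fintype.card D) * (m d : ℝ)| ≤ K / √(Fintype.card D),
        (ε' / √(Fintype.card D) * (m d : ℝ)) ^ 2 := by
  obtain ⟨hm, habs, hdist⟩ := round_sum_sq_le hε' hu
  refine ⟨_, hm, hdist, ?_⟩
  set w : D → ℝ := fun d => ε' / √(Fintype.card D) * (truncDiv (ε' / √(Fintype.card D)) (u d) : ℝ)
  set J : Finset D := Finset.univ.filter fun d => |u d| ≤ K / √(Fintype.card D)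
  have h1 := sum_sq_le_two u w J
  have h2 : ∑ d ∈ J, (u d - w d) ^ 2 ≤ ε' ^ 2 :=
    (Finset.sum_le_sum_of_subset_of_nonneg (Finset.subset_univ _)
      fun d _ _ => sq_nonneg _).trans hdist
  -- A coordinate that is small before rounding towards `0` is small afterwards.
  have h3 : ∑ d ∈ J, w d ^ 2 ≤ ∑ d with |w d| ≤ K / √(Fintype.card D), w d ^ 2 := by
    refine Finset.sum_le_sum_of_subset_of_nonneg (fun d hd => ?_) fun d _ _ => sq_nonneg _
    exact Finset.mem_filter.2 ⟨Finset.mem_univ _, (habs d).trans (Finset.mem_filter.1 hd).2⟩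
  have h4 : ε' ^ 2 ≤ ε ^ 2 / 4 := by nlinarith
  refine le_trans ?_ h3
  linarith

set_option maxHeartbeats 2000000 in
/-- The smallest singular value of a random matrix with weighted rows, when the total weight is at
least twice the dimension. -/
theorem exists_prob_rowForm_lt_of_two_mul_le {c : ℝ≥0} (hc : 0 < c) :
    ∃ c₀ n₀ : ℝ, 0 < c₀ ∧ c₀ ≤ 1 ∧ 1 ≤ n₀ ∧
      ∀ (Ω N D : Type) [MeasurableSpace Ω] [Fintype N] [Fintype D] (P : Measure Ω)
        [IsProbabilityMeasure P] (z : N → D → Ω → ℝ) (μ : N → ℝ), IndepEntries z c P →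
        (∀ j, 0 ≤ μ j) → (∀ j, μ j ≤ 1) → n₀ ≤ Fintype.card D →
        2 * (Fintype.card D : ℝ) ≤ ∑ j, μ j →
        P.real {ω | ∃ v : D → ℝ, rowForm μ (fun j d => z j d ω) v
          < c₀ * (∑ j, μ j) * ∑ d, v d ^ 2} ≤ 3 * Real.exp (-c₀ * Fintype.card D) := by
  classical
  have hc' : (0 : ℝ) < c := by exact_mod_cast hc
  have hM := momentBound_pos c
  set M := momentBound c
  set s := 1 / M with hs
  have hsp : 0 < s := by positivity
  have hs1 : s ≤ 1 := by rw [hs, div_le_one (by linarith)]; linarith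
  set B := 160 * (c : ℝ) with hB
  have hBp : 0 < B := by positivity
  -- Rounding on the large coordinates has squared error `2 ε²`, so `B ε² ≤ 1/128` is what leaves
  -- `S/32 - 2 B S ε² ≥ S/64`.
  set ε := 1 / (3 + 128 * B) with hε
  have hεp : 0 < ε := by positivity
  have hε2 : ε ≤ 1 / 3 := one_div_le_one_div_of_le (by norm_num) (by linarith)
  have hεB : B * ε ^ 2 ≤ 1 / 128 := by
    rw [hε, div_pow, one_pow, mul_one_div, div_le_div_iff₀ (by positivity) (by norm_num)]
    nlinarith
  obtain ⟨κ, hκ, hcount⟩ := exists_card_latticeBall_le (s := s / 4) (by positivity)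
  -- Chosen so that the net for concentrated vectors has `ℓ¹` radius `κ n`, hence at most `exp (s n
  -- / 4)` points. Each fails with probability at most `exp (-s S / 4) ≤ exp (-s n / 2)`.
  set K := √(1 / (ε * κ)) with hK
  have hKp : 0 < K := Real.sqrt_pos.2 (by positivity)
  have hK2 : 1 / (ε * K ^ 2) = κ := by
    rw [hK, Real.sq_sqrt (by positivity)]; field_simp
  set θ := ε / 2 with hθ
  have hθp : 0 < θ := by positivity
  set β := ε / (2 * (1 + B)) with hβ
  have hβp : 0 < β := by positivity
  have hβε : β ≤ ε / 2 := by
    rw [hβ]; apply div_le_div_of_nonneg_left hεp.le (by norm_num) (by linarith)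
  have hβB : B * β ^ 2 ≤ 1 / 2 := by
    have h1 : B * β ≤ ε / 2 := by
      rw [hβ, mul_div_assoc', div_le_div_iff₀ (by positivity) (by norm_num)]; nlinarith
    nlinarith
  -- For spread vectors the net has at most `(12 / (β τ)) ^ n` points, each failing with probability
  -- at most `(9 τ / θ) ^ (2 n)`. The product is `(972 τ / (β θ²)) ^ n`, and this `τ` makes it
  -- `(1/3) ^ n`. The total weight `2 n` provides the spare factor `τ ^ n`: a weight of `n` alone
  -- would leave nothing.
  set τ := β * θ ^ 2 / 2916 with hτ
  have hτp : 0 < τ := by positivity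
  have hθ1 : θ ≤ 1 / 4 := by rw [hθ]; linarith
  have hβ1 : β ≤ 1 / 4 := by linarith
  have hβθ : β * θ ≤ 1 / 16 := by nlinarith
  have hτ1 : τ ≤ 1 := by rw [hτ]; nlinarith
  have hτθ : 9 * τ / θ ≤ 1 := by
    rw [div_le_one hθp, hτ]; nlinarith
  set ε' := β * τ with hε'
  have hε'p : 0 < ε' := by positivity
  have hε'ε : ε' ≤ ε / 2 := (mul_le_of_le_one_right hβp.le hτ1).trans hβε
  have hBε' : B * ε' ^ 2 ≤ τ ^ 2 / 2 := by
    rw [hε', mul_pow]; nlinarith [mul_le_mul_of_nonneg_right hβB (sq_nonneg τ)]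
  clear_value ε' τ β θ K ε B
  -- The small coordinates are at most `δ = K / √n`. From the dimension `n₀` on, the error `(16 M δ
  -- / τ)²` of the small-ball estimate is at most `τ / θ`, and `exp 1 * (3 τ / θ) ≤ 9 τ / θ`.
  refine ⟨min (1 / 64) (min (s / 4) (τ ^ 2 / 2)), max 1 ((16 * M * K / τ) ^ 2 * θ / τ),
    by positivity, (min_le_left _ _).trans (by norm_num), le_max_left _ _, ?_⟩
  intro Ω N D _ _ _ P _ z μ h h0 h1 hn₀ hS2
  set S := ∑ j, μ j
  set c₀ := min (1 / 64) (min (s / 4) (τ ^ 2 / 2))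
  have hc₀1 : c₀ ≤ 1 / 64 := min_le_left _ _
  have hc₀s : c₀ ≤ s / 4 := (min_le_right _ _).trans (min_le_left _ _)
  have hc₀τ : c₀ ≤ τ ^ 2 / 2 := (min_le_right _ _).trans (min_le_right _ _)
  have hn1 : (1 : ℝ) ≤ Fintype.card D := (le_max_left _ _).trans hn₀
  have hnK : (16 * M * K / τ) ^ 2 * θ / τ ≤ Fintype.card D := (le_max_right _ _).trans hn₀
  have hne : Nonempty D := by
    rw [← Fintype.card_pos_iff]; exact_mod_cast (by linarith : (0 : ℝ) < Fintype.card D)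
  set n : ℝ := (Fintype.card D : ℝ) with hn
  have hnp : 0 < n := by linarith
  have hS : 0 ≤ S := by linarith
  have hr : 0 < √n := Real.sqrt_pos.2 hnp
  set vec₂ : (D → ℤ) → D → ℝ := fun m d => ε * K / √n * (m d : ℝ)
  set vec₃ : (D → ℤ) → D → ℝ := fun m d => ε' / √n * (m d : ℝ)
  set F₂ := (latticeBall D (κ * n)).filter fun m => 0 < ∑ d, vec₂ m d ^ 2
  set F₃ := (latticeBall D (n / ε')).filter
    fun m => θ ^ 2 ≤ ∑ d with |vec₃ m d| ≤ K / √n, vec₃ m d ^ 2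
  set E₁ := {ω | ∃ v : D → ℝ, 80 * c * (S + n) * ∑ d, v d ^ 2
        < rowForm μ (fun j d => z j d ω) v}
  set E₂ := ⋃ m ∈ F₂, {ω | rowForm μ (fun j d => z j d ω) (vec₂ m) ≤ S / 4 * ∑ d, vec₂ m d ^ 2}
  set E₃ := ⋃ m ∈ F₃, {ω | rowForm μ (fun j d => z j d ω) (vec₃ m) ≤ 2 * τ ^ 2 * S}
  have hsub : {ω | ∃ v : D → ℝ, rowForm μ (fun j d => z j d ω) v
      < c₀ * S * ∑ d, v d ^ 2} ⊆ E₁ ∪ E₂ ∪ E₃ := by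
    rintro ω ⟨v, hv⟩
    by_contra hcon
    rw [Set.mem_union, Set.mem_union, not_or, not_or] at hcon
    obtain ⟨⟨hn1, hn2⟩, hn3⟩ := hcon
    simp only [E₁, E₂, E₃, Set.mem_iUnion, Set.mem_ofPred_eq, not_exists, not_lt, not_le]
      at hn1 hn2 hn3
    have hup : ∀ v : D → ℝ, rowForm μ (fun j d => z j d ω) v ≤ B * S * ∑ d, v d ^ 2 := by
      intro v
      refine (hn1 v).trans (mul_le_mul_of_nonneg_right ?_
        (Finset.sum_nonneg fun d _ => sq_nonneg _))
      have := mul_le_mul_of_nonneg_left (show n ≤ S by linarith) hc'.le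
      rw [hB]; linarith
    have hv0 : 0 < ∑ d, v d ^ 2 := by
      rcases (Finset.sum_nonneg fun d _ => sq_nonneg (v d) : 0 ≤ ∑ d, v d ^ 2).eq_or_lt with h0 | h0
      · rw [rowForm_eq_zero_of_sum_sq h0.symm, ← h0] at hv; simp at hv
      · exact h0
    obtain ⟨u, hu1, hu2⟩ := exists_unit_of_rowForm (μ := μ) (a := fun j d => z j d ω) hv0
    rw [hu2, mul_comm] at hv
    have hu3 := lt_of_mul_lt_mul_right hv hv0.le
    rcases le_or_gt (∑ d with |u d| ≤ K / √n, u d ^ 2) (ε ^ 2) with hcase | hcase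
    · obtain ⟨m, hm, hdist⟩ := round_large_coords hεp hKp hu1 hcase
      rw [hK2] at hm
      have hlen : 1 / 4 ≤ ∑ d, vec₂ m d ^ 2 := by
        have := sum_sq_le_two u (vec₂ m) Finset.univ
        rw [hu1] at this
        have h2 : 2 * ε ^ 2 ≤ 1 / 4 := by
          have := pow_le_pow_left₀ hεp.le hε2 2
          norm_num at this
          linarith
        have h3 := hdist.trans h2
        simp only [vec₂] at this h3 ⊢
        linarith
      have hq := hn2 _ (Finset.mem_filter.2 ⟨hm, by linarith⟩)
      have hclose := le_rowForm_of_close h0 (by positivity) hup hdist hq.le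
      have h5 := mul_le_mul_of_nonneg_left hlen hS
      have h6 := mul_le_mul_of_nonneg_right hεB hS
      have h7 := mul_le_mul_of_nonneg_right hc₀1 hS
      simp only [vec₂] at hclose h5
      linarith
    · obtain ⟨m, hm, hdist, hmass⟩ := round_small_coords hεp hε'p hε'ε hu1 hcase
      have hq := hn3 _ (Finset.mem_filter.2 ⟨hm, by rw [hθ]; exact hmass⟩)
      have hclose := le_rowForm_of_close h0 (by positivity) hup hdist hq.le
      have h6 := mul_le_mul_of_nonneg_right hBε' hS
      have h7 := mul_le_mul_of_nonneg_right hc₀τ hS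
      linarith
  have hE₁ : P.real E₁ ≤ Real.exp (-c₀ * n) := by
    refine (h.prob_exists_lt_rowForm hc h0 h1).trans (Real.exp_le_exp.2 ?_)
    have h7 := mul_le_mul_of_nonneg_right hc₀1 hnp.le
    linarith
  have hE₂ : P.real E₂ ≤ Real.exp (-c₀ * n) := by
    calc P.real E₂ ≤ ∑ m ∈ F₂, P.real {ω | rowForm μ (fun j d => z j d ω) (vec₂ m)
          ≤ S / 4 * ∑ d, vec₂ m d ^ 2} := measureReal_biUnion_finset_le _ _
      _ ≤ ∑ _m ∈ F₂, Real.exp (-s / 4 * S) :=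
          Finset.sum_le_sum fun m hm => h.prob_rowForm_le h0 h1 (Finset.mem_filter.1 hm).2
      _ = F₂.card * Real.exp (-s / 4 * S) := by rw [Finset.sum_const, nsmul_eq_mul]
      _ ≤ Real.exp (s / 4 * n) * Real.exp (-s / 4 * S) := by
          have hF : (F₂.card : ℝ) ≤ Real.exp (s / 4 * n) := by
            refine le_trans ?_ (hcount D)
            exact_mod_cast Finset.card_filter_le _ _
          gcongr
      _ ≤ Real.exp (-c₀ * n) := by
          rw [← Real.exp_add]
          refine Real.exp_le_exp.2 ?_
          have h7 := mul_le_mul_of_nonneg_right hc₀s hnp.le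
          have h8 := mul_le_mul_of_nonneg_left hS2 hsp.le
          linarith
  have hE₃ : P.real E₃ ≤ Real.exp (-c₀ * n) := by
    have hexp := Real.exp_one_lt_d9
    have hL : Real.exp 1 * (2 * τ / θ + (16 * M * (K / √n) / τ) ^ 2) ≤ 9 * τ / θ := by
      have e : (16 * M * (K / √n) / τ) ^ 2 = (16 * M * K / τ) ^ 2 / n := by
        calc (16 * M * (K / √n) / τ) ^ 2 = (16 * M * K / τ) ^ 2 / √n ^ 2 := by field_simp
          _ = _ := by rw [Real.sq_sqrt hnp.le]
      have h2 : (16 * M * K / τ) ^ 2 / n ≤ τ / θ := by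
        rw [div_le_div_iff₀ hnp hθp]
        rw [div_le_iff₀ hτp] at hnK
        linarith
      rw [e]
      have h3 : 2 * τ / θ = 2 * (τ / θ) := by ring
      have h4 : 9 * τ / θ = 3 * (3 * (τ / θ)) := by ring
      have h5 : 0 < τ / θ := by positivity
      rw [h3, h4]
      refine mul_le_mul (by linarith) (by linarith) (by positivity) (by norm_num)
    have hone : ∀ m ∈ F₃, P.real {ω | rowForm μ (fun j d => z j d ω) (vec₃ m) ≤ 2 * τ ^ 2 * S}
        ≤ ((9 * τ / θ) ^ 2) ^ Fintype.card D := by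
      intro m hm
      refine (h.prob_rowForm_le_of_spread h0 h1 (J := Finset.univ.filter
        fun d => |vec₃ m d| ≤ K / √n) hτp hθp (δ := K / √n) (by positivity)
        (fun d hd => (Finset.mem_filter.1 hd).2) (Finset.mem_filter.1 hm).2).trans ?_
      calc _ ≤ (9 * τ / θ) ^ S := Real.rpow_le_rpow (by positivity) hL hS
        _ ≤ (9 * τ / θ) ^ (2 * n) :=
            Real.rpow_le_rpow_of_exponent_ge (by positivity) hτθ hS2
        _ = ((9 * τ / θ) ^ 2) ^ Fintype.card D := by
            rw [← pow_mul, ← Real.rpow_natCast]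
            push_cast; rfl
    calc P.real E₃ ≤ ∑ m ∈ F₃, P.real {ω | rowForm μ (fun j d => z j d ω) (vec₃ m)
          ≤ 2 * τ ^ 2 * S} := measureReal_biUnion_finset_le _ _
      _ ≤ ∑ _m ∈ F₃, ((9 * τ / θ) ^ 2) ^ Fintype.card D := Finset.sum_le_sum hone
      _ = F₃.card * ((9 * τ / θ) ^ 2) ^ Fintype.card D := by rw [Finset.sum_const, nsmul_eq_mul]
      _ ≤ (12 / ε') ^ Fintype.card D * ((9 * τ / θ) ^ 2) ^ Fintype.card D := by
          have hF : (F₃.card : ℝ) ≤ (12 / ε') ^ Fintype.card D := by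
            refine le_trans ?_ (card_latticeBall_div_le (D := D) hε'p (by linarith))
            exact_mod_cast Finset.card_filter_le _ _
          gcongr
      _ = (1 / 3) ^ Fintype.card D := by
          rw [← mul_pow]
          congr 1
          rw [hε', hτ]; field_simp; norm_num
      _ ≤ Real.exp (-1) ^ Fintype.card D := by
          refine pow_le_pow_left₀ (by norm_num) ?_ _
          rw [Real.exp_neg, ← one_div]
          exact one_div_le_one_div_of_le (Real.exp_pos _) (by linarith)
      _ ≤ Real.exp (-c₀ * n) := by
          rw [← Real.exp_nat_mul]
          refine Real.exp_le_exp.2 ?_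
          have h7 := mul_le_mul_of_nonneg_right hc₀1 hnp.le
          linarith
  calc _ ≤ P.real (E₁ ∪ E₂ ∪ E₃) := measureReal_mono hsub (measure_ne_top _ _)
    _ ≤ P.real E₁ + P.real E₂ + P.real E₃ := (measureReal_union_le _ _).trans
        (add_le_add (measureReal_union_le _ _) le_rfl)
    _ ≤ _ := by linarith

/-! ### Deterministic bounds for solutions of the normal equations -/

section interpolator

variable {I N : Type*} [Fintype N] {z : I → N → ℝ} {lam : I → ℝ}

theorem sq_sum_weighted_mul_le {J : Finset I} (hlam : ∀ j, 0 ≤ lam j) (f g : I → ℝ) :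
    (∑ j ∈ J, lam j * f j * g j) ^ 2
      ≤ (∑ j ∈ J, lam j * f j ^ 2) * ∑ j ∈ J, lam j * g j ^ 2 := by
  have h := Finset.sum_mul_sq_le_sq_mul_sq J (fun j => √(lam j) * f j) (fun j => √(lam j) * g j)
  have e : ∀ j, √(lam j) * f j * (√(lam j) * g j) = lam j * f j * g j := fun j => by
    calc _ = √(lam j) ^ 2 * f j * g j := by ring
      _ = _ := by rw [Real.sq_sqrt (hlam j)]
  simpa only [e, mul_pow, Real.sq_sqrt (hlam _)] using h

theorem sq_dotProduct_le (v w : N → ℝ) : (v ⬝ᵥ w) ^ 2 ≤ (v ⬝ᵥ v) * (w ⬝ᵥ w) := by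
  simpa only [dotProduct, sq] using Finset.sum_mul_sq_le_sq_mul_sq Finset.univ v w

theorem dotProduct_self_nonneg' (v : N → ℝ) : 0 ≤ v ⬝ᵥ v :=
  Finset.sum_nonneg fun _ _ => mul_self_nonneg _

/-- The residual of a vector after orthogonal projection on the span of a finite family. -/
theorem exists_residual (z : I → N → ℝ) (H : Finset I) (x : N → ℝ) :
    ∃ g : I → ℝ, ∀ j ∈ H, z j ⬝ᵥ (x - ∑ l ∈ H, g l • z l) = 0 := by
  classical
  let E := EuclideanSpace ℝ N
  let e : I → E := fun j => WithLp.toLp 2 (z j)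
  let K : Submodule ℝ E := Submodule.span ℝ (e '' H)
  have hmem : K.starProjection (WithLp.toLp 2 x) ∈ K := Submodule.starProjection_apply_mem _ _
  obtain ⟨g, hg⟩ := (Submodule.mem_span_image_finset_iff_exists_fun' ℝ).1 hmem
  refine ⟨g, fun j hj => ?_⟩
  have h1 := K.sub_starProjection_mem_orthogonal (WithLp.toLp 2 x)
  rw [Submodule.mem_orthogonal] at h1
  have h2 := h1 (e j) (Submodule.subset_span ⟨j, hj, rfl⟩)
  rw [← hg] at h2
  have h3 : WithLp.toLp 2 x - ∑ l ∈ H, g l • e l = WithLp.toLp 2 (x - ∑ l ∈ H, g l • z l) := by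
    simp [e]
  rw [h3, EuclideanSpace.inner_toLp_toLp, star_trivial] at h2
  rwa [dotProduct_comm]

variable [Fintype I]

/-- `u` solves `(∑ⱼ λⱼ zⱼ zⱼᵀ) u = √λᵢ zᵢ`, in weak form. -/
def SolvesNormalEq (z : I → N → ℝ) (lam : I → ℝ) (i : I) (u : N → ℝ) : Prop :=
  ∀ y, ∑ j, lam j * (z j ⬝ᵥ u) * (z j ⬝ᵥ y) = √(lam i) * (z i ⬝ᵥ y)

/-- Testing the equation at `u` gives `α |u|² ≤ uᵀ A u = √λ_i (z_i · u)`, and Cauchy–Schwarz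
concludes. -/
theorem SolvesNormalEq.norm_le {i : I} {u : N → ℝ} (hu : SolvesNormalEq z lam i u)
    (hlam : ∀ j, 0 < lam j) {J : Finset I} {α : ℝ} (hα : 0 < α)
    (hq : α * (u ⬝ᵥ u) ≤ ∑ j ∈ J, lam j * (z j ⬝ᵥ u) ^ 2) :
    u ⬝ᵥ u ≤ lam i * (z i ⬝ᵥ z i) / α ^ 2 := by
  have h1 : ∑ j ∈ J, lam j * (z j ⬝ᵥ u) ^ 2 ≤ √(lam i) * (z i ⬝ᵥ u) := by
    rw [← hu u]
    refine (Finset.sum_le_sum_of_subset_of_nonneg (Finset.subset_univ J) fun j _ _ =>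
      mul_nonneg (hlam j).le (sq_nonneg _)).trans (le_of_eq ?_)
    exact Finset.sum_congr rfl fun j _ => by ring
  have h2 := sq_dotProduct_le (z i) u
  have hn := dotProduct_self_nonneg' u
  rcases hn.eq_or_lt with h0 | h0
  · rw [← h0]
    exact div_nonneg (mul_nonneg (hlam i).le (dotProduct_self_nonneg' _)) (sq_nonneg _)
  · rw [le_div_iff₀ (by positivity)]
    have h3 : (α * (u ⬝ᵥ u)) ^ 2 ≤ lam i * ((z i ⬝ᵥ z i) * (u ⬝ᵥ u)) := by
      calc (α * (u ⬝ᵥ u)) ^ 2 ≤ (√(lam i) * (z i ⬝ᵥ u)) ^ 2 :=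
            pow_le_pow_left₀ (by positivity) (hq.trans h1) 2
        _ = lam i * (z i ⬝ᵥ u) ^ 2 := by rw [mul_pow, Real.sq_sqrt (hlam i).le]
        _ ≤ _ := mul_le_mul_of_nonneg_left h2 (hlam i).le
    refine le_of_mul_le_mul_right ?_ h0
    linarith

/-- Moving the head to the right-hand side writes `w = A_J u` as a combination `∑ g_j z_j` of head
columns. Let `q = uᵀ A_J u`. In `q = ∑ g_j (z_j · u)` all terms with `j ≠ i` are nonpositive, so `q
≤ g_i / √λ_i`. On the other hand `γ g_i² ≤ |w|² ≤ β q`. Together these give `q ≤ β / (γ λ_i)`, and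
`α |u|² ≤ q`. -/
theorem SolvesNormalEq.norm_le_of_head [DecidableEq I] {i : I} {u : N → ℝ}
    (hu : SolvesNormalEq z lam i u)
    (hlam : ∀ j, 0 < lam j) {J : Finset I} (hi : i ∉ J) {α β γ : ℝ} (hα : 0 < α) (hβ : 0 < β)
    (hγ : 0 < γ)
    (hlow : ∀ v, α * (v ⬝ᵥ v) ≤ ∑ j ∈ J, lam j * (z j ⬝ᵥ v) ^ 2)
    (hup : ∀ v, ∑ j ∈ J, lam j * (z j ⬝ᵥ v) ^ 2 ≤ β * (v ⬝ᵥ v))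
    (hhead : ∀ g : I → ℝ, γ * ∑ j ∈ Jᶜ, g j ^ 2
      ≤ (∑ j ∈ Jᶜ, g j • z j) ⬝ᵥ (∑ j ∈ Jᶜ, g j • z j)) :
    u ⬝ᵥ u ≤ β / (α * γ * lam i) := by
  set t := √(lam i) with ht
  have ht2 : t ^ 2 = lam i := Real.sq_sqrt (hlam i).le
  have htp : 0 < t := Real.sqrt_pos.2 (hlam i)
  set q := ∑ j ∈ J, lam j * (z j ⬝ᵥ u) ^ 2 with hq
  set g : I → ℝ := fun j => (if j = i then t else 0) - lam j * (z j ⬝ᵥ u) with hg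
  set w := ∑ j ∈ Jᶜ, g j • z j with hw
  have hic : i ∈ Jᶜ := Finset.mem_compl.2 hi
  have hwy : ∀ y, w ⬝ᵥ y = ∑ j ∈ J, lam j * (z j ⬝ᵥ u) * (z j ⬝ᵥ y) := by
    intro y
    have h1 := hu y
    rw [← Finset.sum_add_sum_compl J] at h1
    have h2 : w ⬝ᵥ y = t * (z i ⬝ᵥ y) - ∑ j ∈ Jᶜ, lam j * (z j ⬝ᵥ u) * (z j ⬝ᵥ y) := by
      rw [hw, sum_dotProduct]
      simp only [smul_dotProduct, smul_eq_mul, hg, sub_mul, Finset.sum_sub_distrib, ite_mul,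
        zero_mul]
      rw [Finset.sum_ite_eq' Jᶜ i, if_pos hic]
    rw [h2]; linarith
  have hqg : q ≤ g i / t := by
    have h1 : q = ∑ j ∈ Jᶜ, g j * (z j ⬝ᵥ u) := by
      rw [hq]
      have := hwy u
      rw [hw, sum_dotProduct] at this
      simp only [smul_dotProduct, smul_eq_mul] at this
      rw [this]
      exact Finset.sum_congr rfl fun j _ => by ring
    have h2 : ∀ j, g j * (z j ⬝ᵥ u) ≤ if j = i then g i / t else 0 := by
      intro j
      have hj := hlam j
      split_ifs with hji
      · subst hji
        rw [le_div_iff₀ htp]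
        have : z j ⬝ᵥ u = (t - g j) / lam j := by simp [hg]; field_simp
        rw [this, ← ht2]
        have e : g j * ((t - g j) / t ^ 2) * t = g j - g j ^ 2 / t := by field_simp
        rw [e]
        have : 0 ≤ g j ^ 2 / t := by positivity
        linarith
      · simp only [hg, if_neg hji]
        nlinarith [mul_nonneg hj.le (sq_nonneg (z j ⬝ᵥ u))]
    rw [h1]
    refine (Finset.sum_le_sum fun j _ => h2 j).trans (le_of_eq ?_)
    rw [Finset.sum_ite_eq' Jᶜ i, if_pos hic]
  have hww : w ⬝ᵥ w ≤ β * q := by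
    have h1 : (w ⬝ᵥ w) ^ 2 ≤ q * (β * (w ⬝ᵥ w)) := by
      conv_lhs => rw [hwy w]
      refine (sq_sum_weighted_mul_le (fun j => (hlam j).le) _ _).trans ?_
      refine mul_le_mul_of_nonneg_left (hup w) ?_
      exact Finset.sum_nonneg fun j _ => mul_nonneg (hlam j).le (sq_nonneg _)
    have hq0 : 0 ≤ q := Finset.sum_nonneg fun j _ => mul_nonneg (hlam j).le (sq_nonneg _)
    rcases (dotProduct_self_nonneg' w).eq_or_lt with h0 | h0
    · rw [← h0]; positivity
    · refine le_of_mul_le_mul_right ?_ h0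
      nlinarith
  have hG := hhead g
  have hgi : g i ^ 2 ≤ ∑ j ∈ Jᶜ, g j ^ 2 :=
    Finset.single_le_sum (f := fun j => g j ^ 2) (fun _ _ => sq_nonneg _) hic
  have hq0 : 0 ≤ q := Finset.sum_nonneg fun j _ => mul_nonneg (hlam j).le (sq_nonneg _)
  have hqb : q ≤ β / (γ * lam i) := by
    rcases hq0.eq_or_lt with h0 | h0
    · rw [← h0]; have := hlam i; positivity
    · have h1 : q ^ 2 * lam i ≤ g i ^ 2 := by
        rw [← ht2, ← mul_pow]
        refine pow_le_pow_left₀ (by positivity) ?_ 2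
        rwa [← le_div_iff₀ htp]
      have h2 : γ * g i ^ 2 ≤ β * q := (mul_le_mul_of_nonneg_left hgi hγ.le).trans (hG.trans hww)
      have h3 := mul_le_mul_of_nonneg_left h1 hγ.le
      rw [le_div_iff₀ (mul_pos hγ (hlam i))]
      refine le_of_mul_le_mul_right ?_ h0
      nlinarith
  have hl := hlam i
  have h4 := (hlow u).trans hqb
  rw [le_div_iff₀ (by positivity)] at h4 ⊢
  linarith

/-- Let `y` be the residual of `z_i` after projection on the other head columns; the Gram bound
gives `Y = |y|² ≥ γ`. Cauchy–Schwarz for the form `A` reads `λ_i Y² = (uᵀ A y)² ≤ (uᵀ A u)(yᵀ A y) ≤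
√λ_i (z_i · u)(λ_i Y² + β Y)`. Hence `z_i · u` is bounded below, and so is `|u|`, because `|z_i|² ≤
ζ`. The index `i` may lie in the head or in the tail. -/
theorem SolvesNormalEq.le_norm [DecidableEq I] {i : I} {u : N → ℝ} (hu : SolvesNormalEq z lam i u)
    (hlam : ∀ j, 0 < lam j) {J : Finset I} {β γ ζ : ℝ} (hβ : 0 < β) (hγ : 0 < γ) (hζ : 0 < ζ)
    (hup : ∀ v, ∑ j ∈ J, lam j * (z j ⬝ᵥ v) ^ 2 ≤ β * (v ⬝ᵥ v))
    (hhead : ∀ g : I → ℝ, γ * ∑ j ∈ insert i Jᶜ, g j ^ 2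
      ≤ (∑ j ∈ insert i Jᶜ, g j • z j) ⬝ᵥ (∑ j ∈ insert i Jᶜ, g j • z j))
    (hz : z i ⬝ᵥ z i ≤ ζ) :
    (lam i * γ / (lam i * γ + β)) ^ 2 / (lam i * ζ) ≤ u ⬝ᵥ u := by
  set H := Jᶜ.erase i with hH
  have hiH : i ∉ H := by simp [hH]
  have hins : insert i Jᶜ = insert i H := by
    ext j; by_cases hj : j = i <;> simp [hH, hj]
  obtain ⟨g, hg⟩ := exists_residual z H (z i)
  set y := z i - ∑ l ∈ H, g l • z l with hy
  set Y := y ⬝ᵥ y with hY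
  have hYγ : γ ≤ Y := by
    have h1 := hhead fun j => if j = i then 1 else - g j
    rw [hins, Finset.sum_insert hiH, Finset.sum_insert hiH] at h1
    have h2 : ∑ j ∈ H, (if j = i then (1 : ℝ) else - g j) • z j = -∑ l ∈ H, g l • z l := by
      rw [← Finset.sum_neg_distrib]
      refine Finset.sum_congr rfl fun j hj => ?_
      rw [if_neg (by rintro rfl; exact hiH hj), neg_smul]
    rw [h2] at h1
    simp only [if_true, one_smul, one_pow] at h1
    rw [← sub_eq_add_neg, ← hy] at h1
    have h3 : 0 ≤ ∑ j ∈ H, (if j = i then (1 : ℝ) else - g j) ^ 2 :=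
      Finset.sum_nonneg fun _ _ => sq_nonneg _
    nlinarith
  have hYp : 0 < Y := by linarith
  have hzy : z i ⬝ᵥ y = Y := by
    have h1 : z i = y + ∑ l ∈ H, g l • z l := by rw [hy]; abel
    conv_lhs => rw [h1]
    rw [add_dotProduct, sum_dotProduct, Finset.sum_eq_zero, add_zero]
    intro l hl
    rw [smul_dotProduct, hg l hl, smul_zero]
  set t := √(lam i) with ht
  have ht2 : t ^ 2 = lam i := Real.sq_sqrt (hlam i).le
  have hl := hlam i
  -- Orthogonality to `H` leaves only the index `i` and the tail; if `i` is in the tail, its term is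
  -- counted twice on the right, which is harmless.
  have hyA : ∑ j, lam j * (z j ⬝ᵥ y) ^ 2 ≤ lam i * Y ^ 2 + β * Y := by
    have hsub : (Finset.univ : Finset I) = H ∪ insert i J := by
      ext j
      simp only [hH, Finset.mem_univ, Finset.mem_union, Finset.mem_erase, Finset.mem_compl,
        Finset.mem_insert, true_iff]
      tauto
    have hnn : ∀ j, 0 ≤ lam j * (z j ⬝ᵥ y) ^ 2 := fun j => mul_nonneg (hlam j).le (sq_nonneg _)
    rw [hsub]
    have h0 : ∑ j ∈ H, lam j * (z j ⬝ᵥ y) ^ 2 = 0 :=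
      Finset.sum_eq_zero fun j hj => by rw [hg j hj]; ring
    have h1 := Finset.sum_union_inter (s₁ := H) (s₂ := insert i J)
      (f := fun j => lam j * (z j ⬝ᵥ y) ^ 2)
    have h2 : 0 ≤ ∑ j ∈ H ∩ insert i J, lam j * (z j ⬝ᵥ y) ^ 2 := Finset.sum_nonneg fun j _ => hnn j
    have h3 : ∑ j ∈ insert i J, lam j * (z j ⬝ᵥ y) ^ 2
        ≤ lam i * (z i ⬝ᵥ y) ^ 2 + ∑ j ∈ J, lam j * (z j ⬝ᵥ y) ^ 2 := by
      by_cases hiJ : i ∈ J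
      · rw [Finset.insert_eq_of_mem hiJ]; linarith [hnn i]
      · rw [Finset.sum_insert hiJ]
    rw [hzy] at h3
    linarith [hup y]
  have huA : ∑ j, lam j * (z j ⬝ᵥ u) ^ 2 = t * (z i ⬝ᵥ u) := by
    rw [← hu u]
    exact Finset.sum_congr rfl fun j _ => by ring
  have hu0 : 0 ≤ t * (z i ⬝ᵥ u) := by
    rw [← huA]
    exact Finset.sum_nonneg fun j _ => mul_nonneg (hlam j).le (sq_nonneg _)
  have h5 : lam i * Y ^ 2 ≤ t * (z i ⬝ᵥ u) * (lam i * Y ^ 2 + β * Y) := by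
    calc lam i * Y ^ 2 = (∑ j, lam j * (z j ⬝ᵥ u) * (z j ⬝ᵥ y)) ^ 2 := by
          rw [hu y, hzy, mul_pow, ht2]
      _ ≤ (∑ j, lam j * (z j ⬝ᵥ u) ^ 2) * ∑ j, lam j * (z j ⬝ᵥ y) ^ 2 :=
          sq_sum_weighted_mul_le (fun j => (hlam j).le) _ _
      _ ≤ _ := by rw [huA]; exact mul_le_mul_of_nonneg_left hyA hu0
  have h6 : lam i * Y ≤ t * (z i ⬝ᵥ u) * (lam i * Y + β) := by
    refine le_of_mul_le_mul_right ?_ hYp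
    linarith
  have h7 : lam i * γ / (lam i * γ + β) ≤ t * (z i ⬝ᵥ u) := by
    have h8 : lam i * Y / (lam i * Y + β) ≤ t * (z i ⬝ᵥ u) := by
      rwa [div_le_iff₀ (by positivity)]
    refine le_trans ?_ h8
    rw [div_le_div_iff₀ (by positivity) (by positivity)]
    nlinarith [mul_le_mul_of_nonneg_left hYγ (mul_pos hl hβ).le]
  rw [div_le_iff₀ (by positivity)]
  calc (lam i * γ / (lam i * γ + β)) ^ 2 ≤ (t * (z i ⬝ᵥ u)) ^ 2 :=
        pow_le_pow_left₀ (by positivity) h7 2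
    _ = lam i * (z i ⬝ᵥ u) ^ 2 := by rw [mul_pow, ht2]
    _ ≤ lam i * (ζ * (u ⬝ᵥ u)) := by
        refine mul_le_mul_of_nonneg_left ((sq_dotProduct_le _ _).trans ?_) hl.le
        exact mul_le_mul_of_nonneg_right hz (dotProduct_self_nonneg' u)
    _ = _ := by ring

end interpolator

/-! ### The pseudo-inverse and the formula for the variance -/

section pinv

variable {n p : ℕ}

theorem isSelfAdjoint_mul_transpose (X : Matrix (Fin n) (Fin p) ℝ) : IsSelfAdjoint (X * Xᵀ) := by
  have : (X * Xᵀ).IsHermitian := by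
    simp [Matrix.IsHermitian, Matrix.conjTranspose_eq_transpose_of_trivial]
  exact this

theorem symPinv_transpose (A : Matrix (Fin n) (Fin n) ℝ) : (symPinv A)ᵀ = symPinv A := by
  have : IsSelfAdjoint (symPinv A) := cfc_predicate _ _
  have h2 : (symPinv A)ᴴ = symPinv A := this
  rwa [Matrix.conjTranspose_eq_transpose_of_trivial] at h2

theorem mul_symPinv_mul_self {A : Matrix (Fin n) (Fin n) ℝ} (hA : IsSelfAdjoint A) :
    A * symPinv A * A = A := by
  have hc : ∀ f : ℝ → ℝ, ContinuousOn f (spectrum ℝ A) := fun f =>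
    (Matrix.finite_real_spectrum (A := A)).continuousOn f
  have h1 : A * symPinv A * A = cfc (fun t : ℝ => t * t⁻¹ * t) A := by
    rw [cfc_mul _ _ A (hc _) (hc _), cfc_mul _ _ A (hc _) (hc _), cfc_id' ℝ A, symPinv]
  rw [h1]
  conv_rhs => rw [← cfc_id' ℝ A]
  congr 1
  ext t
  by_cases ht : t = 0
  · simp [ht]
  · field_simp

/-- With `A = X Xᵀ`, the difference `A A⁺ X - X` is annihilated by `Xᵀ` on the right, hence by its
own transpose, hence is zero. This makes the normal equations solvable for every `X`, singular or
not. -/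
theorem mul_symPinv_mul (X : Matrix (Fin n) (Fin p) ℝ) :
    X * Xᵀ * symPinv (X * Xᵀ) * X = X := by
  set A := X * Xᵀ with hA
  have h := mul_symPinv_mul_self (isSelfAdjoint_mul_transpose X)
  rw [← hA] at h
  have h1 : (A * symPinv A * X - X) * (A * symPinv A * X - X)ᵀ = 0 := by
    rw [Matrix.transpose_sub, Matrix.mul_sub]
    have h2 : (A * symPinv A * X - X) * Xᵀ = 0 := by
      rw [Matrix.sub_mul, Matrix.mul_assoc (A * symPinv A) X, ← hA, h, sub_self]
    have h3 : (A * symPinv A * X - X) * (A * symPinv A * X)ᵀ = 0 := by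
      rw [Matrix.transpose_mul, ← Matrix.mul_assoc, h2, Matrix.zero_mul]
    rw [h2, h3, sub_zero]
  have h4 : A * symPinv A * X - X = 0 := by
    rw [← Matrix.conjTranspose_eq_transpose_of_trivial] at h1
    exact Matrix.self_mul_conjTranspose_eq_zero.1 h1
  exact sub_eq_zero.1 h4

end pinv

section variance

variable {n p : ℕ}

theorem integral_sq_dotProduct {ν : Measure ℝ} {v : ℝ} (hν : NoiseAssumptions ν v)
    (u : Fin n → ℝ) :
    Integrable (fun ε : Fin n → ℝ => (u ⬝ᵥ ε) ^ 2) (Measure.pi fun _ : Fin n => ν) ∧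
      ∫ ε : Fin n → ℝ, (u ⬝ᵥ ε) ^ 2 ∂(Measure.pi fun _ : Fin n => ν) = v ^ 2 * (u ⬝ᵥ u) := by
  have hp := hν.prob
  set P := Measure.pi fun _ : Fin n => ν
  have hi : iIndepFun (fun (r : Fin n) (ε : Fin n → ℝ) => u r * ε r) P :=
    iIndepFun_pi (X := fun r x => u r * x) fun r => by fun_prop
  have hmp := fun r : Fin n => measurePreserving_eval (fun _ : Fin n => ν) r
  have hm : ∀ r, MemLp (fun ε : Fin n → ℝ => u r * ε r) 2 P := fun r =>
    (hν.memLp.comp_measurePreserving (hmp r)).const_mul (u r)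
  have h1 : ∀ r, ∫ ε : Fin n → ℝ, ε r ∂P = 0 := fun r => by
    rw [← hν.centered, ← (hmp r).map_eq,
      integral_map (hmp r).measurable.aemeasurable (by fun_prop)]
  have h2 : ∀ r, ∫ ε : Fin n → ℝ, ε r ^ 2 ∂P = v ^ 2 := fun r => by
    rw [← hν.variance, ← (hmp r).map_eq, integral_map (hmp r).measurable.aemeasurable (by fun_prop)]
  have hmean : ∫ ε : Fin n → ℝ, ∑ r, u r * ε r ∂P = 0 := by
    rw [integral_finsetSum _ fun r _ => (hm r).integrable (by norm_num)]
    simp [integral_const_mul, h1]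
  have h3 := IndepFun.variance_sum (μ := P) (X := fun r ε => u r * ε r) (s := Finset.univ)
    (fun r _ => hm r) (fun i _ j _ hij => hi.indepFun hij)
  have h4 : ∀ r, Var[fun ε : Fin n → ℝ => u r * ε r; P] = v ^ 2 * (u r * u r) := by
    intro r
    rw [variance_eq_sub (hm r)]
    simp only [Pi.pow_apply, mul_pow, integral_const_mul, h1, h2]
    ring
  have hsum : MemLp (fun ε : Fin n → ℝ => ∑ r, u r * ε r) 2 P :=
    memLp_finsetSum _ fun r _ => hm r
  have e : (∑ r, fun ε : Fin n → ℝ => u r * ε r) = fun ε => ∑ r, u r * ε r := by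
    ext ε; simp
  rw [Finset.sum_congr rfl fun r _ => h4 r, e, variance_eq_sub hsum, hmean] at h3
  refine ⟨hsum.integrable_sq, ?_⟩
  simp only [Pi.pow_apply] at h3
  simp only [dotProduct, Finset.mul_sum]
  linarith

/-- In the eigenbasis the `i`-th coordinate of the interpolator is `u_i · ε`, the symmetric
pseudo-inverse having moved to the column; its mean square is `v² |u_i|²`. -/
theorem normalizedVariance_eq {ν : Measure ℝ} {v : ℝ} (hν : NoiseAssumptions ν v)
    {U : Matrix (Fin p) (Fin p) ℝ} (hU : U ∈ Matrix.orthogonalGroup (Fin p) ℝ)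
    {M : Matrix (Fin p) (Fin p) ℝ} {d : Fin p → ℝ} (hM : Uᵀ * M * U = Matrix.diagonal d)
    (X : Matrix (Fin n) (Fin p) ℝ) :
    normalizedVariance M ν v X = ∑ i, d i *
      ((symPinv (X * Xᵀ) *ᵥ (fun r => (X * U) r i)) ⬝ᵥ
        (symPinv (X * Xᵀ) *ᵥ (fun r => (X * U) r i))) := by
  have hUU : U * Uᵀ = 1 := by
    have := (Matrix.mem_orthogonalGroup_iff (Fin p) ℝ).1 hU
    simpa [Matrix.star_eq_conjTranspose, Matrix.conjTranspose_eq_transpose_of_trivial] using this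
  have hM' : M = U * Matrix.diagonal d * Uᵀ := by
    rw [← hM]
    calc M = (U * Uᵀ) * M * (U * Uᵀ) := by rw [hUU, Matrix.one_mul, Matrix.mul_one]
      _ = _ := by simp only [Matrix.mul_assoc]
  set B := symPinv (X * Xᵀ) with hB
  set u : Fin p → Fin n → ℝ := fun i => B *ᵥ (fun r => (X * U) r i) with hu
  have hcoord : ∀ ε i, (Uᵀ *ᵥ mni X ε) i = u i ⬝ᵥ ε := by
    intro ε i
    have h1 : Uᵀ *ᵥ mni X ε = (X * U)ᵀ *ᵥ (B *ᵥ ε) := by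
      rw [mni, Matrix.mulVec_mulVec, Matrix.transpose_mul]
    rw [h1]
    have h2 : ((X * U)ᵀ *ᵥ (B *ᵥ ε)) i = (fun r => (X * U) r i) ⬝ᵥ (B *ᵥ ε) := rfl
    rw [h2, Matrix.dotProduct_mulVec, hu]
    simp only
    congr 1
    rw [← Matrix.mulVec_transpose, hB, symPinv_transpose]
  have hraw : ∀ ε, rawVariance M X ε = ∑ i, d i * (u i ⬝ᵥ ε) ^ 2 := by
    intro ε
    have h1 : rawVariance M X ε
        = (Uᵀ *ᵥ mni X ε) ⬝ᵥ (Matrix.diagonal d *ᵥ (Uᵀ *ᵥ mni X ε)) := by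
      rw [rawVariance, hM', ← Matrix.mulVec_mulVec, ← Matrix.mulVec_mulVec, Matrix.dotProduct_mulVec,
        ← Matrix.mulVec_transpose]
    rw [h1]
    simp only [dotProduct, Matrix.mulVec_diagonal]
    refine Finset.sum_congr rfl fun i _ => ?_
    rw [hcoord]
    simp only [dotProduct]; ring
  have hv := hν.v_pos
  have hint := fun i => integral_sq_dotProduct hν (u i)
  simp only [normalizedVariance, hraw]
  rw [integral_div, integral_finsetSum _ fun i _ => (hint i).1.const_mul (d i)]
  simp only [integral_const_mul, (hint _).2]
  rw [Finset.sum_div]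
  refine Finset.sum_congr rfl fun i _ => ?_
  rw [mul_left_comm, mul_div_cancel_left₀ _ (by positivity)]

end variance

/-! ### Averaging over the indices in place of union bounds -/

/-- Indices carrying a nonnegative weight and failing with small probability carry at most half of
the total weight, outside an event of small probability. -/
theorem prob_half_lt_sum_le {Ω I : Type*} [Fintype I] [MeasurableSpace Ω] {P : Measure Ω}
    [IsProbabilityMeasure P] {t : I → ℝ} (ht : ∀ i, 0 ≤ t i) {bad : I → Set Ω} {δ : ℝ} (hδ : 0 ≤ δ)
    (hbad : ∀ i, P.real (bad i) ≤ δ) :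
    P.real {ω | (∑ i, t i) / 2 < ∑ i, (bad i).indicator (fun _ => t i) ω} ≤ 2 * δ := by
  -- No measurability is assumed of the bad events; their measurable hulls have the same probability
  -- and can be integrated.
  set B : I → Set Ω := fun i => toMeasurable P (bad i) with hB
  have hBm : ∀ i, MeasurableSet (B i) := fun i => measurableSet_toMeasurable _ _
  have hBr : ∀ i, P.real (B i) ≤ δ := fun i => by
    have : P.real (B i) = P.real (bad i) := by
      simp only [measureReal_def, hB, measure_toMeasurable]
    rw [this]; exact hbad i
  set f : Ω → ℝ := fun ω => ∑ i, (B i).indicator (fun _ => t i) ω with hf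
  have hfi : Integrable f P := integrable_finsetSum _ fun i _ =>
    (integrable_const (t i)).indicator (hBm i)
  have hf0 : ∀ ω, 0 ≤ f ω := fun ω =>
    Finset.sum_nonneg fun i _ => Set.indicator_nonneg (fun _ _ => ht i) ω
  have hint : ∫ ω, f ω ∂P ≤ δ * ∑ i, t i := by
    rw [hf, integral_finsetSum _ fun i _ => (integrable_const (t i)).indicator (hBm i),
      Finset.mul_sum]
    refine Finset.sum_le_sum fun i _ => ?_
    rw [integral_indicator_const _ (hBm i), smul_eq_mul]
    exact mul_le_mul_of_nonneg_right (hBr i) (ht i)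
  have hle : ∀ ω, ∑ i, (bad i).indicator (fun _ => t i) ω ≤ f ω := fun ω =>
    Finset.sum_le_sum fun i _ => Set.indicator_le_indicator_of_subset (subset_toMeasurable _ _)
      (fun _ => ht i) ω
  rcases (Finset.sum_nonneg fun i _ => ht i : 0 ≤ ∑ i, t i).eq_or_lt with h0 | h0
  · have ht0 : ∀ i, t i = 0 := fun i =>
      (Finset.sum_eq_zero_iff_of_nonneg fun i _ => ht i).1 h0.symm i (Finset.mem_univ i)
    have : {ω | (∑ i, t i) / 2 < ∑ i, (bad i).indicator (fun _ => t i) ω} = ∅ := by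
      ext ω; simp [ht0]
    rw [this, measureReal_empty]; positivity
  · have hmk := mul_meas_ge_le_integral_of_nonneg (ae_of_all _ hf0) hfi ((∑ i, t i) / 2)
    have h2 : P.real {ω | (∑ i, t i) / 2 < ∑ i, (bad i).indicator (fun _ => t i) ω}
        ≤ P.real {ω | (∑ i, t i) / 2 ≤ f ω} :=
      measureReal_mono (fun ω hω => (le_of_lt hω).trans (hle ω)) (measure_ne_top _ _)
    refine h2.trans ?_
    have h3 := hmk.trans hint
    refine le_of_mul_le_mul_left ?_ (half_pos h0)
    linarith

/-- A weighted sum of the squared norms of the columns of a random matrix. -/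
theorem IndepEntries.prob_lt_weighted_sum_norm {Ω N I : Type*} [Fintype N]
    [MeasurableSpace Ω] {P : Measure Ω} [IsProbabilityMeasure P] {z : N → I → Ω → ℝ} {c : ℝ≥0}
    (h : IndepEntries z c P) (hc : 0 < c) {w : I → ℝ} (hw : ∀ i, 0 ≤ w i) (J : Finset I) :
    P.real {ω | 8 * c * Fintype.card N * ∑ i ∈ J, w i < ∑ i ∈ J, w i * ∑ r, z r i ω ^ 2}
      ≤ Real.exp (-(Fintype.card N : ℝ)) := by
  have hc' : (0 : ℝ) < c := by exact_mod_cast hc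
  set a : ℝ := 1 / (4 * c) with ha
  set W := ∑ i ∈ J, w i
  set n : ℝ := (Fintype.card N : ℝ)
  rcases (Finset.sum_nonneg fun i _ => hw i : 0 ≤ W).eq_or_lt with h0 | h0
  · have hw0 : ∀ i ∈ J, w i = 0 :=
      (Finset.sum_eq_zero_iff_of_nonneg fun i _ => hw i).1 h0.symm
    have : {ω | 8 * c * n * W < ∑ i ∈ J, w i * ∑ r, z r i ω ^ 2} = ∅ := by
      ext ω
      have h1 : ∑ i ∈ J, w i * ∑ r, z r i ω ^ 2 = 0 :=
        Finset.sum_eq_zero fun i hi => by rw [hw0 i hi, zero_mul]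
      have h2 : W = 0 := h0.symm
      simp [h1, h2]
    rw [this, measureReal_empty]; positivity
  have hcol : ∀ i, Integrable (fun ω => Real.exp (a * ∑ r, z r i ω ^ 2)) P ∧
      ∫ ω, Real.exp (a * ∑ r, z r i ω ^ 2) ∂P ≤ 2 ^ n := by
    intro i
    have hi : iIndepFun (fun r ω => z r i ω ^ 2) P :=
      (h.transpose.row i).comp (fun _ x => x ^ 2) fun _ => by fun_prop
    obtain ⟨h1, h2⟩ := mgf_weighted_sum_le hi (fun r => (h.std r i).measurable.pow_const 2)
      (μ := fun _ => 1) (fun _ => zero_le_one) (fun _ => le_rfl) two_pos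
      (fun r => ((h.std r i).exp_sq hc).1) (fun r => ((h.std r i).exp_sq hc).2)
    simp only [one_mul, mgf, Finset.sum_const, Finset.card_univ, nsmul_eq_mul, mul_one] at h1 h2
    exact ⟨h1, h2⟩
  set f : Ω → ℝ := fun ω => ∑ i ∈ J, w i / W * Real.exp (a * ∑ r, z r i ω ^ 2) with hf
  have hfi : Integrable f P := integrable_finsetSum _ fun i _ => (hcol i).1.const_mul _
  have hf0 : ∀ ω, 0 ≤ f ω := fun ω => Finset.sum_nonneg fun i _ =>
    mul_nonneg (div_nonneg (hw i) h0.le) (Real.exp_pos _).le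
  have hsum1 : ∑ i ∈ J, w i / W = 1 := by rw [← Finset.sum_div, div_self h0.ne']
  have hint : ∫ ω, f ω ∂P ≤ 2 ^ n := by
    rw [hf, integral_finsetSum _ fun i _ => (hcol i).1.const_mul _]
    simp only [integral_const_mul]
    calc _ ≤ ∑ i ∈ J, w i / W * 2 ^ n := Finset.sum_le_sum fun i _ =>
          mul_le_mul_of_nonneg_left (hcol i).2 (div_nonneg (hw i) h0.le)
      _ = _ := by rw [← Finset.sum_mul, hsum1, one_mul]
  -- By convexity the exponential of the weighted mean is at most the weighted mean `f` of
  -- exponentials, so the bound does not depend on the number of columns. Markov's inequality at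
  -- `exp (2 n)` against `2 ^ n` leaves `exp (-n)`.
  have hmk := mul_meas_ge_le_integral_of_nonneg (ae_of_all _ hf0) hfi (Real.exp (2 * n))
  have hsub : {ω | 8 * c * n * W < ∑ i ∈ J, w i * ∑ r, z r i ω ^ 2}
      ⊆ {ω | Real.exp (2 * n) ≤ f ω} := by
    intro ω hω
    have hω' : 8 * c * n * W < ∑ i ∈ J, w i * ∑ r, z r i ω ^ 2 := hω
    have hj := convexOn_exp.map_sum_le (t := J) (w := fun i => w i / W)
      (p := fun i => a * ∑ r, z r i ω ^ 2) (fun i _ => div_nonneg (hw i) h0.le) hsum1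
      (fun _ _ => Set.mem_univ _)
    refine le_trans (Real.exp_le_exp.2 ?_) hj
    have e : ∑ i ∈ J, (w i / W) • (a * ∑ r, z r i ω ^ 2)
        = a / W * ∑ i ∈ J, w i * ∑ r, z r i ω ^ 2 := by
      rw [Finset.mul_sum]
      exact Finset.sum_congr rfl fun i _ => by rw [smul_eq_mul]; ring
    rw [e]
    have h3 := mul_le_mul_of_nonneg_left hω'.le (by positivity : 0 ≤ a / W)
    refine le_trans (le_of_eq ?_) h3
    have hW : W ≠ 0 := h0.ne'
    rw [ha]; field_simp; ring
  have h2n : (2 : ℝ) ^ n ≤ Real.exp n := by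
    rw [← Real.exp_one_rpow n]
    exact Real.rpow_le_rpow (by norm_num) (by linarith [Real.exp_one_gt_d9]) (by positivity)
  refine (measureReal_mono hsub (measure_ne_top _ _)).trans ?_
  refine le_of_mul_le_mul_left ?_ (Real.exp_pos (2 * n))
  refine hmk.trans (hint.trans (h2n.trans (le_of_eq ?_)))
  rw [← Real.exp_add]; congr 1; ring

/-! ### The covariate model as a random matrix with independent entries -/

section model

theorem measurable_whiten {p : ℕ} (U : Matrix (Fin p) (Fin p) ℝ) (lam : Fin p → ℝ) (j : Fin p) :
    Measurable fun x => whiten U lam x j := by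
  simp only [whiten, Matrix.mulVec, dotProduct]
  fun_prop

theorem integral_sq_of_diagonal {p : ℕ} {D : Measure (Fin p → ℝ)}
    (hD : ∀ j, MemLp (fun x : Fin p → ℝ => x j) 2 D) {U : Matrix (Fin p) (Fin p) ℝ}
    {d : Fin p → ℝ} (hU : Uᵀ * secondMoment D * U = Matrix.diagonal d) (i : Fin p) :
    ∫ x, ((Uᵀ *ᵥ x) i) ^ 2 ∂D = d i := by
  have h1 : (Uᵀ * secondMoment D * U) i i = d i := by rw [hU, Matrix.diagonal_apply_eq]
  have hint : ∀ a b, Integrable (fun x : Fin p → ℝ => U a i * U b i * (x a * x b)) D :=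
    fun a b => ((hD a).integrable_mul (hD b)).const_mul _
  have e : ∀ x : Fin p → ℝ, ((Uᵀ *ᵥ x) i) ^ 2 = ∑ b, ∑ a, U a i * U b i * (x a * x b) := by
    intro x
    simp only [Matrix.mulVec, dotProduct, Matrix.transpose_apply, sq, Finset.sum_mul_sum]
    rw [Finset.sum_comm]
    exact Finset.sum_congr rfl fun b _ => Finset.sum_congr rfl fun a _ => by ring
  rw [← h1]
  simp_rw [e]
  rw [integral_finsetSum _ fun b _ => integrable_finsetSum _ fun a _ => hint a b]
  rw [Matrix.mul_apply]
  refine Finset.sum_congr rfl fun b _ => ?_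
  rw [integral_finsetSum _ fun a _ => hint a b, Matrix.mul_apply, Finset.sum_mul]
  refine Finset.sum_congr rfl fun a _ => ?_
  rw [integral_const_mul, Matrix.transpose_apply, secondMoment, Matrix.of_apply]
  ring

theorem StdSubgaussian.comp_measurePreserving {Ω Ω' : Type*} [MeasurableSpace Ω]
    [MeasurableSpace Ω'] {P : Measure Ω} {P' : Measure Ω'} {X : Ω' → ℝ} {c : ℝ≥0} {f : Ω → Ω'}
    (h : StdSubgaussian X c P') (hf : MeasurePreserving f P P') :
    StdSubgaussian (fun ω => X (f ω)) c P := by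
  have hX := h.measurable
  refine ⟨hX.comp hf.measurable, ?_, ?_, ?_⟩
  · rw [← h.mean, ← hf.map_eq, integral_map hf.measurable.aemeasurable (by fun_prop)]
  · rw [← h.second, ← hf.map_eq, integral_map hf.measurable.aemeasurable (by fun_prop)]
  · have := h.mgf
    rw [← hf.map_eq] at this
    exact this.of_map hf.measurable.aemeasurable

theorem ProbabilityTheory.iIndepFun.comp_measurePreserving {Ω Ω' ι : Type*} [Fintype ι]
    [MeasurableSpace Ω] [MeasurableSpace Ω'] {P : Measure Ω} {P' : Measure Ω'}
    [IsProbabilityMeasure P] [IsProbabilityMeasure P'] {X : ι → Ω' → ℝ} {f : Ω → Ω'}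
    (hX : ∀ i, Measurable (X i)) (h : iIndepFun X P') (hf : MeasurePreserving f P P') :
    iIndepFun (fun i ω => X i (f ω)) P := by
  have hfm := hf.measurable
  rw [iIndepFun_iff_map_fun_eq_pi_map fun i => (hX i).aemeasurable] at h
  have hm : ∀ i, AEMeasurable (fun ω => X i (f ω)) P := fun i => ((hX i).comp hfm).aemeasurable
  rw [iIndepFun_iff_map_fun_eq_pi_map hm]
  have e : (fun ω i => X i (f ω)) = (fun x i => X i x) ∘ f := rfl
  rw [e, ← Measure.map_map (by fun_prop) hfm, hf.map_eq, h]
  congr 1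
  ext1 i
  have e2 : (fun ω => X i (f ω)) = X i ∘ f := rfl
  rw [e2, ← Measure.map_map (hX i) hfm, hf.map_eq]

variable {p : ℕ} {Dsrc Dtgt : Measure (Fin p → ℝ)} {U : Matrix (Fin p) (Fin p) ℝ}
  {lam lamT : Fin p → ℝ} {σ : ℝ}

namespace CovariateAssumptions

theorem lamT_nonneg (h : CovariateAssumptions Dsrc Dtgt U lam lamT σ) (i : Fin p) :
    0 ≤ lamT i := by
  rw [← integral_sq_of_diagonal h.memLp_tgt h.diag_tgt i]
  exact integral_nonneg fun x => sq_nonneg _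

theorem stdSubgaussian (h : CovariateAssumptions Dsrc Dtgt U lam lamT σ) (j : Fin p) :
    StdSubgaussian (fun x => whiten U lam x j) (Real.toNNReal (σ ^ 2)) Dsrc := by
  have hP := h.prob_src
  have hl := h.lam_pos j
  refine ⟨measurable_whiten U lam j, ?_, ?_, ?_, ?_⟩
  · simp only [whiten, Matrix.mulVec, dotProduct]
    rw [integral_div, integral_finsetSum _ fun i _ =>
      ((h.memLp_src i).integrable (by norm_num)).const_mul _]
    simp [integral_const_mul, h.centered]
  · simp only [whiten, div_pow, Real.sq_sqrt hl.le]
    rw [integral_div, integral_sq_of_diagonal h.memLp_src h.diag_src, div_self hl.ne']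
  · intro t
    have := (h.subgaussian (Pi.single j t)).1
    simpa [single_dotProduct] using this
  · intro t
    have := (h.subgaussian (Pi.single j t)).2
    simp only [single_dotProduct, Pi.single_eq_same] at this
    refine this.trans (le_of_eq ?_)
    congr 1
    rw [Real.coe_toNNReal _ (sq_nonneg σ)]; ring

theorem indepEntries (h : CovariateAssumptions Dsrc Dtgt U lam lamT σ) (n : ℕ) :
    IndepEntries (fun (r : Fin n) (j : Fin p) (x : Fin n → Fin p → ℝ) => whiten U lam (x r) j)
      (Real.toNNReal (σ ^ 2)) (Measure.pi fun _ : Fin n => Dsrc) := by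
  have hP := h.prob_src
  have hmp := fun r : Fin n => measurePreserving_eval (fun _ : Fin n => Dsrc) r
  have hw := measurable_whiten U lam
  refine ⟨?_, fun r j => (h.stdSubgaussian j).comp_measurePreserving (hmp r)⟩
  refine iIndepFun_uncurry' (X := fun (r : Fin n) (j : Fin p) (x : Fin n → Fin p → ℝ) =>
    whiten U lam (x r) j) (fun r j => (hw j).comp (measurable_pi_apply r)) ?_ fun r => ?_
  · exact iIndepFun_pi (X := fun (_ : Fin n) (y : Fin p → ℝ) j => whiten U lam y j)
      fun r => (measurable_pi_lambda _ fun j => hw j).aemeasurable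
  · exact h.indep.comp_measurePreserving hw (hmp r)

/-- With `Q = X U`, whose columns are `√λ_j z_j`, orthogonality of `U` gives `X Xᵀ = Q Qᵀ = ∑ λ_j
z_j z_jᵀ`, and `mul_symPinv_mul` shows that the pseudo-inverse does solve the equation. -/
theorem solvesNormalEq (h : CovariateAssumptions Dsrc Dtgt U lam lamT σ) {n : ℕ}
    (x : Fin n → Fin p → ℝ) (i : Fin p) :
    SolvesNormalEq (fun j r => whiten U lam (x r) j) lam i
      (symPinv (Matrix.of x * (Matrix.of x)ᵀ) *ᵥ (fun r => (Matrix.of x * U) r i)) := by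
  intro y
  set X : Matrix (Fin n) (Fin p) ℝ := Matrix.of x with hX
  set Q := X * U with hQ
  have hcol : ∀ j r, Q r j = √(lam j) * whiten U lam (x r) j := by
    intro j r
    have hs : √(lam j) ≠ 0 := (Real.sqrt_pos.2 (h.lam_pos j)).ne'
    rw [whiten, mul_div_cancel₀ _ hs, hQ, Matrix.mul_apply]
    simp only [Matrix.mulVec, dotProduct, Matrix.transpose_apply, hX, Matrix.of_apply]
    exact Finset.sum_congr rfl fun a _ => mul_comm _ _
  have hdot : ∀ j (w : Fin n → ℝ),
      (Qᵀ *ᵥ w) j = √(lam j) * ((fun r => whiten U lam (x r) j) ⬝ᵥ w) := by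
    intro j w
    simp only [Matrix.mulVec, dotProduct, Matrix.transpose_apply, hcol, Finset.mul_sum, mul_assoc]
  have hUU : U * Uᵀ = 1 := by
    have := (Matrix.mem_orthogonalGroup_iff (Fin p) ℝ).1 h.orthogonal
    simpa [Matrix.star_eq_conjTranspose, Matrix.conjTranspose_eq_transpose_of_trivial] using this
  have hA : X * Xᵀ = Q * Qᵀ := by
    rw [hQ, Matrix.transpose_mul, Matrix.mul_assoc, ← Matrix.mul_assoc U, hUU, Matrix.one_mul]
  set u := symPinv (X * Xᵀ) *ᵥ (fun r => Q r i) with hu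
  have hAu : Q *ᵥ (Qᵀ *ᵥ u) = fun r => Q r i := by
    have hm : X * Xᵀ * symPinv (X * Xᵀ) * Q = Q := by
      rw [hQ, ← Matrix.mul_assoc, mul_symPinv_mul]
    rw [Matrix.mulVec_mulVec, ← hA, hu, Matrix.mulVec_mulVec]
    have := congrArg (fun W : Matrix (Fin n) (Fin p) ℝ => fun r => W r i) hm
    exact this
  have h1 : (Qᵀ *ᵥ u) ⬝ᵥ (Qᵀ *ᵥ y) = (fun r => Q r i) ⬝ᵥ y := by
    rw [← hAu, Matrix.dotProduct_mulVec, Matrix.vecMul_transpose]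
  calc ∑ j, lam j * ((fun r => whiten U lam (x r) j) ⬝ᵥ u) * ((fun r => whiten U lam (x r) j) ⬝ᵥ y)
      = (Qᵀ *ᵥ u) ⬝ᵥ (Qᵀ *ᵥ y) := by
        rw [dotProduct]
        refine Finset.sum_congr rfl fun j _ => ?_
        rw [hdot, hdot]
        have : √(lam j) * √(lam j) = lam j := Real.mul_self_sqrt (h.lam_pos j).le
        linear_combination -(((fun r => whiten U lam (x r) j) ⬝ᵥ u) *
          ((fun r => whiten U lam (x r) j) ⬝ᵥ y)) * this
    _ = √(lam i) * ((fun r => whiten U lam (x r) i) ⬝ᵥ y) := by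
        rw [h1]
        simp only [dotProduct, hcol, Finset.mul_sum, mul_assoc]

end CovariateAssumptions

end model

/-! ### Exceptional events for the head and the tail -/

section restrict

variable {I : Type*} {n : ℕ}

/-- Dividing by the largest tail eigenvalue brings the weights into `[0, 1]`, as the exponential
moment bounds require. -/
theorem mul_rowForm_tail (J : Finset I) {lam : I → ℝ} {l : ℝ} (hl : l ≠ 0) (z : I → Fin n → ℝ)
    (v : Fin n → ℝ) :
    l * rowForm (fun j : J => lam j / l) (fun j r => z j r) v
      = ∑ j ∈ J, lam j * (z j ⬝ᵥ v) ^ 2 := by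
  rw [rowForm, Finset.mul_sum, ← Finset.sum_coe_sort J]
  refine Finset.sum_congr rfl fun j _ => ?_
  have : ∑ r, v r * z j r = z j ⬝ᵥ v := Finset.sum_congr rfl fun r _ => mul_comm _ _
  rw [this]
  field_simp

theorem rowForm_head (H : Finset I) (z : I → Fin n → ℝ) (g : I → ℝ) :
    rowForm (fun _ : Fin n => 1) (fun r (j : H) => z j r) (fun j => g j)
      = (∑ j ∈ H, g j • z j) ⬝ᵥ (∑ j ∈ H, g j • z j) := by
  rw [rowForm, dotProduct]
  refine Finset.sum_congr rfl fun r _ => ?_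
  have : ∑ j : H, g j * z j r = (∑ j ∈ H, g j • z j) r := by
    rw [Finset.sum_apply, ← Finset.sum_coe_sort H]
    rfl
  rw [this]; ring

end restrict

/-- Only outer-measure subadditivity is used, so neither the good nor the bad event has to be
measurable. -/
theorem one_sub_le_prob_of_forall {Ω : Type*} [MeasurableSpace Ω] {P : Measure Ω}
    [IsProbabilityMeasure P] {G B : Set Ω} {δ : ℝ} (h : ∀ ω, ω ∉ B → ω ∈ G) (hB : P.real B ≤ δ) :
    1 - δ ≤ P.real G := by
  have h1 : (Set.univ : Set Ω) ⊆ G ∪ B := fun ω _ => by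
    by_cases hω : ω ∈ B
    · exact Or.inr hω
    · exact Or.inl (h ω hω)
  have h2 := (measureReal_mono h1 (measure_ne_top P _)).trans (measureReal_union_le (μ := P) G B)
  rw [probReal_univ] at h2
  linarith

/-- The ratio `l a / (l a + b R)` increases with `l / R`: it is at least `a / (a + b)` when `R ≤ l`,
and at least `(l / R) a / (a + b)` otherwise. -/
theorem sq_ratio_min_le {l R a b : ℝ} (hl : 0 < l) (hR : 0 < R) (ha : 0 < a) (hb : 0 < b) :
    (a / (a + b)) ^ 2 * min 1 (l ^ 2 / R ^ 2) ≤ (l * a / (l * a + b * R)) ^ 2 := by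
  rcases le_total R l with h | h
  · refine (mul_le_of_le_one_right (by positivity) (min_le_left _ _)).trans ?_
    refine pow_le_pow_left₀ (by positivity) ?_ 2
    rw [div_le_div_iff₀ (by positivity) (by positivity)]
    nlinarith [mul_le_mul_of_nonneg_left h (mul_pos ha hb).le]
  · refine (mul_le_mul_of_nonneg_left (min_le_right _ _) (by positivity)).trans ?_
    rw [← div_pow, ← mul_pow]
    refine pow_le_pow_left₀ (by positivity) ?_ 2
    rw [div_mul_div_comm, div_le_div_iff₀ (by positivity) (by positivity)]
    nlinarith [mul_le_mul_of_nonneg_left h (mul_pos (mul_pos ha ha) hl).le]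

section bounds

variable {p : ℕ} {Dsrc Dtgt : Measure (Fin p → ℝ)} {U : Matrix (Fin p) (Fin p) ℝ}
  {lam lamT : Fin p → ℝ} {σ : ℝ}

namespace CovariateAssumptions

/-- In the tail the features are the weighted rows and the dimension is `n`; in the head the
observations are the rows and the dimension is the number of features. -/
theorem tail_indepEntries (h : CovariateAssumptions Dsrc Dtgt U lam lamT σ) (n : ℕ)
    (J : Finset (Fin p)) :
    IndepEntries (fun (j : J) (r : Fin n) (x : Fin n → Fin p → ℝ) => whiten U lam (x r) j)
      (Real.toNNReal (σ ^ 2)) (Measure.pi fun _ : Fin n => Dsrc) :=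
  (h.indepEntries n).transpose.submatrix (f := Subtype.val) (g := id) Subtype.val_injective
    Function.injective_id

theorem head_indepEntries (h : CovariateAssumptions Dsrc Dtgt U lam lamT σ) (n : ℕ)
    (H : Finset (Fin p)) :
    IndepEntries (fun (r : Fin n) (j : H) (x : Fin n → Fin p → ℝ) => whiten U lam (x r) j)
      (Real.toNNReal (σ ^ 2)) (Measure.pi fun _ : Fin n => Dsrc) :=
  (h.indepEntries n).submatrix (f := id) (g := Subtype.val) Function.injective_id
    Subtype.val_injective

/-- The event that the quadratic form of the tail is not of the order of its trace plus `n` times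
its largest weight. -/
def tailUpperBad {p : ℕ} (n : ℕ) (U : Matrix (Fin p) (Fin p) ℝ) (lam : Fin p → ℝ) (C : ℝ)
    (k : Fin p) : Set (Fin n → Fin p → ℝ) :=
  {x | ∃ v : Fin n → ℝ, C * ((∑ j ∈ Finset.Ici k, lam j) + n * lam k) * (v ⬝ᵥ v) <
    ∑ j ∈ Finset.Ici k, lam j * ((fun r => whiten U lam (x r) j) ⬝ᵥ v) ^ 2}

theorem sum_tail_weights (J : Finset (Fin p)) (lam : Fin p → ℝ) (l : ℝ) :
    ∑ j : J, lam j / l = (∑ j ∈ J, lam j) / l := by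
  rw [Finset.sum_coe_sort J fun j => lam j / l, Finset.sum_div]

theorem tail_weight_le_one (h : CovariateAssumptions Dsrc Dtgt U lam lamT σ) (k : Fin p)
    (j : Finset.Ici k) : lam j / lam k ≤ 1 := by
  rw [div_le_one (h.lam_pos k)]
  exact h.lam_antitone (Finset.mem_Ici.1 j.2)

theorem sum_sq_eq_dotProduct {n : ℕ} (v : Fin n → ℝ) : ∑ d, v d ^ 2 = v ⬝ᵥ v :=
  Finset.sum_congr rfl fun _ _ => sq _

theorem prob_tailUpperBad_le (h : CovariateAssumptions Dsrc Dtgt U lam lamT σ) (hσ : 0 < σ)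
    (n : ℕ) (k : Fin p) :
    (Measure.pi fun _ : Fin n => Dsrc).real (tailUpperBad n U lam (80 * σ ^ 2) k)
      ≤ Real.exp (-(n : ℝ)) := by
  have hP := h.prob_src
  have hl := h.lam_pos k
  have h0 : ∀ j : Finset.Ici k, 0 ≤ lam j / lam k := fun j => (div_pos (h.lam_pos _) hl).le
  have hb := (h.tail_indepEntries n (Finset.Ici k)).prob_exists_lt_rowForm
    (Real.toNNReal_pos.2 (by positivity)) h0 (h.tail_weight_le_one k)
  refine le_trans (measureReal_mono ?_ (measure_ne_top _ _))
    (hb.trans (Real.exp_le_exp.2 ?_))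
  · rintro x ⟨v, hv⟩
    refine ⟨v, ?_⟩
    rw [← mul_rowForm_tail _ hl.ne'] at hv
    refine lt_of_mul_lt_mul_left (lt_of_eq_of_lt ?_ hv) hl.le
    rw [sum_tail_weights, sum_sq_eq_dotProduct, Fintype.card_fin, Real.coe_toNNReal _ (sq_nonneg σ)]
    field_simp
  · have : 0 ≤ ∑ j : Finset.Ici k, lam j / lam k := Finset.sum_nonneg fun j _ => h0 j
    rw [Fintype.card_fin]
    linarith

/-- The event that some combination of the columns in `H` is too short. -/
def headLowerBad {p : ℕ} (n : ℕ) (U : Matrix (Fin p) (Fin p) ℝ) (lam : Fin p → ℝ) (a : ℝ)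
    (H : Finset (Fin p)) : Set (Fin n → Fin p → ℝ) :=
  {x | ∃ g : Fin p → ℝ, (∑ j ∈ H, g j • fun r => whiten U lam (x r) j) ⬝ᵥ
      (∑ j ∈ H, g j • fun r => whiten U lam (x r) j) < a * n * ∑ j ∈ H, g j ^ 2}

/-- The event that the column `i` is too long. -/
def colUpperBad {p : ℕ} (n : ℕ) (U : Matrix (Fin p) (Fin p) ℝ) (lam : Fin p → ℝ) (ζ : ℝ)
    (i : Fin p) : Set (Fin n → Fin p → ℝ) :=
  {x | ζ < (fun r => whiten U lam (x r) i) ⬝ᵥ (fun r => whiten U lam (x r) i)}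

theorem prob_colUpperBad_le (h : CovariateAssumptions Dsrc Dtgt U lam lamT σ) (hσ : 0 < σ)
    (n : ℕ) (i : Fin p) :
    (Measure.pi fun _ : Fin n => Dsrc).real (colUpperBad n U lam (8 * σ ^ 2 * n) i)
      ≤ Real.exp (-(n : ℝ)) := by
  have hP := h.prob_src
  have hb := (h.indepEntries n).prob_lt_weighted_sum_norm
    (Real.toNNReal_pos.2 (by positivity)) (w := fun _ => 1) (fun _ => zero_le_one) {i}
  rw [Fintype.card_fin, Real.coe_toNNReal _ (sq_nonneg σ)] at hb
  refine le_trans (measureReal_mono (fun x hx => ?_) (measure_ne_top _ _)) hb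
  have hx' : 8 * σ ^ 2 * n
    < (fun r => whiten U lam (x r) i) ⬝ᵥ (fun r => whiten U lam (x r) i) := hx
  rw [← sum_sq_eq_dotProduct] at hx'
  simpa using hx'

end CovariateAssumptions

end bounds

/-! ### Assembly of the two variance bounds -/

section deterministic

variable {I N : Type*} [Fintype I] [DecidableEq I] [Fintype N] {z : I → N → ℝ} {lam lamT : I → ℝ}

theorem sum_mul_norm_le_of_solvesNormalEq {u : I → N → ℝ} (hu : ∀ i, SolvesNormalEq z lam i (u i))
    (hlam : ∀ j, 0 < lam j) (hT : ∀ j, 0 ≤ lamT j) {J : Finset I} {α β γ δ : ℝ} (hα : 0 < α)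
    (hβ : 0 < β) (hγ : 0 < γ)
    (hlow : ∀ v, α * (v ⬝ᵥ v) ≤ ∑ j ∈ J, lam j * (z j ⬝ᵥ v) ^ 2)
    (hup : ∀ v, ∑ j ∈ J, lam j * (z j ⬝ᵥ v) ^ 2 ≤ β * (v ⬝ᵥ v))
    (hhead : ∀ g : I → ℝ, γ * ∑ j ∈ Jᶜ, g j ^ 2
      ≤ (∑ j ∈ Jᶜ, g j • z j) ⬝ᵥ (∑ j ∈ Jᶜ, g j • z j))
    (hcol : ∑ i ∈ J, lamT i * lam i * (z i ⬝ᵥ z i) ≤ δ) :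
    ∑ i, lamT i * (u i ⬝ᵥ u i) ≤ β / (α * γ) * ∑ i ∈ Jᶜ, lamT i / lam i + δ / α ^ 2 := by
  rw [← Finset.sum_compl_add_sum J]
  refine add_le_add ?_ ?_
  · rw [Finset.mul_sum]
    refine Finset.sum_le_sum fun i hi => ?_
    refine (mul_le_mul_of_nonneg_left ((hu i).norm_le_of_head hlam (Finset.mem_compl.1 hi) hα hβ hγ
      hlow hup hhead) (hT i)).trans (le_of_eq ?_)
    have := (hlam i).ne'
    field_simp
  · refine le_trans ?_ (div_le_div_of_nonneg_right hcol (sq_nonneg α))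
    rw [Finset.sum_div]
    refine Finset.sum_le_sum fun i _ => ?_
    refine (mul_le_mul_of_nonneg_left ((hu i).norm_le hlam hα (hlow _)) (hT i)).trans
      (le_of_eq ?_)
    ring

end deterministic

section bounds

variable {p : ℕ} {Dsrc Dtgt : Measure (Fin p → ℝ)} {U : Matrix (Fin p) (Fin p) ℝ}
  {lam lamT : Fin p → ℝ} {σ : ℝ}

/-- The event that the quadratic form of the tail is not at least of the order of its trace. -/
def tailLowerBad {p : ℕ} (n : ℕ) (U : Matrix (Fin p) (Fin p) ℝ) (lam : Fin p → ℝ) (t : ℝ)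
    (k : Fin p) : Set (Fin n → Fin p → ℝ) :=
  {x | ∃ v : Fin n → ℝ, ∑ j ∈ Finset.Ici k, lam j * ((fun r => whiten U lam (x r) j) ⬝ᵥ v) ^ 2
    < t * (∑ j ∈ Finset.Ici k, lam j) * (v ⬝ᵥ v)}

/-- With weights `λ_j / λ_{k+1}` in dimension `n`, the condition `ρ_k ≥ 2` says exactly that the
total weight is at least twice the dimension. -/
theorem exists_prob_tailLowerBad_le (hσ : 0 < σ) : ∃ t n₀ : ℝ, 0 < t ∧ t ≤ 1 ∧
    ∀ (n p : ℕ) (k : Fin p) (Dsrc Dtgt : Measure (Fin p → ℝ)) (U : Matrix (Fin p) (Fin p) ℝ)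
      (lam lamT : Fin p → ℝ), CovariateAssumptions Dsrc Dtgt U lam lamT σ → n₀ ≤ n → 0 < n →
      2 ≤ effRank lam n k →
      (Measure.pi fun _ : Fin n => Dsrc).real (tailLowerBad n U lam t k)
        ≤ 3 * Real.exp (-t * n) := by
  obtain ⟨t, n₀, ht, ht1, -, H⟩ := exists_prob_rowForm_lt_of_two_mul_le
    (Real.toNNReal_pos.2 (by positivity : 0 < σ ^ 2))
  refine ⟨t, n₀, ht, ht1, fun n p k Dsrc Dtgt U lam lamT h hn hn0 hr => ?_⟩
  have hP := h.prob_src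
  have hl := h.lam_pos k
  have hn0' : (0 : ℝ) < n := by exact_mod_cast hn0
  have hb := H (Fin n → Fin p → ℝ) (Finset.Ici k) (Fin n) (Measure.pi fun _ : Fin n => Dsrc) _
    (fun j => lam j / lam k) (h.tail_indepEntries n (Finset.Ici k))
    (fun j => (div_pos (h.lam_pos _) hl).le) (CovariateAssumptions.tail_weight_le_one h k)
    (by rwa [Fintype.card_fin])
    (by
      rw [CovariateAssumptions.sum_tail_weights, Fintype.card_fin, le_div_iff₀ hl]
      rw [effRank, le_div_iff₀ (by positivity)] at hr
      linarith)
  rw [Fintype.card_fin] at hb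
  refine le_trans (measureReal_mono ?_ (measure_ne_top _ _)) hb
  rintro x ⟨v, hv⟩
  refine ⟨v, ?_⟩
  rw [← mul_rowForm_tail _ hl.ne'] at hv
  refine lt_of_mul_lt_mul_left (hv.trans_eq ?_) hl.le
  rw [CovariateAssumptions.sum_tail_weights, CovariateAssumptions.sum_sq_eq_dotProduct]
  field_simp

theorem exists_prob_headLowerBad_le (hσ : 0 < σ) : ∃ a a₁ : ℝ, 0 < a ∧ 0 < a₁ ∧ a ≤ 1 ∧
    ∀ (n p : ℕ) (H : Finset (Fin p)) (Dsrc Dtgt : Measure (Fin p → ℝ))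
      (U : Matrix (Fin p) (Fin p) ℝ) (lam lamT : Fin p → ℝ),
      CovariateAssumptions Dsrc Dtgt U lam lamT σ → (H.card : ℝ) ≤ a₁ * n →
      (Measure.pi fun _ : Fin n => Dsrc).real (CovariateAssumptions.headLowerBad n U lam a H)
        ≤ 2 * Real.exp (-a * n) := by
  obtain ⟨a, a₁, ha, ha₁, ha1, -, F⟩ := exists_prob_rowForm_lt_of_tall
    (Real.toNNReal_pos.2 (by positivity : 0 < σ ^ 2))
  refine ⟨a, a₁, ha, ha₁, ha1, fun n p H Dsrc Dtgt U lam lamT h hH => ?_⟩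
  have hP := h.prob_src
  have hb := F (Fin n → Fin p → ℝ) (Fin n) H (Measure.pi fun _ : Fin n => Dsrc) _
    (fun _ => 1) (h.head_indepEntries n H) (fun _ => zero_le_one) (fun _ => le_rfl)
    (by simpa using hH)
  simp only [Finset.sum_const, Finset.card_univ, Fintype.card_fin, nsmul_eq_mul, mul_one] at hb
  refine le_trans (measureReal_mono ?_ (measure_ne_top _ _)) hb
  rintro x ⟨g, hg⟩
  refine ⟨fun j => g j, ?_⟩
  rw [← rowForm_head H (fun j r => whiten U lam (x r) j)] at hg
  rwa [Finset.sum_coe_sort H fun j => g j ^ 2]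

theorem card_compl_Ici {p : ℕ} (k : Fin p) : ((Finset.Ici k)ᶜ).card = k := by
  have : (Finset.Ici k)ᶜ = Finset.Iio k := by ext; simp
  rw [this, Fin.card_Iio]

theorem exp_neg_mul_le {a c x : ℝ} (hc : 0 < c) (h : 1 / a ≤ c) (ha : 0 < a) (hx : 0 ≤ x) :
    Real.exp (-a * x) ≤ Real.exp (-x / c) := by
  refine Real.exp_le_exp.2 ?_
  rw [neg_mul, neg_div, neg_le_neg_iff, div_le_iff₀ hc]
  rw [div_le_iff₀ ha] at h
  nlinarith

/-- The event that the weighted columns of the tail are too long. -/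
def colSumUpperBad {p : ℕ} (n : ℕ) (U : Matrix (Fin p) (Fin p) ℝ) (lam w : Fin p → ℝ) (C : ℝ)
    (k : Fin p) : Set (Fin n → Fin p → ℝ) :=
  {x | C * n * ∑ i ∈ Finset.Ici k, w i < ∑ i ∈ Finset.Ici k, w i *
    ((fun r => whiten U lam (x r) i) ⬝ᵥ (fun r => whiten U lam (x r) i))}

theorem prob_colSumUpperBad_le (h : CovariateAssumptions Dsrc Dtgt U lam lamT σ) (hσ : 0 < σ)
    (n : ℕ) (k : Fin p) {w : Fin p → ℝ} (hw : ∀ i, 0 ≤ w i) :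
    (Measure.pi fun _ : Fin n => Dsrc).real (colSumUpperBad n U lam w (8 * σ ^ 2) k)
      ≤ Real.exp (-(n : ℝ)) := by
  have hP := h.prob_src
  have hb := (h.indepEntries n).prob_lt_weighted_sum_norm
    (Real.toNNReal_pos.2 (by positivity)) hw (Finset.Ici k)
  rw [Fintype.card_fin, Real.coe_toNNReal _ (sq_nonneg σ)] at hb
  refine le_trans (measureReal_mono (fun x hx => ?_) (measure_ne_top _ _)) hb
  have hx' : 8 * σ ^ 2 * n * ∑ i ∈ Finset.Ici k, w i < ∑ i ∈ Finset.Ici k, w i *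
    ((fun r => whiten U lam (x r) i) ⬝ᵥ (fun r => whiten U lam (x r) i)) := hx
  simp_rw [← CovariateAssumptions.sum_sq_eq_dotProduct] at hx'
  exact hx'

theorem exists_variance_le (hσ : 0 < σ) : ∃ c₀ : ℝ, ∀ c : ℝ, c₀ ≤ c → 1 < c →
    ∀ (n p : ℕ) (k : Fin p), 0 < (k : ℕ) → ((k : ℕ) : ℝ) < n / c →
    ∀ (Dsrc Dtgt : Measure (Fin p → ℝ)) (U : Matrix (Fin p) (Fin p) ℝ) (lam lamT : Fin p → ℝ),
      CovariateAssumptions Dsrc Dtgt U lam lamT σ →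
    ∀ (ν : Measure ℝ) (v : ℝ), NoiseAssumptions ν v → 2 ≤ effRank lam n k →
      1 - 7 * Real.exp (-(n : ℝ) / c) ≤
        (Measure.pi fun _ : Fin n => Dsrc).real
          {x : Fin n → Fin p → ℝ |
            normalizedVariance (secondMoment Dtgt) ν v (Matrix.of x)
              ≤ c * (1 / n * ∑ i ∈ Finset.Iio k, lamT i / lam i
                  + n * ((∑ i ∈ Finset.Ici k, lamT i * lam i) /
                      (∑ i ∈ Finset.Ici k, lam i) ^ 2))} := by
  obtain ⟨t, n₀, ht, ht1, Htail⟩ := exists_prob_tailLowerBad_le hσ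
  obtain ⟨a, a₁, ha, ha₁, ha1, Hhead⟩ := exists_prob_headLowerBad_le hσ
  -- The first two entries turn the probabilities into powers of `exp (-n / c)`; the next two give
  -- `n ≥ n₀` and `k ≤ a₁ n`. The last two are the coefficients of the head and tail sums for `α = t
  -- S`, `β = 120 σ² S`, `γ = a n`.
  refine ⟨max (max (1 / t) (1 / a)) (max (max n₀ (1 / a₁)) (max (120 * σ ^ 2 / (t * a))
    (8 * σ ^ 2 / t ^ 2))), fun c hc hc1 n p k hk hkn Dsrc Dtgt U lam lamT h ν v hν hr => ?_⟩
  simp only [max_le_iff] at hc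
  obtain ⟨⟨hct, hca⟩, ⟨hcn, hca₁⟩, hcC, hcD⟩ := hc
  have hP := h.prob_src
  have hc0 : 0 < c := by linarith
  have hk1 : (1 : ℝ) ≤ (k : ℕ) := by exact_mod_cast hk
  -- Since `1 ≤ k < n / c`, the sample size exceeds `c`, hence every threshold included in `c`.
  have hcn' : c < n := by
    rw [lt_div_iff₀ hc0] at hkn
    nlinarith
  have hn0 : (0 : ℝ) < n := by linarith
  have hka : (((Finset.Ici k)ᶜ).card : ℝ) ≤ a₁ * n := by
    rw [card_compl_Ici]
    refine hkn.le.trans ?_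
    rw [div_le_iff₀ ha₁] at hca₁
    rw [div_le_iff₀ hc0]
    nlinarith
  have hlam := h.lam_pos
  have hT := h.lamT_nonneg
  set S := ∑ j ∈ Finset.Ici k, lam j with hS
  have hr' : 2 * (n * lam k) ≤ S := by
    rwa [effRank, le_div_iff₀ (mul_pos hn0 (hlam k))] at hr
  have hSp : 0 < S := lt_of_lt_of_le (by have := hlam k; positivity) hr'
  have hw : ∀ i, 0 ≤ lamT i * lam i := fun i => mul_nonneg (hT i) (hlam i).le
  refine one_sub_le_prob_of_forall (B := (tailLowerBad n U lam t k ∪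
    CovariateAssumptions.tailUpperBad n U lam (80 * σ ^ 2) k) ∪
    (CovariateAssumptions.headLowerBad n U lam a (Finset.Ici k)ᶜ ∪
      colSumUpperBad n U lam (fun i => lamT i * lam i) (8 * σ ^ 2) k)) (fun x hx => ?_) ?_
  · simp only [Set.mem_union, not_or] at hx
    obtain ⟨⟨h1, h2⟩, h3, h4⟩ := hx
    simp only [tailLowerBad, CovariateAssumptions.tailUpperBad, CovariateAssumptions.headLowerBad,
      colSumUpperBad, Set.mem_ofPred_eq, not_exists, not_lt] at h1 h2 h3 h4
    rw [Set.mem_ofPred_eq, normalizedVariance_eq hν h.orthogonal h.diag_tgt]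
    have hβ : 80 * σ ^ 2 * (S + n * lam k) ≤ 120 * σ ^ 2 * S := by
      nlinarith [mul_le_mul_of_nonneg_left hr' (sq_nonneg σ)]
    refine (sum_mul_norm_le_of_solvesNormalEq (h.solvesNormalEq x) hlam hT (mul_pos ht hSp)
      (by positivity : 0 < 120 * σ ^ 2 * S) (mul_pos ha hn0) h1
      (fun v => (h2 v).trans (mul_le_mul_of_nonneg_right hβ (dotProduct_self_nonneg' v))) h3
      h4).trans ?_
    have hc' : (Finset.Ici k)ᶜ = Finset.Iio k := by ext; simp
    rw [hc', mul_add]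
    refine add_le_add ?_ ?_
    · rw [← mul_assoc c]
      refine mul_le_mul_of_nonneg_right ?_
        (Finset.sum_nonneg fun i _ => div_nonneg (hT i) (hlam i).le)
      refine le_trans (le_of_eq ?_) (mul_le_mul_of_nonneg_right hcC (by positivity))
      field_simp
    · refine le_trans (le_of_eq ?_) (mul_le_mul_of_nonneg_right hcD
        (mul_nonneg hn0.le (div_nonneg (Finset.sum_nonneg fun i _ => hw i) (sq_nonneg S))))
      field_simp
  · have e1 := exp_neg_mul_le hc0 hct ht hn0.le
    have e2 := exp_neg_mul_le hc0 hca ha hn0.le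
    have e3 : Real.exp (-(n : ℝ)) ≤ Real.exp (-(n : ℝ) / c) := by
      simpa using exp_neg_mul_le hc0 (by simpa using hc1.le) one_pos hn0.le
    have b1 := Htail n p k Dsrc Dtgt U lam lamT h (by linarith) (by exact_mod_cast hn0) hr
    have b2 := h.prob_tailUpperBad_le hσ n k
    have b3 := Hhead n p (Finset.Ici k)ᶜ Dsrc Dtgt U lam lamT h hka
    have b4 := prob_colSumUpperBad_le h hσ n k hw
    -- The four events contribute `3 + 1 + 2 + 1 = 7`.
    refine (measureReal_union_le _ _).trans ?_
    refine (add_le_add (measureReal_union_le _ _) (measureReal_union_le _ _)).trans ?_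
    linarith

theorem exists_le_variance (hσ : 0 < σ) : ∃ c₀ : ℝ, ∀ c : ℝ, c₀ ≤ c → 1 < c →
    ∀ (n p : ℕ) (k : Fin p), 0 < (k : ℕ) → ((k : ℕ) : ℝ) < n / c →
    ∀ (Dsrc Dtgt : Measure (Fin p → ℝ)) (U : Matrix (Fin p) (Fin p) ℝ) (lam lamT : Fin p → ℝ),
      CovariateAssumptions Dsrc Dtgt U lam lamT σ →
    ∀ (ν : Measure ℝ) (v : ℝ), NoiseAssumptions ν v →
      1 - 7 * Real.exp (-(n : ℝ) / c) ≤
        (Measure.pi fun _ : Fin n => Dsrc).real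
          {x : Fin n → Fin p → ℝ |
            1 / (c * n) * ∑ i, lamT i / lam i *
                min 1 (lam i ^ 2 / (lam k ^ 2 * (effRank lam n k + 1) ^ 2))
              ≤ normalizedVariance (secondMoment Dtgt) ν v (Matrix.of x)} := by
  obtain ⟨a, a₁, ha, ha₁, ha1, Hhead⟩ := exists_prob_headLowerBad_le hσ
  -- The constant of `le_norm` for `γ = a n`, `β = 80 σ² n R` and `ζ = 8 σ² n`. Requiring `c ≥ 2 /
  -- κ` absorbs the half of the sum lost to bad indices.
  set κ := (a / (a + 80 * σ ^ 2)) ^ 2 / (8 * σ ^ 2) with hκ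
  have hκp : 0 < κ := by positivity
  refine ⟨max (1 / a) (max (2 / a₁) (2 / κ)),
    fun c hc hc1 n p k hk hkn Dsrc Dtgt U lam lamT h ν v hν => ?_⟩
  simp only [max_le_iff] at hc
  obtain ⟨hca, hca₁, hcκ⟩ := hc
  have hP := h.prob_src
  have hc0 : 0 < c := by linarith
  have hk1 : (1 : ℝ) ≤ (k : ℕ) := by exact_mod_cast hk
  rw [lt_div_iff₀ hc0] at hkn
  have hn0 : (0 : ℝ) < n := by nlinarith
  -- Adjoining `i` gives at most `k + 1 ≤ 2 k` columns, whence `2 / a₁` in the choice of `c`.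
  have hka : ∀ i : Fin p, ((insert i (Finset.Ici k)ᶜ).card : ℝ) ≤ a₁ * n := by
    intro i
    have h1 : ((insert i (Finset.Ici k)ᶜ).card : ℝ) ≤ (k : ℕ) + 1 := by
      have := Finset.card_insert_le i (Finset.Ici k)ᶜ
      rw [card_compl_Ici] at this
      exact_mod_cast this
    rw [div_le_iff₀ ha₁] at hca₁
    nlinarith [mul_le_mul_of_nonneg_right hca₁ (by linarith : (0 : ℝ) ≤ (k : ℕ)),
      mul_le_mul_of_nonneg_right hkn.le ha₁.le]
  have hlam := h.lam_pos
  have hT := h.lamT_nonneg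
  set S := ∑ j ∈ Finset.Ici k, lam j with hS
  have hSn : 0 ≤ S := Finset.sum_nonneg fun j _ => (hlam j).le
  set R := lam k * (effRank lam n k + 1) with hR
  have hlk := hlam k
  have hnR : n * R = S + n * lam k := by
    rw [hR, effRank, ← hS]; field_simp
  have hRp : 0 < R := by
    refine pos_of_mul_pos_right (a := (n : ℝ)) ?_ hn0.le
    rw [hnR]; positivity
  simp_rw [← mul_pow, ← hR]
  set s : Fin p → ℝ := fun i => lamT i / lam i * min 1 (lam i ^ 2 / R ^ 2) with hs
  have hs0 : ∀ i, 0 ≤ s i := fun i => mul_nonneg (div_nonneg (hT i) (hlam i).le)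
    (le_min zero_le_one (by positivity))
  set bad : Fin p → Set (Fin n → Fin p → ℝ) := fun i =>
    CovariateAssumptions.headLowerBad n U lam a (insert i (Finset.Ici k)ᶜ) ∪
      CovariateAssumptions.colUpperBad n U lam (8 * σ ^ 2 * n) i with hbad
  have e2 := exp_neg_mul_le hc0 hca ha hn0.le
  have e3 : Real.exp (-(n : ℝ)) ≤ Real.exp (-(n : ℝ) / c) := by
    simpa using exp_neg_mul_le hc0 (by simpa using hc1.le) one_pos hn0.le
  have hbadP : ∀ i, (Measure.pi fun _ : Fin n => Dsrc).real (bad i)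
      ≤ 3 * Real.exp (-(n : ℝ) / c) := by
    intro i
    have b3 := Hhead n p _ Dsrc Dtgt U lam lamT h (hka i)
    have b4 := h.prob_colUpperBad_le hσ n i
    refine (measureReal_union_le _ _).trans ?_
    linarith
  refine one_sub_le_prob_of_forall (B := CovariateAssumptions.tailUpperBad n U lam (80 * σ ^ 2) k ∪
    {x | (∑ i, s i) / 2 < ∑ i, (bad i).indicator (fun _ => s i) x}) (fun x hx => ?_) ?_
  · simp only [Set.mem_union, not_or, CovariateAssumptions.tailUpperBad, Set.mem_ofPred_eq,
      not_exists, not_lt] at hx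
    obtain ⟨h1, h2⟩ := hx
    rw [Set.mem_ofPred_eq, normalizedVariance_eq hν h.orthogonal h.diag_tgt]
    have key : ∀ i, κ / n * (s i - (bad i).indicator (fun _ => s i) x) ≤ lamT i *
        ((symPinv (of x * (of x)ᵀ) *ᵥ (fun r => (of x * U) r i)) ⬝ᵥ
          (symPinv (of x * (of x)ᵀ) *ᵥ (fun r => (of x * U) r i))) := by
      intro i
      by_cases hi : x ∈ bad i
      · rw [Set.indicator_of_mem hi, sub_self, mul_zero]
        exact mul_nonneg (hT i) (dotProduct_self_nonneg' _)
      · rw [Set.indicator_of_notMem hi, sub_zero]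
        simp only [hbad, Set.mem_union, not_or, CovariateAssumptions.headLowerBad,
          CovariateAssumptions.colUpperBad, Set.mem_ofPred_eq, not_exists, not_lt] at hi
        have hli := hlam i
        have hle := (h.solvesNormalEq x i).le_norm hlam
          (by positivity : 0 < 80 * σ ^ 2 * (S + n * lam k)) (mul_pos ha hn0)
          (by positivity : 0 < 8 * σ ^ 2 * n) h1 hi.1 hi.2
        have hmin := sq_ratio_min_le hli hRp ha (by positivity : 0 < 80 * σ ^ 2)
        have e : lam i * (a * n) / (lam i * (a * n) + 80 * σ ^ 2 * (S + n * lam k))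
            = lam i * a / (lam i * a + 80 * σ ^ 2 * R) := by
          rw [← hnR]
          have : lam i * a + 80 * σ ^ 2 * R ≠ 0 := by positivity
          rw [show lam i * (a * n) + 80 * σ ^ 2 * (n * R)
            = n * (lam i * a + 80 * σ ^ 2 * R) by ring]
          field_simp
        rw [e] at hle
        refine le_trans (le_of_eq ?_) (mul_le_mul_of_nonneg_left
          ((div_le_div_of_nonneg_right hmin (by positivity)).trans hle) (hT i))
        simp only [hs, hκ]
        field_simp
    refine le_trans ?_ (Finset.sum_le_sum fun i _ => key i)
    rw [← Finset.mul_sum, Finset.sum_sub_distrib]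
    have hs1 : 0 ≤ ∑ i, s i := Finset.sum_nonneg fun i _ => hs0 i
    have hκc : 1 / (c * n) ≤ κ / n / 2 := by
      rw [div_le_iff₀ hκp] at hcκ
      rw [div_div, div_le_div_iff₀ (by positivity) (by positivity)]
      nlinarith
    refine (mul_le_mul_of_nonneg_right hκc hs1).trans ?_
    rw [div_mul_eq_mul_div, ← mul_div_assoc']
    exact mul_le_mul_of_nonneg_left (by linarith) (by positivity)
  · have b2 := h.prob_tailUpperBad_le hσ n k
    have b5 := prob_half_lt_sum_le (P := Measure.pi fun _ : Fin n => Dsrc) hs0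
      (by positivity) hbadP
    refine (measureReal_union_le _ _).trans ?_
    linarith

end bounds

theorem theorem3p2 :
    ∃ b : ℝ, 1 < b ∧ ∀ σ : ℝ, 0 < σ → ∃ c : ℝ, 1 < c ∧
      ∀ (n p : ℕ), n < p →
      ∀ (k : Fin p), 0 < (k : ℕ) → ((k : ℕ) : ℝ) < n / c →
      ∀ (Dsrc Dtgt : Measure (Fin p → ℝ)) (U : Matrix (Fin p) (Fin p) ℝ) (lam lamT : Fin p → ℝ),
        CovariateAssumptions Dsrc Dtgt U lam lamT σ →
      ∀ (ν : Measure ℝ) (v : ℝ), NoiseAssumptions ν v →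
        (1 - 10 * Real.exp (-(n : ℝ) / c) ≤
          (Measure.pi fun _ : Fin n => Dsrc).real
            {x : Fin n → Fin p → ℝ |
              1 / (c * n) * ∑ i, lamT i / lam i *
                  min 1 (lam i ^ 2 / (lam k ^ 2 * (effRank lam n k + 1) ^ 2))
                ≤ normalizedVariance (secondMoment Dtgt) ν v (Matrix.of x)}) ∧
        (b ≤ effRank lam n k →
          1 - 7 * Real.exp (-(n : ℝ) / c) ≤
            (Measure.pi fun _ : Fin n => Dsrc).real
              {x : Fin n → Fin p → ℝ |
                normalizedVariance (secondMoment Dtgt) ν v (Matrix.of x)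
                  ≤ c * (1 / n * ∑ i ∈ Finset.Iio k, lamT i / lam i
                      + n * ((∑ i ∈ Finset.Ici k, lamT i * lam i) /
                          (∑ i ∈ Finset.Ici k, lam i) ^ 2))}) := by
  -- The value `2` is the ratio of total weight to dimension in
  -- `exists_prob_rowForm_lt_of_two_mul_le`, which is the same for every `σ`.
  refine ⟨2, one_lt_two, fun σ hσ => ?_⟩
  obtain ⟨c₁, h₁⟩ := exists_le_variance hσ
  obtain ⟨c₂, h₂⟩ := exists_variance_le hσ
  set c := max 2 (max c₁ c₂)
  have hc : 1 < c := one_lt_two.trans_le (le_max_left _ _)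
  have hc₁ : c₁ ≤ c := (le_max_left _ _).trans (le_max_right _ _)
  have hc₂ : c₂ ≤ c := (le_max_right _ _).trans (le_max_right _ _)
  refine ⟨c, hc, fun n p _ k hk hkn Dsrc Dtgt U lam lamT h ν v hν => ⟨?_, fun hr => ?_⟩⟩
  · refine le_trans ?_ (h₁ c hc₁ hc n p k hk hkn Dsrc Dtgt U lam lamT h ν v hν)
    linarith [Real.exp_pos (-(n : ℝ) / c)]
  · exact h₂ c hc₂ hc n p k hk hkn Dsrc Dtgt U lam lamT h ν v hν hr
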